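/- We work in the PL category: manifolds are Hausdorff, second countable piecewise linear manifolds, possibly with boundary, of a fixed dimension $n\ge 1$, and homeomorphisms and embeddings are PL. No connectedness is assumed. Definitions. A manifold $U$ with compact boundary is a homotopy collar if the inclusion $\partial U\hookrightarrow U$ is a homotopy equivalence. A subset $V\subset U$ is a neighborhood of infinity if $\overline{U\setminus V}$ is compact. A pseudo-collar is a homotopy collar $U$ that contains arbitrarily small homotopy collar neighborhoods of infinity: every neighborhood of infinity in $U$ contains a neighborhood of infinity $V$ that is a closed codimension $0$ PL submanifold of $U$, whose boundary $\partial V$ is its topological frontier and is bicollared in $U$, and that is itself a homotopy collar. A compact cobordism $(W,M,N)$ is a compact manifold $W$ with $\partial W=M\sqcup N$, where $M$ and $N$ are closed in $W$; it is a one-sided h-cobordism if at least one of the inclusions $M\hookrightarrow W$, $N\hookrightarrow W$ is a homotopy equivalence. Proposition. Let $\{(W_i,M_i,N_i)\}_{i=1}^{\infty}$ be a sequence of $n$-dimensional one-sided h-cobordisms such that each inclusion $M_i\hookrightarrow W_i$ is a homotopy equivalence, and suppose that for each $i\ge 1$ there is a PL homeomorphism $h_i\colon N_i\to M_{i+1}$.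 Then the adjunction space $$U=W_1\cup_{h_1}W_2\cup_{h_2}W_3\cup_{h_3}\cdots,$$ with the PL structure in which each $W_i$ is PL embedded, is a pseudo-collar, with $\partial U=M_1$. Conversely, for every $n$-dimensional pseudo-collar $U$ there are such a sequence $\{(W_i,M_i,N_i)\}_{i=1}^{\infty}$ and such PL homeomorphisms $h_i$ for which $U$ is PL homeomorphic to the adjunction space $W_1\cup_{h_1}W_2\cup_{h_2}\cdots$, by a homeomorphism that embeds each $W_i$ piecewise linearly in $U$ and takes $M_1$ to $\partial U$. -/

import Mathlib

open Set Filter Topology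
open scoped Manifold ContinuousMap

universe u

/-! ### Piecewise linear maps -/

/-- A (closed, convex, possibly unbounded, lower-dimensional or empty) polyhedron: an intersection
of finitely many closed half-spaces. -/
def IsPolyhedron {E : Type*} [AddCommGroup E] [Module ℝ E] (P : Set E) : Prop :=
  ∃ s : Set (E →ᵃ[ℝ] ℝ), s.Finite ∧ P = {x | ∀ g ∈ s, g x ≤ 0}

/-- `b` is, along the filter `l`, a piecewise linear function of `a`: finitely many polyhedra
cover the values of `a`, and on each of them `b` is an affine function of `a`. -/
def IsPLGerm {Z E F : Type*} [AddCommGroup E] [Module ℝ E] [AddCommGroup F] [Module ℝ F]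
    (l : Filter Z) (a : Z → E) (b : Z → F) : Prop :=
  ∃ T : Set (Set E × (E →ᵃ[ℝ] F)), T.Finite ∧ (∀ p ∈ T, IsPolyhedron p.1) ∧
    ∀ᶠ z in l, (∃ p ∈ T, a z ∈ p.1) ∧ ∀ p ∈ T, a z ∈ p.1 → b z = p.2 (a z)

theorem IsPLGerm.refl {Z E : Type*} [AddCommGroup E] [Module ℝ E] (l : Filter Z) (a : Z → E) :
    IsPLGerm l a a := by
  refine ⟨{(univ, AffineMap.id ℝ E)}, finite_singleton _, ?_, ?_⟩
  · rintro p rfl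
    exact ⟨∅, finite_empty, by simp⟩
  · exact Eventually.of_forall fun z => by simp

theorem IsPLGerm.trans {Z E F G : Type*} [AddCommGroup E] [Module ℝ E] [AddCommGroup F]
    [Module ℝ F] [AddCommGroup G] [Module ℝ G] {l : Filter Z} {a : Z → E} {b : Z → F} {c : Z → G}
    (h₁ : IsPLGerm l a b) (h₂ : IsPLGerm l b c) : IsPLGerm l a c := by
  obtain ⟨T, hT, hP, hab⟩ := h₁
  obtain ⟨T', hT', hP', hbc⟩ := h₂
  refine ⟨image2 (fun p q => (p.1 ∩ p.2 ⁻¹' q.1, q.2.comp p.2)) T T', hT.image2 _ hT', ?_, ?_⟩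
  · rintro _ ⟨p, hp, q, hq, rfl⟩
    obtain ⟨s, hs, hps⟩ := hP p hp
    obtain ⟨t, ht, hqt⟩ := hP' q hq
    refine ⟨s ∪ (fun g => g.comp p.2) '' t, hs.union (ht.image _), ?_⟩
    ext x
    constructor
    · rintro ⟨h1, h2⟩ g (hg | ⟨g, hg, rfl⟩)
      · rw [hps] at h1; exact h1 g hg
      · rw [mem_preimage, hqt] at h2; exact h2 g hg
    · intro h
      refine ⟨?_, ?_⟩
      · rw [hps]; exact fun g hg => h g (Or.inl hg)
      · change p.2 x ∈ q.1
        rw [hqt]; exact fun g hg => h _ (Or.inr ⟨g, hg, rfl⟩)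
  · filter_upwards [hab, hbc] with z h1 h2
    obtain ⟨⟨p, hp, hpz⟩, h1⟩ := h1
    obtain ⟨⟨q, hq, hqz⟩, h2⟩ := h2
    refine ⟨⟨_, ⟨p, hp, q, hq, rfl⟩, hpz, ?_⟩, ?_⟩
    · change p.2 (a z) ∈ q.1
      rwa [← h1 p hp hpz]
    · rintro _ ⟨p', hp', q', hq', rfl⟩ ⟨hz, hz'⟩
      have e := h1 p' hp' hz
      change p'.2 (a z) ∈ q'.1 at hz'
      rw [← e] at hz'
      rw [h2 q' hq' hz', e]; rfl

theorem IsPLGerm.comp_tendsto {Z Z' E F : Type*} [AddCommGroup E] [Module ℝ E] [AddCommGroup F]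
    [Module ℝ F] {l : Filter Z} {l' : Filter Z'} {a : Z → E} {b : Z → F} {f : Z' → Z}
    (h : IsPLGerm l a b) (hf : Tendsto f l' l) : IsPLGerm l' (a ∘ f) (b ∘ f) := by
  obtain ⟨T, hT, hP, hab⟩ := h
  exact ⟨T, hT, hP, hf.eventually hab⟩

theorem IsPLGerm.congr {Z E F : Type*} [AddCommGroup E] [Module ℝ E] [AddCommGroup F]
    [Module ℝ F] {l : Filter Z} {a : Z → E} {b b' : Z → F}
    (h : IsPLGerm l a b) (hb : b' =ᶠ[l] b) : IsPLGerm l a b' := by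
  obtain ⟨T, hT, hP, hab⟩ := h
  refine ⟨T, hT, hP, ?_⟩
  filter_upwards [hab, hb] with z h1 h2
  exact ⟨h1.1, fun p hp hz => h2.trans (h1.2 p hp hz)⟩

/-- Continuous maps between open subsets of Euclidean half-space that are locally piecewise
linear. -/
noncomputable def plPregroupoid (n : ℕ) [NeZero n] : Pregroupoid (EuclideanHalfSpace n) where
  property f s := ContinuousOn f s ∧
    ∀ x ∈ s, IsPLGerm (𝓝[s] x) (fun y => (y : EuclideanHalfSpace n).val) (fun y => (f y).val)
  comp := by
    rintro f g u v ⟨hf, hf'⟩ ⟨hg, hg'⟩ _ _ _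
    refine ⟨hg.comp (hf.mono inter_subset_left) fun x hx => hx.2, fun x hx => ?_⟩
    have ht : Tendsto f (𝓝[u ∩ f ⁻¹' v] x) (𝓝[v] (f x)) :=
      ((hf x hx.1).mono inter_subset_left).tendsto_nhdsWithin fun y hy => hy.2
    have h1 : IsPLGerm (𝓝[u ∩ f ⁻¹' v] x) (fun y => (y : EuclideanHalfSpace n).val)
        (fun y => (f y).val) :=
      (hf' x hx.1).comp_tendsto (f := id) (nhdsWithin_mono x inter_subset_left)
    exact h1.trans ((hg' (f x) hx.2).comp_tendsto ht)
  id_mem := ⟨continuousOn_id, fun _ _ => IsPLGerm.refl _ _⟩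
  locality := by
    intro f u hu h
    have key : ∀ x ∈ u, ∃ v, IsOpen v ∧ x ∈ v ∧ 𝓝[u ∩ v] x = 𝓝[u] x ∧
        ContinuousOn f (u ∩ v) ∧ ∀ x ∈ u ∩ v, IsPLGerm (𝓝[u ∩ v] x)
          (fun y => (y : EuclideanHalfSpace n).val) (fun y => (f y).val) := by
      intro x hx
      obtain ⟨v, hv, hxv, hc, hp⟩ := h x hx
      exact ⟨v, hv, hxv, nhdsWithin_inter_of_mem' (mem_nhdsWithin_of_mem_nhds (hv.mem_nhds hxv)),
        hc, hp⟩
    refine ⟨fun x hx => ?_, fun x hx => ?_⟩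
    · obtain ⟨v, hv, hxv, he, hc, hp⟩ := key x hx
      have := hc x ⟨hx, hxv⟩
      rwa [ContinuousWithinAt, he] at this
    · obtain ⟨v, hv, hxv, he, hc, hp⟩ := key x hx
      have := hp x ⟨hx, hxv⟩
      rwa [he] at this
  congr := by
    rintro f g u hu hfg ⟨hc, hp⟩
    refine ⟨hc.congr hfg, fun x hx => (hp x hx).congr ?_⟩
    filter_upwards [self_mem_nhdsWithin] with y hy
    rw [hfg y hy]

/-- The groupoid of piecewise linear homeomorphisms between open subsets of the closed half-space
of dimension `n`. -/
noncomputable def plGroupoid (n : ℕ) [NeZero n] : StructureGroupoid (EuclideanHalfSpace n) :=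
  (plPregroupoid n).groupoid

/-! ### Piecewise linear manifolds -/

/-- The charted space `X` is a piecewise linear `n`-manifold, possibly with boundary; the boundary
is `(𝓡∂ n).boundary X`. -/
structure IsPLManifold (n : ℕ) [NeZero n] (X : Type*) [TopologicalSpace X]
    [ChartedSpace (EuclideanHalfSpace n) X] : Prop where
  t2 : T2Space X
  secondCountable : SecondCountableTopology X
  hasGroupoid : HasGroupoid X (plGroupoid n)

/-- `plCoord n x` are the coordinates in the preferred chart around `x`. Only their values near `x`
are meaningful. -/
noncomputable def plCoord (n : ℕ) [NeZero n] {X : Type*} [TopologicalSpace X]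
    [ChartedSpace (EuclideanHalfSpace n) X] (x : X) : X → EuclideanSpace ℝ (Fin n) :=
  extChartAt (𝓡∂ n) x

/-- Let `c z` be coordinates on `Z` near `z`, and `d y` coordinates on `Y` near `y`. The map
`f : Z → Y` is locally bi-PL if, in these coordinates, `f` is locally piecewise linear and so is
its local inverse on the image: the coordinates of `f z'` are a piecewise linear function of those
of `z'`, and conversely. -/
def IsLocallyBiPL {Z Y E F : Type*} [TopologicalSpace Z] [AddCommGroup E] [Module ℝ E]
    [AddCommGroup F] [Module ℝ F] (c : Z → Z → E) (d : Y → Y → F) (f : Z → Y) : Prop :=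
  ∀ z, IsPLGerm (𝓝 z) (c z) (d (f z) ∘ f) ∧ IsPLGerm (𝓝 z) (d (f z) ∘ f) (c z)

/-- A piecewise linear embedding of one `n`-manifold in another. -/
def IsPLEmbedding (n : ℕ) [NeZero n] {X Y : Type*} [TopologicalSpace X] [TopologicalSpace Y]
    [ChartedSpace (EuclideanHalfSpace n) X] [ChartedSpace (EuclideanHalfSpace n) Y]
    (f : X → Y) : Prop :=
  IsEmbedding f ∧ IsLocallyBiPL (plCoord n) (plCoord n) f

/-- A homeomorphism between subsets of two PL manifolds is piecewise linear (in both
directions). -/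
def IsPLHomeo (n : ℕ) [NeZero n] {X Y : Type*} [TopologicalSpace X] [TopologicalSpace Y]
    [ChartedSpace (EuclideanHalfSpace n) X] [ChartedSpace (EuclideanHalfSpace n) Y]
    {s : Set X} {t : Set Y} (h : s ≃ₜ t) : Prop :=
  IsLocallyBiPL (fun x y : s => plCoord n (x : X) (y : X)) (plCoord n) (fun x => (h x : Y))

/-! ### Homotopy collars and pseudo-collars -/

/-- The inclusion of the subspace `A` in `X` is a homotopy equivalence. -/
def InclIsHomotopyEquiv {X : Type*} [TopologicalSpace X] (A : Set X) : Prop :=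
  ∃ e : A ≃ₕ X, ∀ a : A, e a = a

/-- A homotopy collar: a manifold with compact boundary whose inclusion is a homotopy
equivalence. -/
structure IsHomotopyCollar (n : ℕ) [NeZero n] (X : Type*) [TopologicalSpace X]
    [ChartedSpace (EuclideanHalfSpace n) X] : Prop where
  isPLManifold : IsPLManifold n X
  isCompact_boundary : IsCompact ((𝓡∂ n).boundary X)
  homotopyEquiv : InclIsHomotopyEquiv ((𝓡∂ n).boundary X)

/-- A neighborhood of infinity: the closure of the complement is compact. -/
def IsNhdOfInfinity {X : Type*} [TopologicalSpace X] (V : Set X) : Prop :=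
  IsCompact (closure Vᶜ)

/-- The PL manifold `V` is a codimension 0 closed PL submanifold of `X`, whose manifold boundary is
its topological frontier and is PL bicollared in `X`. -/
structure IsCleanSubmanifold (n : ℕ) [NeZero n] {X : Type*} [TopologicalSpace X]
    [ChartedSpace (EuclideanHalfSpace n) X] (V : Set X) [ChartedSpace (EuclideanHalfSpace n) V] :
    Prop where
  isPLManifold : IsPLManifold n V
  isClosed : IsClosed V
  isPLEmbedding : IsPLEmbedding n (Subtype.val : V → X)
  frontier_eq : frontier V = Subtype.val '' (𝓡∂ n).boundary V
  bicollar : ∃ b : (𝓡∂ n).boundary V × Ioo (-1 : ℝ) 1 → X, IsOpenEmbedding b ∧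
    (∀ y, b (y, ⟨0, by norm_num⟩) = y.val.val) ∧
    (∀ z, b z ∈ V ↔ 0 ≤ (z.2 : ℝ)) ∧
    IsLocallyBiPL (fun z w => (plCoord n z.1.val w.1.val, (w.2 : ℝ))) (plCoord n) b

/-- A pseudo-collar: a homotopy collar that contains arbitrarily small homotopy collar
neighborhoods of infinity. -/
def IsPseudoCollar (n : ℕ) [NeZero n] (X : Type*) [TopologicalSpace X]
    [ChartedSpace (EuclideanHalfSpace n) X] : Prop :=
  IsHomotopyCollar n X ∧
  ∀ Q : Set X, IsNhdOfInfinity Q → ∃ V : Set X, V ⊆ Q ∧ IsNhdOfInfinity V ∧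
    ∃ _ : ChartedSpace (EuclideanHalfSpace n) V, IsCleanSubmanifold n V ∧ IsHomotopyCollar n V

/-! ### One-sided h-cobordisms and their unions -/

/-- `(W, M, N)` is a compact cobordism: `W` is a compact PL manifold and its boundary is the
disjoint union of the closed manifolds `M` and `N`. -/
structure IsCompactCobordism (n : ℕ) [NeZero n] {W : Type*} [TopologicalSpace W]
    [ChartedSpace (EuclideanHalfSpace n) W] (M N : Set W) : Prop where
  isPLManifold : IsPLManifold n W
  compact : CompactSpace W
  isClosed_left : IsClosed M
  isClosed_right : IsClosed N
  disjoint : Disjoint M N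
  boundary_eq : (𝓡∂ n).boundary W = M ∪ N

/-- `(W, M, N)` is a one-sided h-cobordism: the inclusion of at least one of the two ends is a
homotopy equivalence. -/
def IsOneSidedHCobordism (n : ℕ) [NeZero n] {W : Type*} [TopologicalSpace W]
    [ChartedSpace (EuclideanHalfSpace n) W] (M N : Set W) : Prop :=
  IsCompactCobordism n M N ∧ (InclIsHomotopyEquiv M ∨ InclIsHomotopyEquiv N)

/-- A sequence of one-sided h-cobordisms `(W i, M i, N i)` of dimension `n`, where the inclusion of
`M i` in `W i` is a homotopy equivalence, with PL homeomorphisms `h i : N i → M (i + 1)`. -/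
structure HCobordismStack (n : ℕ) [NeZero n] where
  W : ℕ → Type u
  [topologicalSpace : ∀ i, TopologicalSpace (W i)]
  [chartedSpace : ∀ i, ChartedSpace (EuclideanHalfSpace n) (W i)]
  M : ∀ i, Set (W i)
  N : ∀ i, Set (W i)
  oneSided : ∀ i, IsOneSidedHCobordism n (M i) (N i)
  homotopyEquiv : ∀ i, InclIsHomotopyEquiv (M i)
  h : ∀ i, N i ≃ₜ M (i + 1)
  isPLHomeo : ∀ i, IsPLHomeo n (h i)

namespace HCobordismStack

attribute [instance] HCobordismStack.topologicalSpace HCobordismStack.chartedSpace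

variable {n : ℕ} [NeZero n]

/-- The gluing relation: `x ∈ N i` is identified with `h i x ∈ M (i + 1)`. -/
inductive Glue (S : HCobordismStack.{u} n) : (Σ i, S.W i) → (Σ i, S.W i) → Prop
  | glue (i : ℕ) (x : S.N i) : Glue S ⟨i, x⟩ ⟨i + 1, S.h i x⟩

/-- The adjunction space `W 0 ∪ W 1 ∪ W 2 ∪ ⋯`, glued along the `h i`. -/
def Adjunction (S : HCobordismStack.{u} n) : Type u := Quot S.Glue

/-- The quotient topology. -/
instance (S : HCobordismStack.{u} n) : TopologicalSpace S.Adjunction :=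
  inferInstanceAs (TopologicalSpace (Quot S.Glue))

/-- The canonical map of `W i` to the adjunction space. -/
def incl (S : HCobordismStack.{u} n) (i : ℕ) (x : S.W i) : S.Adjunction :=
  Quot.mk _ ⟨i, x⟩

end HCobordismStack

/-! Adjunction space. Each seam has a collar on either side (`exists_collar`), and two such collars
fit together to a bicollar. Coordinates of the bicollars near the seams, and charts of the pieces
elsewhere, make the union a PL manifold (`exists_plStructure`) in which only the first end remains
as boundary. For the homotopy type, a compact collared end whose inclusion is a homotopy equivalence
is a strong deformation retract (`isSDR_of_collar`), so every piece retracts to its initial end,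
keeping that end fixed. These retractions are performed one after another: piece `i`, counted from
0, moves during the time interval `[2⁻⁽ⁱ⁺¹⁾, 2⁻ⁱ]` and then follows the earlier pieces. Infinitely
many retractions thus fit into the unit interval, while each piece rests for a positive time and
takes part in finitely many of them; this gives continuity. Stopped at time `2⁻ᵏ`, the flow retracts
the union of the pieces from `k` on to its initial end (`isSDR_seam`). These tails are cofinal among
the neighborhoods of infinity, because a compact set meets finitely many pieces, and their frontiers
are bicollared seams.

Converse. In a pseudo-collar choose homotopy collars `V 0 = U ⊇ V 1 ⊇ ⋯`, each inside the interior
of its predecessor and away from `∂U`, with no point in all of them, and cut `U` into the pieces `V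
i \ interior (V (i + 1))` (`exists_hCobordism`). The collar `V (i + 1)` retracts to its frontier, so
the inclusion of the piece in `V i` is a homotopy equivalence. The inclusion of `∂(V i)` in `V i` is
one as well, and it factors through the piece; hence so is the inclusion of `∂(V i)` in the piece.
Nothing similar holds for the other end, so the cobordisms are only one-sided.

Two facts of PL topology are proved on the way: invariance of the boundary
(`OpenPartialHomeomorph.apply_zero_of_isPLGerm`) and the collar theorem. PL structures are handled
throughout by germs of coordinates (`BiPL`), which compose and pull back more easily than charts. -/

/-! ### Calculus of piecewise linear germs -/

section Germs

variable {Z Z' E F G F' : Type*} [AddCommGroup E] [Module ℝ E] [AddCommGroup F] [Module ℝ F]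
  [AddCommGroup G] [Module ℝ G] [AddCommGroup F'] [Module ℝ F'] {l : Filter Z}

theorem IsPLGerm.affine (l : Filter Z) (a : Z → E) (A : E →ᵃ[ℝ] F) :
    IsPLGerm l a (fun z => A (a z)) := by
  refine ⟨{(univ, A)}, finite_singleton _, ?_, Eventually.of_forall fun z => by simp⟩
  rintro p rfl
  exact ⟨∅, finite_empty, by simp⟩

theorem IsPLGerm.linear (l : Filter Z) (a : Z → E) (A : E →ₗ[ℝ] F) :
    IsPLGerm l a (fun z => A (a z)) :=
  IsPLGerm.affine l a A.toAffineMap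

theorem IsPLGerm.congr_left {a a' : Z → E} {b : Z → F} (h : IsPLGerm l a b) (ha : a' =ᶠ[l] a) :
    IsPLGerm l a' b := by
  obtain ⟨T, hT, hP, hab⟩ := h
  refine ⟨T, hT, hP, ?_⟩
  filter_upwards [hab, ha] with z h1 h2
  rwa [h2]

/-- Pairwise intersections of the two families of polyhedra form a common refinement. -/
theorem IsPLGerm.prodMk {a : Z → E} {b : Z → F} {c : Z → G} (hb : IsPLGerm l a b)
    (hc : IsPLGerm l a c) : IsPLGerm l a (fun z => (b z, c z)) := by
  obtain ⟨T, hT, hP, hb⟩ := hb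
  obtain ⟨T', hT', hP', hc⟩ := hc
  refine ⟨image2 (fun p q => (p.1 ∩ q.1, p.2.prod q.2)) T T', hT.image2 _ hT', ?_, ?_⟩
  · rintro _ ⟨p, hp, q, hq, rfl⟩
    obtain ⟨s, hs, hps⟩ := hP p hp
    obtain ⟨t, ht, hqt⟩ := hP' q hq
    refine ⟨s ∪ t, hs.union ht, ?_⟩
    ext x
    simp only [hps, hqt, mem_inter_iff, mem_ofPred_eq, mem_union]
    exact ⟨fun h g hg => hg.elim (h.1 g) (h.2 g),
      fun h => ⟨fun g hg => h g (Or.inl hg), fun g hg => h g (Or.inr hg)⟩⟩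
  · filter_upwards [hb, hc] with z h1 h2
    obtain ⟨⟨p, hp, hpz⟩, h1⟩ := h1
    obtain ⟨⟨q, hq, hqz⟩, h2⟩ := h2
    refine ⟨⟨_, ⟨p, hp, q, hq, rfl⟩, hpz, hqz⟩, ?_⟩
    rintro _ ⟨p', hp', q', hq', rfl⟩ ⟨hz, hz'⟩
    simp [h1 p' hp' hz, h2 q' hq' hz']

theorem IsPLGerm.fst (l : Filter Z) (a : Z → E) (b : Z → F) :
    IsPLGerm l (fun z => (a z, b z)) a :=
  IsPLGerm.linear l (fun z => (a z, b z)) (LinearMap.fst ℝ E F)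

theorem IsPLGerm.snd (l : Filter Z) (a : Z → E) (b : Z → F) :
    IsPLGerm l (fun z => (a z, b z)) b :=
  IsPLGerm.linear l (fun z => (a z, b z)) (LinearMap.snd ℝ E F)

theorem IsPLGerm.const (l : Filter Z) (a : Z → E) (c : F) : IsPLGerm l a (fun _ => c) :=
  IsPLGerm.affine l a (AffineMap.const ℝ E c)

theorem IsPLGerm.add {a : Z → E} {b c : Z → F} (hb : IsPLGerm l a b) (hc : IsPLGerm l a c) :
    IsPLGerm l a (fun z => b z + c z) :=
  (hb.prodMk hc).trans
    (IsPLGerm.linear l (fun z => (b z, c z)) (LinearMap.fst ℝ F F + LinearMap.snd ℝ F F))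

theorem IsPLGerm.const_smul {a : Z → E} {b : Z → F} (hb : IsPLGerm l a b) (r : ℝ) :
    IsPLGerm l a (fun z => r • b z) :=
  hb.trans (IsPLGerm.linear l b (r • LinearMap.id))

theorem IsPLGerm.sub {a : Z → E} {b c : Z → F} (hb : IsPLGerm l a b) (hc : IsPLGerm l a c) :
    IsPLGerm l a (fun z => b z - c z) := by
  simpa [sub_eq_add_neg] using hb.add (hc.const_smul (-1))

theorem IsPLGerm.const_mul {a : Z → E} {b : Z → ℝ} (hb : IsPLGerm l a b) (r : ℝ) :
    IsPLGerm l a (fun z => r * b z) :=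
  hb.const_smul r

theorem IsPLGerm.smul_const {a : Z → E} {b : Z → ℝ} (hb : IsPLGerm l a b) (v : F) :
    IsPLGerm l a (fun z => b z • v) :=
  hb.trans (IsPLGerm.linear l b (LinearMap.toSpanSingleton ℝ F v))

theorem IsPLGerm.sum {ι : Type*} (s : Finset ι) {a : Z → E} {b : ι → Z → F}
    (hb : ∀ i ∈ s, IsPLGerm l a (b i)) : IsPLGerm l a (fun z => ∑ i ∈ s, b i z) := by
  classical
  induction s using Finset.induction_on with
  | empty => simpa using IsPLGerm.const l a (0 : F)
  | insert i s hi ih =>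
    simp only [Finset.sum_insert hi]
    exact (hb i (Finset.mem_insert_self i s)).add
      (ih fun j hj => hb j (Finset.mem_insert_of_mem hj))

theorem IsPLGerm.max {a : Z → E} {b c : Z → ℝ} (hb : IsPLGerm l a b) (hc : IsPLGerm l a c) :
    IsPLGerm l a (fun z => max (b z) (c z)) := by
  refine (hb.prodMk hc).trans
    ⟨{({p : ℝ × ℝ | p.1 ≤ p.2}, (LinearMap.snd ℝ ℝ ℝ).toAffineMap),
      ({p : ℝ × ℝ | p.2 ≤ p.1}, (LinearMap.fst ℝ ℝ ℝ).toAffineMap)}, by simp, ?_, ?_⟩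
  · rintro p (rfl | rfl)
    · refine ⟨{(LinearMap.fst ℝ ℝ ℝ - LinearMap.snd ℝ ℝ ℝ).toAffineMap}, by simp, ?_⟩
      ext x; simp
    · refine ⟨{(LinearMap.snd ℝ ℝ ℝ - LinearMap.fst ℝ ℝ ℝ).toAffineMap}, by simp, ?_⟩
      ext x; simp
  · refine Eventually.of_forall fun z => ⟨?_, ?_⟩
    · rcases le_total (b z) (c z) with h | h
      · exact ⟨_, Or.inl rfl, h⟩
      · exact ⟨_, Or.inr rfl, h⟩
    · rintro p (rfl | rfl) h
      · exact max_eq_right h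
      · exact max_eq_left h

theorem IsPLGerm.min {a : Z → E} {b c : Z → ℝ} (hb : IsPLGerm l a b) (hc : IsPLGerm l a c) :
    IsPLGerm l a (fun z => min (b z) (c z)) := by
  have h := (((hb.const_mul (-1)).max (hc.const_mul (-1)))).const_mul (-1)
  refine h.congr (Eventually.of_forall fun z => ?_)
  simp only [neg_mul, one_mul, max_neg_neg, neg_neg]

theorem IsPLGerm.abs {a : Z → E} {b : Z → ℝ} (hb : IsPLGerm l a b) :
    IsPLGerm l a (fun z => |b z|) := by
  have h := hb.max (hb.const_mul (-1))
  refine h.congr (Eventually.of_forall fun z => ?_)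
  simp [abs_eq_max_neg]

/-- `a` and `b` are piecewise linear functions of each other along `l`. -/
def BiPL (l : Filter Z) (a : Z → E) (b : Z → F) : Prop :=
  IsPLGerm l a b ∧ IsPLGerm l b a

theorem BiPL.refl (l : Filter Z) (a : Z → E) : BiPL l a a :=
  ⟨IsPLGerm.refl l a, IsPLGerm.refl l a⟩

theorem BiPL.symm {a : Z → E} {b : Z → F} (h : BiPL l a b) : BiPL l b a := ⟨h.2, h.1⟩

theorem BiPL.trans {a : Z → E} {b : Z → F} {c : Z → G} (h : BiPL l a b) (h' : BiPL l b c) :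
    BiPL l a c :=
  ⟨h.1.trans h'.1, h'.2.trans h.2⟩

theorem BiPL.comp_tendsto {l' : Filter Z'} {a : Z → E} {b : Z → F} (h : BiPL l a b) {f : Z' → Z}
    (hf : Tendsto f l' l) : BiPL l' (fun z => a (f z)) (fun z => b (f z)) :=
  ⟨h.1.comp_tendsto hf, h.2.comp_tendsto hf⟩

theorem BiPL.congr {a a' : Z → E} {b b' : Z → F} (h : BiPL l a b) (ha : a' =ᶠ[l] a)
    (hb : b' =ᶠ[l] b) : BiPL l a' b' :=
  ⟨(h.1.congr hb).congr_left ha, (h.2.congr ha).congr_left hb⟩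

theorem BiPL.of_eventuallyEq {a b : Z → E} (h : a =ᶠ[l] b) : BiPL l a b :=
  (BiPL.refl l b).congr h (EventuallyEq.refl l b)

theorem BiPL.prodMk {a : Z → E} {b : Z → F} {c : Z → G} {d : Z → F'} (h : BiPL l a b)
    (h' : BiPL l c d) : BiPL l (fun z => (a z, c z)) (fun z => (b z, d z)) :=
  ⟨((IsPLGerm.fst l a c).trans h.1).prodMk ((IsPLGerm.snd l a c).trans h'.1),
    ((IsPLGerm.fst l b d).trans h.2).prodMk ((IsPLGerm.snd l b d).trans h'.2)⟩

theorem BiPL.prod_const (l : Filter Z) (a : Z → E) (c : F) : BiPL l a (fun z => (a z, c)) :=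
  ⟨(IsPLGerm.refl l a).prodMk (IsPLGerm.const l a c), IsPLGerm.fst l a _⟩

theorem BiPL.affineEquiv (l : Filter Z) (a : Z → E) (A : E ≃ᵃ[ℝ] F) :
    BiPL l a (fun z => A (a z)) := by
  refine ⟨IsPLGerm.affine l a A.toAffineMap, ?_⟩
  have := IsPLGerm.affine l (fun z => A (a z)) A.symm.toAffineMap
  simpa using this

end Germs

theorem isLocallyBiPL_iff {Z Y E F : Type*} [TopologicalSpace Z] [AddCommGroup E] [Module ℝ E]
    [AddCommGroup F] [Module ℝ F] {c : Z → Z → E} {d : Y → Y → F} {f : Z → Y} :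
    IsLocallyBiPL c d f ↔ ∀ z, BiPL (𝓝 z) (c z) (fun z' => d (f z) (f z')) :=
  Iff.rfl

/-! ### Piecewise linear charts -/

section Charts

variable {n : ℕ} [NeZero n] {X : Type*} [TopologicalSpace X]

/-- Every transition map factors through a coordinate germ `c y`, hence is PL. The values of `c` may
lie in any vector space, for instance in a product with `ℝ`, so coordinates can be prescribed before
they are made into charts. The comparison of `c` with `plCoord` is all that is needed later of the
new structure. -/
theorem exists_chartedSpace_of_charts {E : Type*} [AddCommGroup E] [Module ℝ E] (c : X → X → E)
    (h : ∀ x, ∃ φ : OpenPartialHomeomorph X (EuclideanHalfSpace n), x ∈ φ.source ∧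
      ∀ y ∈ φ.source, BiPL (𝓝 y) (c y) (fun z => (φ z).val)) :
    ∃ _ : ChartedSpace (EuclideanHalfSpace n) X, HasGroupoid X (plGroupoid n) ∧
      ∀ x, BiPL (𝓝 x) (c x) (plCoord n x) := by
  choose φ hx hφ using h
  let _ : ChartedSpace (EuclideanHalfSpace n) X :=
    { atlas := range φ
      chartAt := φ
      mem_chart_source := hx
      chart_mem_atlas := fun x => mem_range_self x }
  refine ⟨inferInstance, ?_, fun x => hφ x x (hx x)⟩
  refine hasGroupoid_of_pregroupoid (plPregroupoid n) ?_
  rintro _ _ ⟨x, rfl⟩ ⟨y, rfl⟩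
  refine ⟨((φ x).symm ≫ₕ φ y).continuousOn, fun v hv => ?_⟩
  rw [OpenPartialHomeomorph.trans_source] at hv
  obtain ⟨hv1, hv2⟩ := hv
  have ht : Tendsto (φ x).symm (𝓝[((φ x).symm ≫ₕ φ y).source] v) (𝓝 ((φ x).symm v)) :=
    ((φ x).symm.continuousAt hv1).mono_left nhdsWithin_le_nhds
  have hv1' := (φ x).symm.map_source hv1
  have key := (((hφ x _ hv1').symm.trans (hφ y _ hv2)).comp_tendsto ht).1
  refine key.congr_left ?_
  filter_upwards [self_mem_nhdsWithin] with w hw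
  rw [(φ x).right_inv hw.1]

theorem IsPLManifold.biPL_of_mem_atlas [ChartedSpace (EuclideanHalfSpace n) X]
    (hX : IsPLManifold n X) {e e' : OpenPartialHomeomorph X (EuclideanHalfSpace n)}
    (he : e ∈ atlas (EuclideanHalfSpace n) X) (he' : e' ∈ atlas (EuclideanHalfSpace n) X) {y : X}
    (hy : y ∈ e.source) (hy' : y ∈ e'.source) :
    BiPL (𝓝 y) (fun z => (e z).val) (fun z => (e' z).val) := by
  have key : ∀ {e e' : OpenPartialHomeomorph X (EuclideanHalfSpace n)},
      e ∈ atlas (EuclideanHalfSpace n) X → e' ∈ atlas (EuclideanHalfSpace n) X →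
      y ∈ e.source → y ∈ e'.source →
      IsPLGerm (𝓝 y) (fun z => (e z).val) (fun z => (e' z).val) := by
    intro e e' he he' hy hy'
    have h := hX.hasGroupoid.compatible he he'
    have h1 : (plPregroupoid n).property (e.symm ≫ₕ e') (e.symm ≫ₕ e').source :=
      (mem_groupoid_of_pregroupoid.1 h).1
    have hs : e y ∈ (e.symm ≫ₕ e').source := by
      rw [OpenPartialHomeomorph.trans_source]
      refine ⟨e.map_source hy, ?_⟩
      change e.symm (e y) ∈ e'.source
      rwa [e.left_inv hy]
    have h2 := h1.2 (e y) hs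
    have ht : Tendsto e (𝓝 y) (𝓝[(e.symm ≫ₕ e').source] (e y)) := by
      rw [(e.symm ≫ₕ e').open_source.nhdsWithin_eq hs]
      exact e.continuousAt hy
    refine (h2.comp_tendsto ht).congr ?_
    filter_upwards [e.open_source.mem_nhds hy] with z hz
    simp [e.left_inv hz]
  exact ⟨key he he' hy hy', key he' he hy' hy⟩

theorem IsPLManifold.biPL_plCoord [ChartedSpace (EuclideanHalfSpace n) X]
    (hX : IsPLManifold n X) {e : OpenPartialHomeomorph X (EuclideanHalfSpace n)}
    (he : e ∈ atlas (EuclideanHalfSpace n) X) {y : X} (hy : y ∈ e.source) :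
    BiPL (𝓝 y) (plCoord n y) (fun z => (e z).val) :=
  hX.biPL_of_mem_atlas (chart_mem_atlas _ y) he (mem_chart_source _ y) hy

theorem mem_boundary_iff_plCoord [ChartedSpace (EuclideanHalfSpace n) X] {x : X} :
    x ∈ (𝓡∂ n).boundary X ↔ (plCoord n x x) 0 = 0 := by
  change extChartAt (𝓡∂ n) x x ∈ frontier (range (𝓡∂ n)) ↔ _
  rw [frontier_range_modelWithCornersEuclideanHalfSpace]
  exact eq_comm

/-! ### Invariance of the boundary -/

/-- A nonempty relatively open subset of the hyperplane `v 0 = 0` contains a point where none of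
finitely many affine functions vanishes, except those vanishing on the whole hyperplane. -/
theorem exists_generic_point {O : Set (EuclideanSpace ℝ (Fin n))} (hO : IsOpen O)
    {G : Set (EuclideanSpace ℝ (Fin n) →ᵃ[ℝ] ℝ)} (hG : G.Finite)
    (hne : ∃ v ∈ O, v 0 = 0) :
    ∃ v ∈ O, v 0 = 0 ∧ ∀ g ∈ G, g v = 0 → ∀ w : EuclideanSpace ℝ (Fin n), w 0 = 0 → g w = 0 := by
  suffices h : ∃ O' ⊆ O, IsOpen O' ∧ (∃ v ∈ O', v 0 = 0) ∧ ∀ v ∈ O', ∀ g ∈ G, g v = 0 →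
      ∀ w : EuclideanSpace ℝ (Fin n), w 0 = 0 → g w = 0 by
    obtain ⟨O', hO', -, ⟨v, hv, hv0⟩, h⟩ := h
    exact ⟨v, hO' hv, hv0, h v hv⟩
  induction G, hG using Set.Finite.induction_on with
  | empty => exact ⟨O, subset_rfl, hO, hne, by simp⟩
  | @insert g G _ _ ih =>
    obtain ⟨O', hO', ho, ⟨v, hv, hv0⟩, h⟩ := ih
    -- Either `g` vanishes on a relatively open part of the hyperplane, and then on all of it since
    -- `g` is affine, or the open set can be shrunk to avoid the zeros of `g`.
    by_cases hg : ∀ u ∈ O', u 0 = 0 → g u = 0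
    · have hall : ∀ w : EuclideanSpace ℝ (Fin n), w 0 = 0 → g w = 0 := by
        intro w hw
        have hc : Tendsto (fun t : ℝ => v + t • (w - v)) (𝓝[>] 0) (𝓝 v) := by
          have : Continuous (fun t : ℝ => v + t • (w - v)) := by fun_prop
          have h2 := this.tendsto 0
          simp only [zero_smul, add_zero] at h2
          exact h2.mono_left nhdsWithin_le_nhds
        obtain ⟨t, ht, ht0⟩ :=
          ((hc.eventually (ho.mem_nhds hv)).and self_mem_nhdsWithin).exists
        have h1 := hg _ ht (by simp [hw, hv0])
        have e : v + t • (w - v) = AffineMap.lineMap v w t := by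
          rw [AffineMap.lineMap_apply, vsub_eq_sub, vadd_eq_add, add_comm]
        rw [e, AffineMap.apply_lineMap, AffineMap.lineMap_apply, hg v hv hv0] at h1
        simpa [(show (0:ℝ) < t from ht0).ne'] using h1
      refine ⟨O', hO', ho, ⟨v, hv, hv0⟩, ?_⟩
      rintro u hu g' (rfl | hg') h0
      · exact hall
      · exact h u hu g' hg' h0
    · push Not at hg
      obtain ⟨u, hu, hu0, hgu⟩ := hg
      have hcont : Continuous g := g.continuous_of_finiteDimensional
      refine ⟨O' ∩ {w | g w ≠ 0}, inter_subset_left.trans hO',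
        ho.inter (isOpen_ne_fun hcont continuous_const), ⟨u, ⟨hu, hgu⟩, hu0⟩, ?_⟩
      rintro w ⟨hw, hw'⟩ g' (rfl | hg') h0
      · exact absurd h0 hw'
      · exact h w hw g' hg' h0

/-- An affine function vanishing on the hyperplane `v 0 = 0` is a multiple of the first
coordinate. -/
theorem AffineMap.eq_mul_of_vanishing {g : EuclideanSpace ℝ (Fin n) →ᵃ[ℝ] ℝ}
    (hg : ∀ w : EuclideanSpace ℝ (Fin n), w 0 = 0 → g w = 0) (w : EuclideanSpace ℝ (Fin n)) :
    g w = w 0 * g (EuclideanSpace.single 0 1) := by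
  have h0 : g 0 = 0 := hg 0 (by simp)
  have hl : ∀ v, g v = g.linear v := fun v => by
    have := g.map_vadd 0 v
    simpa [h0] using this
  have h1 := hg (w - w 0 • EuclideanSpace.single 0 1) (by simp)
  rw [hl, map_sub, map_smul, ← hl, ← hl, smul_eq_mul, sub_eq_zero] at h1
  exact h1

/-- Suppose `ψ x` were interior. Near a generic boundary point `v` of the chart `φ` every wall of
the finitely many polyhedra either misses `v` or is the boundary hyperplane, so that one polyhedron
contains a whole half-ball around `v`. There the change of charts is a single injective affine map.
Its image of a half-ball should be open in Euclidean space, yet it contains no point beyond the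
image of the hyperplane. -/
theorem OpenPartialHomeomorph.apply_zero_of_isPLGerm
    (φ ψ : OpenPartialHomeomorph X (EuclideanHalfSpace n)) {x : X} (hx : x ∈ φ.source)
    (hx' : x ∈ ψ.source) (h : IsPLGerm (𝓝 x) (fun z => (φ z).val) (fun z => (ψ z).val))
    (h0 : (φ x).val 0 = 0) : (ψ x).val 0 = 0 := by
  by_contra hne
  have hpos : 0 < (ψ x).val 0 := lt_of_le_of_ne (ψ x).2 (Ne.symm hne)
  obtain ⟨T, hT, hP, hab⟩ := h
  have hcoord : Continuous fun v : EuclideanHalfSpace n => v.val 0 := by fun_prop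
  have hev : ∀ᶠ z in 𝓝 x, z ∈ φ.source ∧ z ∈ ψ.source ∧ 0 < (ψ z).val 0 ∧
      (∃ p ∈ T, (φ z).val ∈ p.1) ∧ ∀ p ∈ T, (φ z).val ∈ p.1 → (ψ z).val = p.2 (φ z).val := by
    have h3 : ∀ᶠ z in 𝓝 x, 0 < (ψ z).val 0 :=
      ((hcoord.continuousAt.comp (ψ.continuousAt hx')).tendsto).eventually (lt_mem_nhds hpos)
    filter_upwards [φ.open_source.mem_nhds hx, ψ.open_source.mem_nhds hx', h3, hab]
      with z h1 h2 h3 h4 using ⟨h1, h2, h3, h4⟩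
  obtain ⟨O, hO, hOo, hxO⟩ := eventually_nhds_iff.1 hev
  have hOφ : O ⊆ φ.source := fun z hz => (hO z hz).1
  have hOψ : O ⊆ ψ.source := fun z hz => (hO z hz).2.1
  obtain ⟨Ω, hΩ, hΩO⟩ := isOpen_induced_iff.1 (φ.isOpen_image_of_subset_source hOo hOφ)
  have hlift : ∀ v ∈ Ω, 0 ≤ v 0 → ∃ z ∈ O, (φ z).val = v := by
    intro v hv hv0
    have : (⟨v, hv0⟩ : EuclideanHalfSpace n) ∈ φ '' O := by rw [← hΩO]; exact hv
    obtain ⟨z, hz, hzv⟩ := this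
    exact ⟨z, hz, by rw [hzv]⟩
  choose! s hs hps using hP
  have hG : (⋃ p ∈ T, s p).Finite := hT.biUnion hs
  have hxΩ : (φ x).val ∈ Ω := by
    have : φ x ∈ φ '' O := mem_image_of_mem _ hxO
    rw [← hΩO] at this
    exact this
  obtain ⟨v, hvΩ, hv0, hgen⟩ := exists_generic_point hΩ hG ⟨_, hxΩ, h0⟩
  -- Near `v` each wall function has a constant sign on the upper side: by continuity if `g v ≠ 0`,
  -- and as a multiple of the first coordinate otherwise.
  have hN : ∀ g ∈ ⋃ p ∈ T, s p, ∃ N ∈ 𝓝 v, (∀ u ∈ N, 0 ≤ u 0 → g u ≤ 0) ∨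
      (∀ u ∈ N, 0 < u 0 → 0 < g u) := by
    intro g hg
    have hcont : Continuous g := g.continuous_of_finiteDimensional
    rcases lt_trichotomy (g v) 0 with h | h | h
    · exact ⟨_, hcont.continuousAt.eventually (gt_mem_nhds h), Or.inl fun u hu _ => le_of_lt hu⟩
    · refine ⟨univ, univ_mem, ?_⟩
      have hm := AffineMap.eq_mul_of_vanishing (hgen g hg h)
      rcases le_or_gt (g (EuclideanSpace.single 0 1)) 0 with h1 | h1
      · left; intro u _ hu
        rw [hm]; exact mul_nonpos_of_nonneg_of_nonpos hu h1
      · right; intro u _ hu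
        rw [hm]; exact mul_pos hu h1
    · exact ⟨_, hcont.continuousAt.eventually (lt_mem_nhds h), Or.inr fun u hu _ => hu⟩
  choose! N hN hNg using hN
  have hNall : (⋂ g ∈ ⋃ p ∈ T, s p, N g) ∩ Ω ∈ 𝓝 v :=
    inter_mem ((biInter_mem hG).2 hN) (hΩ.mem_nhds hvΩ)
  obtain ⟨r, hr, hball⟩ := Metric.mem_nhds_iff.1 hNall
  set e₀ : EuclideanSpace ℝ (Fin n) := EuclideanSpace.single 0 1 with he₀
  have hue : ‖e₀‖ = 1 := by simp [he₀]
  -- A test point inside the open half-ball. A polyhedron that contains it satisfies the nonpositive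
  -- alternative for all of its walls, hence contains the half-ball.
  set w₀ := v + (r / 2) • e₀ with hw₀
  have hw₀b : w₀ ∈ Metric.ball v r := by
    rw [mem_ball_iff_norm, hw₀, add_sub_cancel_left, norm_smul, hue, Real.norm_eq_abs,
      abs_of_pos (by positivity)]
    linarith
  have hw₀0 : 0 < w₀ 0 := by simp [hw₀, hv0, he₀, hr]
  obtain ⟨z₀, hz₀, hz₀w⟩ := hlift w₀ (hball hw₀b).2 hw₀0.le
  obtain ⟨-, -, -, ⟨p, hp, hpz⟩, -⟩ := hO z₀ hz₀
  have hpball : ∀ u ∈ Metric.ball v r, 0 ≤ u 0 → u ∈ p.1 := by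
    intro u hu hu0
    rw [hps p hp]
    intro g hg
    have hgG : g ∈ ⋃ p ∈ T, s p := mem_biUnion hp hg
    have hmem : ∀ u ∈ Metric.ball v r, u ∈ N g := fun u hu => (mem_iInter₂.1 (hball hu).1) g hgG
    rcases hNg g hgG with h1 | h1
    · exact h1 u (hmem u hu) hu0
    · have h2 := h1 w₀ (hmem _ hw₀b) hw₀0
      rw [hps p hp, hz₀w] at hpz
      exact absurd (hpz g hg) (not_le.2 h2)
  have hA : ∀ z ∈ O, (φ z).val ∈ Metric.ball v r → (ψ z).val = p.2 (φ z).val := fun z hz hzb =>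
    (hO z hz).2.2.2.2 p hp (hpball _ hzb (φ z).2)
  -- A kernel vector would give two nearby points of the open half-ball with the same image under
  -- the injective `ψ`.
  have hlin : Function.Injective p.2.linear := by
    rw [injective_iff_map_eq_zero]
    intro w hw
    have hc : Tendsto (fun t : ℝ => w₀ + t • w) (𝓝[>] 0) (𝓝 w₀) := by
      have : Continuous (fun t : ℝ => w₀ + t • w) := by fun_prop
      have h2 := this.tendsto 0
      simp only [zero_smul, add_zero] at h2
      exact h2.mono_left nhdsWithin_le_nhds
    have hc0 : Continuous fun u : EuclideanSpace ℝ (Fin n) => u 0 := by fun_prop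
    obtain ⟨t, ⟨ht1, ht2⟩, ht⟩ := ((hc.eventually ((Metric.isOpen_ball.mem_nhds hw₀b))).and
      (hc.eventually (hc0.continuousAt.eventually (lt_mem_nhds hw₀0)))).and
      self_mem_nhdsWithin |>.exists
    obtain ⟨z₁, hz₁, hz₁w⟩ := hlift _ (hball ht1).2 ht2.le
    have e1 := hA z₀ hz₀ (by rw [hz₀w]; exact hw₀b)
    have e2 := hA z₁ hz₁ (by rw [hz₁w]; exact ht1)
    have e3 : p.2 (w₀ + t • w) = p.2 w₀ := by
      have := p.2.map_vadd w₀ (t • w)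
      rw [map_smul, hw, smul_zero, zero_vadd, vadd_eq_add, add_comm] at this
      exact this
    have e4 : z₀ = z₁ := ψ.injOn (hOψ hz₀) (hOψ hz₁)
      (Subtype.ext (by rw [e1, e2, hz₀w, hz₁w, e3]))
    rw [← e4, hz₀w] at hz₁w
    have : t • w = 0 := by simpa using hz₁w.symm
    exact (smul_eq_zero.1 this).resolve_left (ne_of_gt ht)
  have hinj : Function.Injective p.2 := (p.2.linear_injective_iff).1 hlin
  obtain ⟨y, hy, hyv⟩ := hlift v hvΩ hv0.ge
  have hO2 : IsOpen (O ∩ φ ⁻¹' (Subtype.val ⁻¹' Metric.ball v r)) :=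
    (φ.continuousOn.mono hOφ).isOpen_inter_preimage hOo
      (Metric.isOpen_ball.preimage continuous_subtype_val)
  obtain ⟨Ω₂, hΩ₂, hΩO₂⟩ := isOpen_induced_iff.1
    (ψ.isOpen_image_of_subset_source hO2 (inter_subset_left.trans hOψ))
  have hyΩ : p.2 v ∈ Ω₂ := by
    have hyb : (φ y).val ∈ Metric.ball v r := by rw [hyv]; exact Metric.mem_ball_self hr
    have : ψ y ∈ ψ '' (O ∩ φ ⁻¹' (Subtype.val ⁻¹' Metric.ball v r)) :=
      mem_image_of_mem _ ⟨hy, hyb⟩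
    rw [← hΩO₂, mem_preimage, hA y hy hyb, hyv] at this
    exact this
  have hy0 : 0 < (p.2 v) 0 := by
    rw [← hyv, ← hA y hy (by rw [hyv]; exact Metric.mem_ball_self hr)]
    exact (hO y hy).2.2.1
  -- The point `v - t • e₀` lies below the half-space, but for small `t` its image is in the open
  -- image of `ψ`; by injectivity it would be a value of `φ`.
  have hc : Tendsto (fun t : ℝ => p.2 (v - t • e₀)) (𝓝[>] 0) (𝓝 (p.2 v)) := by
    have hpc : Continuous p.2 := p.2.continuous_of_finiteDimensional
    have : Continuous (fun t : ℝ => p.2 (v - t • e₀)) := by fun_prop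
    have h2 := this.tendsto 0
    simp only [zero_smul, sub_zero] at h2
    exact h2.mono_left nhdsWithin_le_nhds
  have hc0 : Continuous fun u : EuclideanSpace ℝ (Fin n) => u 0 := by fun_prop
  obtain ⟨t, ⟨ht1, ht2⟩, ht⟩ := ((hc.eventually (hΩ₂.mem_nhds hyΩ)).and
      (hc.eventually (hc0.continuousAt.eventually (lt_mem_nhds hy0)))).and
      self_mem_nhdsWithin |>.exists
  have hmem : (⟨p.2 (v - t • e₀), ht2.le⟩ : EuclideanHalfSpace n) ∈
      ψ '' (O ∩ φ ⁻¹' (Subtype.val ⁻¹' Metric.ball v r)) := by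
    rw [← hΩO₂]; exact ht1
  obtain ⟨z, ⟨hz, hzb⟩, hzψ⟩ := hmem
  have e1 := hA z hz hzb
  rw [hzψ] at e1
  have e2 := hinj e1
  have e3 := (φ z).2
  rw [← e2] at e3
  simp [hv0, he₀] at e3
  exact absurd ht (not_lt.2 e3)

theorem mem_boundary_iff_of_biPL [ChartedSpace (EuclideanHalfSpace n) X]
    {φ : OpenPartialHomeomorph X (EuclideanHalfSpace n)} {x : X} (hx : x ∈ φ.source)
    (h : BiPL (𝓝 x) (plCoord n x) (fun z => (φ z).val)) :
    x ∈ (𝓡∂ n).boundary X ↔ (φ x).val 0 = 0 := by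
  rw [mem_boundary_iff_plCoord]
  exact ⟨OpenPartialHomeomorph.apply_zero_of_isPLGerm (chartAt _ x) φ (mem_chart_source _ x) hx h.1,
    OpenPartialHomeomorph.apply_zero_of_isPLGerm φ (chartAt _ x) hx (mem_chart_source _ x) h.2⟩

theorem IsPLManifold.mem_boundary_iff [ChartedSpace (EuclideanHalfSpace n) X]
    (hX : IsPLManifold n X) {e : OpenPartialHomeomorph X (EuclideanHalfSpace n)}
    (he : e ∈ atlas (EuclideanHalfSpace n) X) {x : X} (hx : x ∈ e.source) :
    x ∈ (𝓡∂ n).boundary X ↔ (e x).val 0 = 0 :=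
  mem_boundary_iff_of_biPL hx (hX.biPL_plCoord he hx)

theorem IsPLManifold.isClosed_boundary [ChartedSpace (EuclideanHalfSpace n) X]
    (hX : IsPLManifold n X) : IsClosed ((𝓡∂ n).boundary X) := by
  rw [← isOpen_compl_iff, isOpen_iff_mem_nhds]
  intro x hx
  have hx0 : (chartAt (EuclideanHalfSpace n) x x).val 0 ≠ 0 := fun h =>
    hx ((hX.mem_boundary_iff (chart_mem_atlas _ x) (mem_chart_source _ x)).2 h)
  have hcoord : Continuous fun v : EuclideanHalfSpace n => v.val 0 := by fun_prop
  filter_upwards [(chartAt (EuclideanHalfSpace n) x).open_source.mem_nhds (mem_chart_source _ x),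
    ((hcoord.continuousAt.comp ((chartAt (EuclideanHalfSpace n) x).continuousAt
      (mem_chart_source _ x))).tendsto).eventually (isOpen_ne.mem_nhds hx0)] with y hy hy0 hyb
  exact hy0 ((hX.mem_boundary_iff (chart_mem_atlas _ x) hy).1 hyb)

end Charts

/-! ### Codimension 0 submanifolds with flat frontier -/

/-- Source of nearly all new charts: a chart `ψ` that matches an embedded subspace with an embedded
model restricts to a chart of the subspace. The models are the half-space in Euclidean space and two
splittings of Euclidean space along its first coordinate. -/
theorem OpenPartialHomeomorph.exists_pullback {Z X Y Y' : Type*} [TopologicalSpace Z]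
    [TopologicalSpace X] [TopologicalSpace Y] [TopologicalSpace Y'] [Nonempty Z] [Nonempty Y']
    (ψ : OpenPartialHomeomorph X Y) {f : Z → X} (hf : IsEmbedding f) {j : Y' → Y}
    (hj : IsEmbedding j) (h : ∀ y ∈ ψ.source, y ∈ range f ↔ ψ y ∈ range j) :
    ∃ φ : OpenPartialHomeomorph Z Y', φ.source = f ⁻¹' ψ.source ∧ φ.target = j ⁻¹' ψ.target ∧
      ∀ z ∈ φ.source, j (φ z) = ψ (f z) := by
  have hj' : ∀ z ∈ f ⁻¹' ψ.source, j (Function.invFun j (ψ (f z))) = ψ (f z) := fun z hz =>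
    Function.invFun_eq ((h _ hz).1 (mem_range_self z))
  have hf' : ∀ w ∈ j ⁻¹' ψ.target, f (Function.invFun f (ψ.symm (j w))) = ψ.symm (j w) :=
    fun w hw => Function.invFun_eq ((h _ (ψ.map_target hw)).2
      (by rw [ψ.right_inv hw]; exact mem_range_self w))
  refine ⟨
    { toFun := fun z => Function.invFun j (ψ (f z))
      invFun := fun w => Function.invFun f (ψ.symm (j w))
      source := f ⁻¹' ψ.source
      target := j ⁻¹' ψ.target
      map_source' := fun z hz => by
        rw [mem_preimage, hj' z hz]; exact ψ.map_source hz
      map_target' := fun w hw => by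
        rw [mem_preimage, hf' w hw]; exact ψ.map_target hw
      left_inv' := fun z hz => hf.injective <| by
        have e := hj' z hz
        have hm : Function.invFun j (ψ (f z)) ∈ j ⁻¹' ψ.target := by
          rw [mem_preimage, e]; exact ψ.map_source hz
        rw [hf' _ hm, e, ψ.left_inv hz]
      right_inv' := fun w hw => hj.injective <| by
        have e := hf' w hw
        have hm : Function.invFun f (ψ.symm (j w)) ∈ f ⁻¹' ψ.source := by
          rw [mem_preimage, e]; exact ψ.map_target hw
        rw [hj' _ hm, e, ψ.right_inv hw]
      continuousOn_toFun := by
        rw [hj.isInducing.continuousOn_iff]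
        exact (ψ.continuousOn.comp hf.continuous.continuousOn fun z hz => hz).congr hj'
      continuousOn_invFun := by
        rw [hf.isInducing.continuousOn_iff]
        exact (ψ.symm.continuousOn.comp hj.continuous.continuousOn fun z hz => hz).congr hf'
      open_source := ψ.open_source.preimage hf.continuous
      open_target := ψ.open_target.preimage hj.continuous }, rfl, rfl, hj'⟩

section Submanifold

variable {n : ℕ} [NeZero n]

instance : Nonempty (EuclideanHalfSpace n) := ⟨⟨0, by simp⟩⟩

variable {X : Type*} [TopologicalSpace X]

theorem isEmbedding_val_halfSpace :
    IsEmbedding (fun v : EuclideanHalfSpace n => (v.val : EuclideanSpace ℝ (Fin n))) :=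
  IsEmbedding.subtypeVal

theorem range_val_halfSpace :
    range (fun v : EuclideanHalfSpace n => (v.val : EuclideanSpace ℝ (Fin n))) = {v | 0 ≤ v 0} :=
  Subtype.range_val

/-- `F` is the part of the frontier where `A` is cut along a hyperplane; there the flat charts
restrict to half-space charts. At the other points `A` is a neighborhood and the charts of `X` are
reused. The boundary is then read off in these charts, by invariance of the boundary. -/
theorem exists_submanifold [ChartedSpace (EuclideanHalfSpace n) X] (hX : IsPLManifold n X)
    {A F : Set X} (hint : ∀ x ∈ A, x ∉ F → A ∈ 𝓝 x)
    (hflat : ∀ x ∈ F, ∃ ψ : OpenPartialHomeomorph X (EuclideanSpace ℝ (Fin n)), x ∈ ψ.source ∧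
      ψ x 0 = 0 ∧ (∀ y ∈ ψ.source, BiPL (𝓝 y) (plCoord n y) ψ) ∧
      ∀ y ∈ ψ.source, y ∈ A ↔ 0 ≤ ψ y 0) :
    ∃ _ : ChartedSpace (EuclideanHalfSpace n) A, IsPLManifold n A ∧
      IsPLEmbedding n (Subtype.val : A → X) ∧
      (𝓡∂ n).boundary A = {x | x.val ∈ F ∨ x.val ∈ (𝓡∂ n).boundary X} := by
  have hcharts : ∀ x : A, ∃ φ : OpenPartialHomeomorph A (EuclideanHalfSpace n), x ∈ φ.source ∧
      (∀ y ∈ φ.source, BiPL (𝓝 y) (fun z : A => plCoord n y.val z.val) (fun z => (φ z).val)) ∧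
      ((φ x).val 0 = 0 ↔ (x.val ∈ F ∨ x.val ∈ (𝓡∂ n).boundary X)) := by
    intro x
    have : Nonempty A := ⟨x⟩
    by_cases hx : x.val ∈ F
    · obtain ⟨ψ, hxψ, h0, hpl, hA⟩ := hflat x hx
      obtain ⟨φ, hφs, -, hφ⟩ := ψ.exists_pullback (IsEmbedding.subtypeVal (p := (· ∈ A)))
        (isEmbedding_val_halfSpace (n := n)) (fun y hy => by
          rw [range_val_halfSpace, Subtype.range_val]; exact hA y hy)
      have hxs : x ∈ φ.source := by rw [hφs]; exact hxψ
      refine ⟨φ, hxs, fun y hy => ?_, ?_⟩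
      · have hy' : y.val ∈ ψ.source := by rw [hφs] at hy; exact hy
        refine ((hpl _ hy').comp_tendsto continuous_subtype_val.continuousAt).congr
          (EventuallyEq.refl _ _) ?_
        filter_upwards [φ.open_source.mem_nhds hy] with z hz using hφ z hz
      · rw [show (φ x).val = ψ x.val from hφ x hxs]
        exact iff_of_true h0 (Or.inl hx)
    · have hi : x.val ∈ interior A := mem_interior_iff_mem_nhds.2 (hint x x.2 hx)
      obtain ⟨φ, hφs, -, hφ⟩ := ((chartAt (EuclideanHalfSpace n) x.val).restrOpen (interior A)
          isOpen_interior).exists_pullback (IsEmbedding.subtypeVal (p := (· ∈ A)))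
        IsEmbedding.id (fun y hy => by
          rw [Subtype.range_val, range_id]
          exact iff_of_true (interior_subset hy.2) trivial)
      have hxs : x ∈ φ.source := by rw [hφs]; exact ⟨mem_chart_source _ _, hi⟩
      refine ⟨φ, hxs, fun y hy => ?_, ?_⟩
      · have hy' : y.val ∈ (chartAt (EuclideanHalfSpace n) x.val).source := by
          rw [hφs] at hy; exact hy.1
        refine ((hX.biPL_plCoord (chart_mem_atlas _ x.val) hy').comp_tendsto
          continuous_subtype_val.continuousAt).congr (EventuallyEq.refl _ _) ?_
        filter_upwards [φ.open_source.mem_nhds hy] with z hz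
        exact congrArg Subtype.val (hφ z hz)
      · rw [show φ x = chartAt (EuclideanHalfSpace n) x.val x.val from hφ x hxs,
          ← hX.mem_boundary_iff (chart_mem_atlas _ x.val) (mem_chart_source _ x.val)]
        exact (or_iff_right hx).symm
  obtain ⟨inst, hg, hc⟩ := exists_chartedSpace_of_charts
    (fun y z : A => plCoord n y.val z.val)
    (fun x => let ⟨φ, h1, h2, _⟩ := hcharts x; ⟨φ, h1, h2⟩)
  have := hX.t2
  have := hX.secondCountable
  refine ⟨inst, ⟨inferInstance, inferInstance, hg⟩, ⟨IsEmbedding.subtypeVal, fun x => (hc x).symm⟩,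
    ?_⟩
  ext x
  obtain ⟨φ, h1, h2, h3⟩ := hcharts x
  rw [mem_boundary_iff_of_biPL h1 ((hc x).symm.trans (h2 x h1)), h3]
  rfl

/-- The unit normal vector of the boundary of the half-space. -/
noncomputable def normalVec (n : ℕ) [NeZero n] : EuclideanSpace ℝ (Fin n) :=
  EuclideanSpace.single 0 1

@[simp] theorem normalVec_zero : normalVec n 0 = 1 := by simp [normalVec]

@[simp] theorem norm_normalVec : ‖normalVec n‖ = 1 := by simp [normalVec]

/-- The projection of Euclidean space to the boundary of the half-space. -/
noncomputable def hyperProj (v : EuclideanSpace ℝ (Fin n)) : EuclideanHalfSpace n :=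
  ⟨v - v 0 • normalVec n, by simp⟩

theorem hyperProj_val (v : EuclideanSpace ℝ (Fin n)) :
    (hyperProj v).val = v - v 0 • normalVec n := rfl

theorem continuous_hyperProj :
    Continuous (hyperProj : EuclideanSpace ℝ (Fin n) → EuclideanHalfSpace n) := by
  refine Continuous.subtype_mk ?_ _
  fun_prop

/-- Coordinates of a bicollar: `b (y, t)` has the coordinates of `y`, shifted by `t` in the normal
direction. -/
theorem exists_flatChart {Z : Type*} [TopologicalSpace Z] [ChartedSpace (EuclideanHalfSpace n) Z]
    (hZ : IsPLManifold n Z) {F : Set Z} (hF : ∀ x ∈ F, ∀ᶠ z in 𝓝 x, z ∈ F ↔ z ∈ (𝓡∂ n).boundary Z)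
    {E : Type*} [AddCommGroup E] [Module ℝ E] {d : X → X → E}
    {b : F × Ioo (-1 : ℝ) 1 → X} (hb : IsOpenEmbedding b)
    (hbpl : IsLocallyBiPL (fun z w => (plCoord n z.1.val w.1.val, (w.2 : ℝ))) d b) (y : F) :
    ∃ ψ : OpenPartialHomeomorph X (EuclideanSpace ℝ (Fin n)), b (y, ⟨0, by norm_num⟩) ∈ ψ.source ∧
      (∀ x ∈ ψ.source, BiPL (𝓝 x) (d x) ψ) ∧
      ∀ x ∈ ψ.source, ∃ z, b z = x ∧ ψ x 0 = z.2 := by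
  obtain ⟨O, hO, hOo, hyO⟩ := eventually_nhds_iff.1 (hF y y.2)
  -- On `O` the set `F` is the entire boundary, so in this chart it is exactly the hyperplane. This
  -- admits an `F` that is only one end of a cobordism.
  set e := chartAt (EuclideanHalfSpace n) y.val with he
  set φ := e.restrOpen O hOo with hφ
  set y₀ : F × Ioo (-1 : ℝ) 1 := (y, ⟨0, by norm_num⟩) with hy₀
  have : Nonempty (F × Ioo (-1 : ℝ) 1) := ⟨y₀⟩
  -- Euclidean space is split into the hyperplane and the normal line, to match the product
  -- structure of the bicollar.
  have hj : IsEmbedding (fun v : EuclideanSpace ℝ (Fin n) => (hyperProj v, v 0)) := by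
    have hc : Continuous (fun v : EuclideanSpace ℝ (Fin n) => (hyperProj v, v 0)) :=
      continuous_hyperProj.prodMk (by fun_prop)
    have hl : Function.LeftInverse
        (fun p : EuclideanHalfSpace n × ℝ => p.1.val + p.2 • normalVec n)
        (fun v : EuclideanSpace ℝ (Fin n) => (hyperProj v, v 0)) := fun v => by
      simp [hyperProj_val]
    exact hl.isEmbedding (by fun_prop) hc
  have hf : IsEmbedding (fun z : F × Ioo (-1 : ℝ) 1 => (z.1.val, z.2.val)) :=
    IsEmbedding.subtypeVal.prodMap IsEmbedding.subtypeVal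
  have hbd : ∀ z ∈ φ.source, z ∈ F ↔ (e z).val 0 = 0 := fun z hz => by
    rw [hO z hz.2, hZ.mem_boundary_iff (chart_mem_atlas _ _) hz.1]
  obtain ⟨χ, hχs, -, hχ⟩ := (φ.prod (OpenPartialHomeomorph.ofSet (Ioo (-1 : ℝ) 1)
      isOpen_Ioo)).exists_pullback hf hj (by
    rintro ⟨z, t⟩ ⟨hz, ht⟩
    have h1 : (z, t) ∈ range (fun z : F × Ioo (-1 : ℝ) 1 => (z.1.val, z.2.val)) ↔ z ∈ F := by
      constructor
      · rintro ⟨w, hw⟩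
        have e1 : w.1.val = z := (Prod.ext_iff.1 hw).1
        rw [← e1]; exact w.1.2
      · intro h
        exact ⟨(⟨z, h⟩, ⟨t, ht⟩), rfl⟩
    rw [h1, hbd z hz]
    change _ ↔ (e z, t) ∈ _
    constructor
    · intro h
      refine ⟨(e z).val + t • normalVec n, Prod.ext (Subtype.ext ?_) ?_⟩
      · simp [hyperProj_val, h]
      · simp [h]
    · rintro ⟨v, hv⟩
      have e1 : hyperProj v = e z := (Prod.ext_iff.1 hv).1
      rw [← e1]
      simp [hyperProj_val])
  have hχs' : ∀ z, z ∈ χ.source ↔ z.1.val ∈ φ.source := fun z => by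
    rw [hχs]; exact ⟨fun h => h.1, fun h => ⟨h, z.2.2⟩⟩
  have hχ0 : ∀ z ∈ χ.source, χ z 0 = z.2 := fun z hz => (Prod.ext_iff.1 (hχ z hz)).2
  have hχ1 : ∀ z ∈ χ.source, χ z - χ z 0 • normalVec n = (e z.1.val).val := fun z hz =>
    congrArg Subtype.val (Prod.ext_iff.1 (hχ z hz)).1
  have hχpl : ∀ z ∈ χ.source, BiPL (𝓝 z)
      (fun w : F × Ioo (-1 : ℝ) 1 => (plCoord n z.1.val w.1.val, (w.2 : ℝ))) χ := by
    intro z hz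
    have hz1 : z.1.val ∈ e.source := ((hχs' z).1 hz).1
    have ht : Tendsto (fun w : F × Ioo (-1 : ℝ) 1 => w.1.val) (𝓝 z) (𝓝 z.1.val) := by
      have : Continuous (fun w : F × Ioo (-1 : ℝ) 1 => w.1.val) := by fun_prop
      exact this.continuousAt
    have h1 := ((hZ.biPL_plCoord (chart_mem_atlas _ y.val) hz1).comp_tendsto ht).prodMk
      (BiPL.refl (𝓝 z) (fun w : F × Ioo (-1 : ℝ) 1 => (w.2 : ℝ)))
    refine h1.trans ⟨?_, ?_⟩
    · refine ((IsPLGerm.fst _ _ _).add ((IsPLGerm.snd _ _ _).smul_const (normalVec n))).congr ?_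
      filter_upwards [χ.open_source.mem_nhds hz] with w hw
      rw [← hχ1 w hw, hχ0 w hw]; abel
    · have h0 : IsPLGerm (𝓝 z) χ (fun w => χ w 0) :=
        IsPLGerm.linear _ _ (EuclideanSpace.proj (𝕜 := ℝ) (0 : Fin n)).toLinearMap
      refine (((IsPLGerm.refl (𝓝 z) χ).sub (h0.smul_const (normalVec n))).prodMk h0).congr ?_
      filter_upwards [χ.open_source.mem_nhds hz] with w hw
      rw [hχ1 w hw, hχ0 w hw]
  set B := hb.toOpenPartialHomeomorph b with hB
  have hBs : B.symm.source = range b := by simp [hB]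
  have hBb : ∀ z, B.symm (b z) = z := fun z => by
    have := B.left_inv (x := z) (by simp [hB])
    simpa [hB] using this
  have hsrc : ∀ x, x ∈ (B.symm ≫ₕ χ).source ↔ ∃ z ∈ χ.source, b z = x := by
    intro x
    rw [OpenPartialHomeomorph.trans_source, hBs]
    constructor
    · rintro ⟨⟨z, rfl⟩, hz⟩
      rw [mem_preimage, hBb] at hz
      exact ⟨z, hz, rfl⟩
    · rintro ⟨z, hz, rfl⟩
      exact ⟨mem_range_self z, by rw [mem_preimage, hBb]; exact hz⟩
  refine ⟨B.symm ≫ₕ χ, (hsrc _).2 ⟨y₀, (hχs' y₀).2 ⟨mem_chart_source _ _, hyO⟩, rfl⟩, ?_, ?_⟩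
  · intro x hx
    obtain ⟨z, hz, rfl⟩ := (hsrc x).1 hx
    have h1 := (isLocallyBiPL_iff.1 hbpl z).symm.trans (hχpl z hz)
    have ht : Tendsto B.symm (𝓝 (b z)) (𝓝 z) := by
      have := B.symm.continuousAt (x := b z) (by rw [hBs]; exact mem_range_self z)
      rwa [ContinuousAt, hBb] at this
    refine (h1.comp_tendsto ht).congr ?_ (EventuallyEq.refl _ _)
    filter_upwards [hb.isOpen_range.mem_nhds (mem_range_self z)] with x hx
    obtain ⟨w, rfl⟩ := hx
    simp [hBb]
  · intro x hx
    obtain ⟨z, hz, rfl⟩ := (hsrc x).1 hx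
    refine ⟨z, rfl, ?_⟩
    simp [hBb, hχ0 z hz]

end Submanifold

/-! ### Local pushes along the boundary -/

/-- `Θ` is transplanted by `Φ` and continued by the identity. The support lies in `S`, which is
closed in all of `X` and contained in the source, so nothing can go wrong at the edge of the source.
-/
theorem OpenPartialHomeomorph.exists_homeomorph_extend {X E : Type*} [TopologicalSpace X]
    [TopologicalSpace E] (Φ : OpenPartialHomeomorph X E) (Θ : E ≃ₜ E) {S : Set X}
    (hS : IsClosed S) (hSs : S ⊆ Φ.source) (hmaps : ∀ x ∈ S, ∃ y ∈ S, Φ y = Θ (Φ x))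
    (hmaps' : ∀ x ∈ S, ∃ y ∈ S, Φ y = Θ.symm (Φ x))
    (hid : ∀ x ∈ Φ.source, x ∉ S → Θ (Φ x) = Φ x) :
    ∃ P : X ≃ₜ X, (∀ x ∈ Φ.source, P x ∈ Φ.source ∧ Φ (P x) = Θ (Φ x)) ∧ ∀ x ∉ S, P x = x := by
  classical
  have key : ∀ Θ : E ≃ₜ E, (∀ x ∈ S, ∃ y ∈ S, Φ y = Θ (Φ x)) →
      (∀ x ∈ Φ.source, x ∉ S → Θ (Φ x) = Φ x) →
      ∃ f : X → X, Continuous f ∧ (∀ x ∈ Φ.source, f x ∈ Φ.source ∧ Φ (f x) = Θ (Φ x)) ∧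
        ∀ x ∉ S, f x = x := by
    intro Θ hmaps hid
    have ht : ∀ x ∈ Φ.source, Θ (Φ x) ∈ Φ.target := by
      intro x hx
      by_cases hxS : x ∈ S
      · obtain ⟨y, hy, hyx⟩ := hmaps x hxS
        rw [← hyx]; exact Φ.map_source (hSs hy)
      · rw [hid x hx hxS]; exact Φ.map_source hx
    have hf1 : ∀ x ∈ Φ.source, (if x ∈ Φ.source then Φ.symm (Θ (Φ x)) else x) =
        Φ.symm (Θ (Φ x)) := fun x hx => if_pos hx
    have hf2 : ∀ x ∉ S, (if x ∈ Φ.source then Φ.symm (Θ (Φ x)) else x) = x := by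
      intro x hx
      split_ifs with h
      · rw [hid x h hx, Φ.left_inv h]
      · rfl
    refine ⟨fun x => if x ∈ Φ.source then Φ.symm (Θ (Φ x)) else x, ?_, fun x hx => ?_, hf2⟩
    · rw [continuous_iff_continuousAt]
      intro x
      by_cases hx : x ∈ S
      · have hxs := hSs hx
        have h1 : ContinuousAt (fun x => Φ.symm (Θ (Φ x))) x :=
          (Φ.symm.continuousAt (ht x hxs)).comp
            (f := fun x => Θ (Φ x)) (Θ.continuous.continuousAt.comp (Φ.continuousAt hxs))
        refine h1.congr ?_
        filter_upwards [Φ.open_source.mem_nhds hxs] with y hy using (hf1 y hy).symm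
      · refine continuousAt_id.congr ?_
        filter_upwards [hS.isOpen_compl.mem_nhds hx] with y hy using (hf2 y hy).symm
    · simp only [hf1 x hx]
      exact ⟨Φ.map_target (ht x hx), Φ.right_inv (ht x hx)⟩
  obtain ⟨f, hf, hf1, hf2⟩ := key Θ hmaps hid
  have hid' : ∀ x ∈ Φ.source, x ∉ S → Θ.symm (Φ x) = Φ x := fun x hx hxS => by
    rw [Homeomorph.symm_apply_eq, hid x hx hxS]
  obtain ⟨g, hg, hg1, hg2⟩ := key Θ.symm hmaps' hid'
  refine ⟨⟨⟨f, g, fun x => ?_, fun x => ?_⟩, hf, hg⟩, hf1, hf2⟩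
  · by_cases hx : x ∈ S
    · have h1 := hf1 x (hSs hx)
      have h2 := hg1 _ h1.1
      refine Φ.injOn h2.1 (hSs hx) ?_
      rw [h2.2, h1.2, Homeomorph.symm_apply_apply]
    · rw [hf2 x hx, hg2 x hx]
  · by_cases hx : x ∈ S
    · have h1 := hg1 x (hSs hx)
      have h2 := hf1 _ h1.1
      refine Φ.injOn h2.1 (hSs hx) ?_
      rw [h2.2, h1.2, Homeomorph.apply_symm_apply]
    · rw [hg2 x hx, hf2 x hx]

/-- Moves `(-∞, 0]` down by `s` and fixes `[s, ∞)`. -/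
def pushDown (s τ : ℝ) : ℝ := min τ (max (2 * τ - s) (τ - s))

/-- The inverse of `pushDown s`. -/
noncomputable def pushUp (s τ : ℝ) : ℝ := max τ (min ((τ + s) / 2) (τ + s))

/-- `pushDown s` has slopes 1, 2, 1 with breaks at `0` and `s`; its inverse has breaks at `-s` and
`s`. The form with `min` and `max` is jointly PL in `s` and `τ`, so that `s` may vary along the
boundary. -/
theorem pushUp_pushDown {s : ℝ} (hs : 0 ≤ s) (τ : ℝ) : pushUp s (pushDown s τ) = τ := by
  unfold pushUp pushDown
  rcases le_total (2 * τ - s) (τ - s) with h | h <;>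
  rcases le_total τ s with h' | h' <;> grind

theorem pushDown_pushUp {s : ℝ} (hs : 0 ≤ s) (τ : ℝ) : pushDown s (pushUp s τ) = τ := by
  unfold pushUp pushDown
  rcases le_total τ (-s) with h | h <;>
  rcases le_total τ s with h' | h' <;> grind

theorem pushDown_of_nonpos {s τ : ℝ} (hs : 0 ≤ s) (h : τ ≤ 0) : pushDown s τ = τ - s := by
  unfold pushDown; grind

theorem pushDown_of_le {s τ : ℝ} (h : s ≤ τ) : pushDown s τ = τ := by
  unfold pushDown; grind

theorem pushDown_zero (τ : ℝ) : pushDown 0 τ = τ := by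
  unfold pushDown; grind

theorem pushDown_le (s τ : ℝ) : pushDown s τ ≤ τ := min_le_left _ _

theorem pushUp_le {s τ δ : ℝ} (hs : s ≤ δ) (h : τ ≤ δ) : pushUp s τ ≤ δ := by
  unfold pushUp; grind

theorem continuous_pushDown : Continuous fun p : ℝ × ℝ => pushDown p.1 p.2 := by
  unfold pushDown; fun_prop

theorem continuous_pushUp : Continuous fun p : ℝ × ℝ => pushUp p.1 p.2 := by
  unfold pushUp; fun_prop

section Germs

variable {Z E : Type*} [AddCommGroup E] [Module ℝ E] {l : Filter Z} {a : Z → E} {s t : Z → ℝ}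

theorem IsPLGerm.pushDown (hs : IsPLGerm l a s) (ht : IsPLGerm l a t) :
    IsPLGerm l a (fun z => pushDown (s z) (t z)) :=
  ht.min (((ht.const_mul 2).sub hs).max (ht.sub hs))

theorem IsPLGerm.pushUp (hs : IsPLGerm l a s) (ht : IsPLGerm l a t) :
    IsPLGerm l a (fun z => pushUp (s z) (t z)) := by
  refine (ht.max (((ht.add hs).const_mul (1 / 2)).min (ht.add hs))).congr
    (Eventually.of_forall fun z => ?_)
  simp only [_root_.pushUp]
  ring_nf

end Germs

/-! ### PL shears of Euclidean space in the normal direction -/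

section Shear

variable {n : ℕ} [NeZero n]

theorem IsPLGerm.coord {n : ℕ} {Z : Type*} (l : Filter Z) (a : Z → EuclideanSpace ℝ (Fin n)) (i : Fin n) :
    IsPLGerm l a (fun z => a z i) :=
  IsPLGerm.linear _ _ (EuclideanSpace.proj (𝕜 := ℝ) i).toLinearMap

/-- The `ℓ¹` distance of the projections to the boundary hyperplane. -/
noncomputable def hyperDist (v₀ v : EuclideanSpace ℝ (Fin n)) : ℝ :=
  ∑ i, |(hyperProj v).val i - v₀ i|

/-- A piecewise linear bump function that does not depend on the normal coordinate. -/
noncomputable def bump (v₀ : EuclideanSpace ℝ (Fin n)) (δ : ℝ) (v : EuclideanSpace ℝ (Fin n)) : ℝ :=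
  max 0 (δ - hyperDist v₀ v)

theorem hyperProj_add_smul (v : EuclideanSpace ℝ (Fin n)) (t : ℝ) :
    hyperProj (v + t • normalVec n) = hyperProj v := by
  apply Subtype.ext
  simp only [hyperProj_val, PiLp.add_apply, PiLp.smul_apply, normalVec_zero, smul_eq_mul, mul_one,
    add_smul]
  abel

theorem hyperDist_nonneg (v₀ v : EuclideanSpace ℝ (Fin n)) : 0 ≤ hyperDist v₀ v :=
  Finset.sum_nonneg fun _ _ => abs_nonneg _

theorem hyperDist_add_smul (v₀ v : EuclideanSpace ℝ (Fin n)) (t : ℝ) :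
    hyperDist v₀ (v + t • normalVec n) = hyperDist v₀ v := by
  simp only [hyperDist, hyperProj_add_smul]

theorem bump_add_smul (v₀ v : EuclideanSpace ℝ (Fin n)) (δ t : ℝ) :
    bump v₀ δ (v + t • normalVec n) = bump v₀ δ v := by
  simp only [bump, hyperDist_add_smul]

theorem bump_nonneg (v₀ v : EuclideanSpace ℝ (Fin n)) (δ : ℝ) : 0 ≤ bump v₀ δ v := le_max_left _ _

theorem bump_le (v₀ v : EuclideanSpace ℝ (Fin n)) {δ : ℝ} (hδ : 0 ≤ δ) : bump v₀ δ v ≤ δ :=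
  max_le hδ (by linarith [hyperDist_nonneg v₀ v])

theorem continuous_hyperDist (v₀ : EuclideanSpace ℝ (Fin n)) : Continuous (hyperDist v₀) := by
  unfold hyperDist
  simp only [hyperProj_val]
  fun_prop

theorem continuous_bump (v₀ : EuclideanSpace ℝ (Fin n)) (δ : ℝ) : Continuous (bump v₀ δ) :=
  continuous_const.max (continuous_const.sub (continuous_hyperDist v₀))

/-- Built from absolute values of affine functions; this is the reason for the `ℓ¹` distance in
`hyperDist`. -/
theorem IsPLGerm.bump {Z : Type*} (l : Filter Z) (a : Z → EuclideanSpace ℝ (Fin n))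
    (v₀ : EuclideanSpace ℝ (Fin n)) (δ : ℝ) : IsPLGerm l a (fun z => bump v₀ δ (a z)) := by
  refine (IsPLGerm.const l a 0).max ((IsPLGerm.const l a δ).sub (IsPLGerm.sum _ fun i _ => ?_))
  refine IsPLGerm.abs (IsPLGerm.sub ?_ (IsPLGerm.const l a _))
  exact ((IsPLGerm.refl l a).sub ((IsPLGerm.coord l a 0).smul_const (normalVec n))).trans
    (IsPLGerm.coord l _ i)

/-- The homeomorphism of Euclidean space that pushes down in the normal direction by the amount
prescribed by a bump function. -/
noncomputable def shear (v₀ : EuclideanSpace ℝ (Fin n)) (δ : ℝ) :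
    EuclideanSpace ℝ (Fin n) ≃ₜ EuclideanSpace ℝ (Fin n) where
  toFun v := v + (pushDown (bump v₀ δ v) (v 0) - v 0) • normalVec n
  invFun v := v + (pushUp (bump v₀ δ v) (v 0) - v 0) • normalVec n
  left_inv v := by
    simp only [bump_add_smul, PiLp.add_apply, PiLp.smul_apply, normalVec_zero, smul_eq_mul, mul_one,
      add_sub_cancel, pushUp_pushDown (bump_nonneg v₀ v δ)]
    rw [add_assoc, ← add_smul]
    simp
  right_inv v := by
    simp only [bump_add_smul, PiLp.add_apply, PiLp.smul_apply, normalVec_zero, smul_eq_mul, mul_one,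
      add_sub_cancel, pushDown_pushUp (bump_nonneg v₀ v δ)]
    rw [add_assoc, ← add_smul]
    simp
  continuous_toFun := by
    have h : Continuous fun v : EuclideanSpace ℝ (Fin n) => pushDown (bump v₀ δ v) (v 0) :=
      continuous_pushDown.comp ((continuous_bump v₀ δ).prodMk (by fun_prop))
    fun_prop
  continuous_invFun := by
    have h : Continuous fun v : EuclideanSpace ℝ (Fin n) => pushUp (bump v₀ δ v) (v 0) :=
      continuous_pushUp.comp ((continuous_bump v₀ δ).prodMk (by fun_prop))
    fun_prop

theorem shear_apply (v₀ v : EuclideanSpace ℝ (Fin n)) (δ : ℝ) :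
    shear v₀ δ v = v + (pushDown (bump v₀ δ v) (v 0) - v 0) • normalVec n := rfl

theorem shear_symm_apply (v₀ v : EuclideanSpace ℝ (Fin n)) (δ : ℝ) :
    (shear v₀ δ).symm v = v + (pushUp (bump v₀ δ v) (v 0) - v 0) • normalVec n := rfl

theorem BiPL.shear {Z : Type*} (l : Filter Z) (a : Z → EuclideanSpace ℝ (Fin n))
    (v₀ : EuclideanSpace ℝ (Fin n)) (δ : ℝ) : BiPL l a (fun z => shear v₀ δ (a z)) := by
  refine ⟨?_, ?_⟩
  · exact (IsPLGerm.refl l a).add ((((IsPLGerm.bump l a v₀ δ).pushDown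
      (IsPLGerm.coord l a 0)).sub (IsPLGerm.coord l a 0)).smul_const _)
  · set c := fun z => _root_.shear v₀ δ (a z) with hc
    refine ((IsPLGerm.refl l c).add ((((IsPLGerm.bump l c v₀ δ).pushUp
      (IsPLGerm.coord l c 0)).sub (IsPLGerm.coord l c 0)).smul_const (normalVec n))).congr
      (Eventually.of_forall fun z => ?_)
    have := (_root_.shear v₀ δ).symm_apply_apply (a z)
    rw [shear_symm_apply] at this
    exact this.symm

end Shear

/-! ### Collars -/

section Collar

variable {n : ℕ} [NeZero n] {W : Type*} [TopologicalSpace W]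

/-- The space `W` with an external open collar `B × (-∞, 0]` attached along `B`. -/
def ExtSpace (B : Set W) : Set (W × ℝ) := {p | p.2 ≤ 0 ∧ (p.2 = 0 ∨ p.1 ∈ B)}

/-- Coordinates on `ExtSpace B`. -/
noncomputable def extCoord (n : ℕ) [NeZero n] [ChartedSpace (EuclideanHalfSpace n) W] {B : Set W}
    (p q : ExtSpace B) : EuclideanSpace ℝ (Fin n) × ℝ :=
  (plCoord n p.1.1 q.1.1, q.1.2)

/-- The projection of Euclidean space to the half-space. -/
noncomputable def halfProj (v : EuclideanSpace ℝ (Fin n)) : EuclideanHalfSpace n :=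
  ⟨v + (max (v 0) 0 - v 0) • normalVec n, by simp⟩

theorem halfProj_val (v : EuclideanSpace ℝ (Fin n)) :
    (halfProj v).val = v + (max (v 0) 0 - v 0) • normalVec n := rfl

theorem continuous_halfProj :
    Continuous (halfProj : EuclideanSpace ℝ (Fin n) → EuclideanHalfSpace n) := by
  refine Continuous.subtype_mk ?_ _
  fun_prop

/-- The half-space with its external collar becomes all of Euclidean space: `halfProj v` is the foot
point and `min (v 0) 0` the depth in the collar. -/
theorem halfProj_add_min (v : EuclideanSpace ℝ (Fin n)) :
    (halfProj v).val + min (v 0) 0 • normalVec n = v := by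
  rw [halfProj_val, add_assoc, ← add_smul]
  have : max (v 0) 0 - v 0 + min (v 0) 0 = 0 := by
    have := max_add_min (v 0) 0; linarith
  rw [this, zero_smul, add_zero]

theorem halfProj_val_zero (v : EuclideanSpace ℝ (Fin n)) : (halfProj v).val 0 = max (v 0) 0 := by
  simp [halfProj_val]

theorem hyperDist_halfProj (v₀ v : EuclideanSpace ℝ (Fin n)) :
    hyperDist v₀ (halfProj v).val = hyperDist v₀ v := by
  rw [halfProj_val, hyperDist_add_smul]

theorem halfProj_add_smul_of_nonpos {v : EuclideanSpace ℝ (Fin n)} (h : v 0 = 0) {t : ℝ}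
    (ht : t ≤ 0) : (halfProj (v + t • normalVec n)).val = v := by
  simp [halfProj_val, h, ht]

omit [NeZero n] in
theorem EuclideanSpace.norm_le_sum_abs (w : EuclideanSpace ℝ (Fin n)) : ‖w‖ ≤ ∑ i, |w i| := by
  have h : w = ∑ i, w i • EuclideanSpace.single i (1 : ℝ) := by
    ext j
    simp [Finset.sum_apply, Pi.single_apply]
  conv_lhs => rw [h]
  refine (norm_sum_le _ _).trans (Finset.sum_le_sum fun i _ => ?_)
  simp [norm_smul]

/-- Around a boundary point the extended space looks like Euclidean space, where a shear supported
over a small box is available. On the external collar the shear acts at nonpositive heights, where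
`pushDown` is a translation; so there it lowers each fibre by the bump function `s`. -/
theorem exists_push [ChartedSpace (EuclideanHalfSpace n) W] (hW : IsPLManifold n W) {x₀ : W}
    (hx₀ : x₀ ∈ (𝓡∂ n).boundary W) :
    ∃ (P : ExtSpace ((𝓡∂ n).boundary W) ≃ₜ ExtSpace ((𝓡∂ n).boundary W)) (s : W → ℝ),
      (∀ x, 0 ≤ s x) ∧ (∀ᶠ x in 𝓝 x₀, 0 < s x) ∧ IsLocallyBiPL (extCoord n) (extCoord n) P ∧
      ∀ p, p.1.1 ∈ (𝓡∂ n).boundary W → (P p).1 = (p.1.1, p.1.2 - s p.1.1) := by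
  classical
  set B := (𝓡∂ n).boundary W with hB
  set e := chartAt (EuclideanHalfSpace n) x₀ with he
  have hxe : x₀ ∈ e.source := mem_chart_source _ x₀
  have hbd : ∀ x ∈ e.source, x ∈ B ↔ (e x).val 0 = 0 := fun x hx =>
    hW.mem_boundary_iff (chart_mem_atlas _ x₀) hx
  set v₀ := (e x₀).val with hv₀
  have hv₀0 : v₀ 0 = 0 := (hbd x₀ hxe).1 hx₀
  have hD0 : hyperDist v₀ v₀ = 0 := by simp [hyperDist, hyperProj_val, hv₀0]
  -- a compact box in the target of the chart
  obtain ⟨Ω, hΩ, hΩe⟩ := isOpen_induced_iff.1 e.open_target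
  have hv₀Ω : v₀ ∈ Ω := by
    have : e x₀ ∈ e.target := e.map_source hxe
    rw [← hΩe] at this; exact this
  obtain ⟨r, hr, hball⟩ := Metric.isOpen_iff.1 hΩ v₀ hv₀Ω
  -- The tangential and the normal displacement are each at most `δ`, so the box stays within `2r/3`
  -- of `v₀`.
  set δ := r / 3 with hδdef
  have hδ : 0 < δ := by positivity
  have hbox : ∀ v : EuclideanSpace ℝ (Fin n), 0 ≤ v 0 → v 0 ≤ δ → hyperDist v₀ v ≤ δ →
      v ∈ Metric.ball v₀ r := by
    intro v h0 h1 h2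
    rw [mem_ball_iff_norm]
    have e1 : v - v₀ = ((hyperProj v).val - v₀) + v 0 • normalVec n := by
      rw [hyperProj_val]; abel
    rw [e1]
    refine (norm_add_le _ _).trans_lt ?_
    have h3 : ‖(hyperProj v).val - v₀‖ ≤ δ := (EuclideanSpace.norm_le_sum_abs _).trans h2
    have h4 : ‖v 0 • normalVec n‖ ≤ δ := by
      rw [norm_smul, norm_normalVec, mul_one, Real.norm_eq_abs, abs_of_nonneg h0]; exact h1
    linarith
  set K : Set (EuclideanHalfSpace n) := {v | v.val 0 ≤ δ ∧ hyperDist v₀ v.val ≤ δ} with hK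
  have hKe : K ⊆ e.target := by
    rintro v ⟨h1, h2⟩
    rw [← hΩe]
    exact hball (hbox v.val v.2 h1 h2)
  have hKc : IsCompact K := by
    have hcl : IsClosedEmbedding (Subtype.val : EuclideanHalfSpace n → EuclideanSpace ℝ (Fin n)) :=
      IsClosed.isClosedEmbedding_subtypeVal
        (isClosed_le continuous_const (by fun_prop : Continuous
          fun v : EuclideanSpace ℝ (Fin n) => v 0))
    have hKcl : IsClosed K :=
      (isClosed_le (by fun_prop : Continuous fun v : EuclideanHalfSpace n => v.val 0)
        continuous_const).inter (isClosed_le ((continuous_hyperDist v₀).comp continuous_subtype_val) continuous_const)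
    refine (hcl.isCompact_preimage (isCompact_closedBall v₀ r)).of_isClosed_subset hKcl ?_
    rintro v ⟨h1, h2⟩
    exact Metric.ball_subset_closedBall (hbox v.val v.2 h1 h2)
  -- the extended chart
  have hfe : IsEmbedding (Subtype.val : ExtSpace B → W × ℝ) := IsEmbedding.subtypeVal
  have hje : IsEmbedding (fun v : EuclideanSpace ℝ (Fin n) => (halfProj v, min (v 0) 0)) := by
    have hc : Continuous (fun v : EuclideanSpace ℝ (Fin n) => (halfProj v, min (v 0) 0)) :=
      continuous_halfProj.prodMk (by fun_prop)
    have hl : Function.LeftInverse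
        (fun p : EuclideanHalfSpace n × ℝ => p.1.val + p.2 • normalVec n)
        (fun v : EuclideanSpace ℝ (Fin n) => (halfProj v, min (v 0) 0)) := halfProj_add_min
    exact hl.isEmbedding (by fun_prop) hc
  have : Nonempty (ExtSpace B) := ⟨⟨(x₀, 0), le_rfl, Or.inl rfl⟩⟩
  obtain ⟨Φ, hΦs, hΦt, hΦ⟩ := (e.prod (OpenPartialHomeomorph.refl ℝ)).exists_pullback hfe hje (by
    rintro ⟨w, t⟩ ⟨hw, -⟩
    change w ∈ e.source at hw
    rw [Subtype.range_val]
    change (t ≤ 0 ∧ (t = 0 ∨ w ∈ B)) ↔ (e w, t) ∈ _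
    rw [hbd w hw]
    constructor
    · rintro ⟨h1, h2⟩
      have h3 : min ((e w).val 0 + t) 0 = t ∧ max ((e w).val 0 + t) 0 = (e w).val 0 := by
        have := (e w).2
        rcases h2 with rfl | h2
        · rw [add_zero]; exact ⟨min_eq_right this, max_eq_left this⟩
        · rw [h2, zero_add]; exact ⟨min_eq_left h1, max_eq_right h1⟩
      refine ⟨(e w).val + t • normalVec n, Prod.ext (Subtype.ext ?_) ?_⟩
      · simp only [halfProj_val, PiLp.add_apply, PiLp.smul_apply, normalVec_zero, smul_eq_mul,
          mul_one, h3.2]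
        rw [add_assoc, ← add_smul]
        simp
      · simpa using h3.1
    · rintro ⟨v, hv⟩
      have e1 : halfProj v = e w := (Prod.ext_iff.1 hv).1
      have e2 : min (v 0) 0 = t := (Prod.ext_iff.1 hv).2
      rw [← e1, ← e2, halfProj_val_zero]
      refine ⟨min_le_right _ _, ?_⟩
      rcases le_total (v 0) 0 with h | h
      · exact Or.inr (max_eq_right h)
      · exact Or.inl (min_eq_right h))
  have hΦs' : ∀ p, p ∈ Φ.source ↔ p.1.1 ∈ e.source := fun p => by
    rw [hΦs]; exact ⟨fun h => h.1, fun h => ⟨h, mem_univ _⟩⟩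
  have hΦt' : ∀ v, v ∈ Φ.target ↔ halfProj v ∈ e.target := fun v => by
    rw [hΦt]; exact ⟨fun h => h.1, fun h => ⟨h, mem_univ _⟩⟩
  have hΦ1 : ∀ p ∈ Φ.source, halfProj (Φ p) = e p.1.1 := fun p hp =>
    (Prod.ext_iff.1 (hΦ p hp)).1
  have hΦ2 : ∀ p ∈ Φ.source, min (Φ p 0) 0 = p.1.2 := fun p hp =>
    (Prod.ext_iff.1 (hΦ p hp)).2
  have hΦ3 : ∀ p ∈ Φ.source, Φ p = (e p.1.1).val + p.1.2 • normalVec n := fun p hp => by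
    rw [← hΦ1 p hp, ← hΦ2 p hp, halfProj_add_min]
  -- `S` contains whole collar fibres and so need not be compact, but it is closed, as the preimage
  -- of a compact subset of `W`.
  set S : Set (ExtSpace B) := {p | p.1.1 ∈ e.symm '' K} with hS
  have hSc : IsClosed S := by
    have := hW.t2
    have h1 : IsCompact (e.symm '' K) := hKc.image_of_continuousOn (e.symm.continuousOn.mono hKe)
    exact h1.isClosed.preimage (continuous_fst.comp continuous_subtype_val)
  have hSs : S ⊆ Φ.source := by
    rintro p ⟨v, hv, hvp⟩
    rw [hΦs', ← hvp]; exact e.map_target (hKe hv)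
  have hSΦ : ∀ p ∈ Φ.source, p ∈ S ↔ Φ p 0 ≤ δ ∧ hyperDist v₀ (Φ p) ≤ δ := by
    intro p hp
    have hp' := (hΦs' p).1 hp
    have h1 : p ∈ S ↔ e p.1.1 ∈ K := by
      constructor
      · rintro ⟨v, hv, hvp⟩
        rw [← hvp, e.right_inv (hKe hv)]; exact hv
      · intro h
        exact ⟨_, h, e.left_inv hp'⟩
    rw [h1, ← hΦ1 p hp, hK, mem_ofPred_eq, hyperDist_halfProj, halfProj_val_zero, max_le_iff]
    exact ⟨fun h => ⟨h.1.1, h.2⟩, fun h => ⟨⟨h.1, hδ.le⟩, h.2⟩⟩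
  -- `Φ` takes `S` onto the full region bounded only by `δ`. The shear preserves this region both
  -- ways: it leaves `hyperDist` unchanged, and neither `pushDown` nor `pushUp` moves a height past
  -- `δ`.
  have hSsurj : ∀ v : EuclideanSpace ℝ (Fin n), v 0 ≤ δ → hyperDist v₀ v ≤ δ →
      ∃ p ∈ S, Φ p = v := by
    intro v h1 h2
    have hvt : v ∈ Φ.target := (hΦt' v).2 (hKe ⟨by
      rw [halfProj_val_zero]; exact max_le h1 hδ.le, by rw [hyperDist_halfProj]; exact h2⟩)
    refine ⟨Φ.symm v, (hSΦ _ (Φ.map_target hvt)).2 ?_, Φ.right_inv hvt⟩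
    rw [Φ.right_inv hvt]; exact ⟨h1, h2⟩
  obtain ⟨P, hP1, hP2⟩ := Φ.exists_homeomorph_extend (shear v₀ δ) hSc hSs
    (fun p hp => by
      obtain ⟨h1, h2⟩ := (hSΦ p (hSs hp)).1 hp
      refine hSsurj _ ?_ ?_
      · rw [shear_apply]
        simpa using (pushDown_le _ _).trans h1
      · rw [shear_apply, hyperDist_add_smul]; exact h2)
    (fun p hp => by
      obtain ⟨h1, h2⟩ := (hSΦ p (hSs hp)).1 hp
      refine hSsurj _ ?_ ?_
      · rw [shear_symm_apply]
        simpa using pushUp_le (bump_le _ _ hδ.le) h1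
      · rw [shear_symm_apply, hyperDist_add_smul]; exact h2)
    (fun p hp hpS => by
      rw [hSΦ p hp, not_and_or, not_le, not_le] at hpS
      have h1 : pushDown (bump v₀ δ (Φ p)) (Φ p 0) = Φ p 0 := by
        rcases hpS with h | h
        · exact pushDown_of_le ((bump_le _ _ hδ.le).trans h.le)
        · have : bump v₀ δ (Φ p) = 0 := max_eq_left (by linarith)
          rw [this, pushDown_zero]
      rw [shear_apply, h1, sub_self, zero_smul, add_zero])
  have hΦpl : ∀ p ∈ Φ.source, BiPL (𝓝 p) (extCoord n p) Φ := by
    intro p hp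
    have ht : Tendsto (fun q : ExtSpace B => q.1.1) (𝓝 p) (𝓝 p.1.1) :=
      (continuous_fst.comp continuous_subtype_val).continuousAt
    have h1 := ((hW.biPL_plCoord (chart_mem_atlas _ x₀) ((hΦs' p).1 hp)).comp_tendsto ht).prodMk
      (BiPL.refl (𝓝 p) (fun q : ExtSpace B => q.1.2))
    refine h1.trans ⟨?_, ?_⟩
    · refine ((IsPLGerm.fst _ _ _).add ((IsPLGerm.snd _ _ _).smul_const (normalVec n))).congr ?_
      filter_upwards [Φ.open_source.mem_nhds hp] with q hq using hΦ3 q hq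
    · have h0 : IsPLGerm (𝓝 p) Φ (fun q => Φ q 0) := IsPLGerm.coord _ _ 0
      have hc := IsPLGerm.const (𝓝 p) Φ (0 : ℝ)
      refine (((IsPLGerm.refl (𝓝 p) Φ).add
        (((h0.max hc).sub h0).smul_const (normalVec n))).prodMk (h0.min hc)).congr ?_
      filter_upwards [Φ.open_source.mem_nhds hp] with q hq
      rw [hΦ2 q hq, ← halfProj_val, hΦ1 q hq]
  refine ⟨P, fun x => if x ∈ e.source then bump v₀ δ (e x).val else 0, fun x => ?_, ?_, ?_, ?_⟩
  · dsimp only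
    split_ifs
    · exact bump_nonneg _ _ _
    · exact le_rfl
  · have h1 : ∀ᶠ x in 𝓝 x₀, 0 < bump v₀ δ (e x).val := by
      have hc : ContinuousAt (fun x => bump v₀ δ (e x).val) x₀ :=
        ((continuous_bump v₀ δ).comp continuous_subtype_val).continuousAt.comp (e.continuousAt hxe)
      refine hc.eventually (lt_mem_nhds ?_)
      change 0 < max 0 (δ - hyperDist v₀ v₀)
      rw [hD0, sub_zero]
      exact lt_max_of_lt_right hδ
    filter_upwards [h1, e.open_source.mem_nhds hxe] with x hx hxs
    rwa [if_pos hxs]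
  · rw [isLocallyBiPL_iff]
    intro p
    by_cases hp : p ∈ Φ.source
    · have h1 := (hΦpl p hp).trans (BiPL.shear (𝓝 p) Φ v₀ δ)
      have h2 := (hΦpl _ (hP1 p hp).1).symm.comp_tendsto P.continuous.continuousAt
      refine (h1.congr (EventuallyEq.refl _ _) ?_).trans h2
      filter_upwards [Φ.open_source.mem_nhds hp] with q hq using (hP1 q hq).2
    · have hpS : p ∉ S := fun h => hp (hSs h)
      refine BiPL.of_eventuallyEq ?_
      filter_upwards [hSc.isOpen_compl.mem_nhds hpS] with q hq
      rw [hP2 p hpS, hP2 q hq]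
  · intro p hp
    by_cases hps : p.1.1 ∈ e.source
    · have hpΦ := (hΦs' p).2 hps
      obtain ⟨h1, h2⟩ := hP1 p hpΦ
      have h0 : (e p.1.1).val 0 = 0 := (hbd _ hps).1 hp
      have hp2 : p.1.2 ≤ 0 := p.2.1
      have hΦ0 : Φ p 0 = p.1.2 := by rw [hΦ3 p hpΦ]; simp [h0]
      set σ := bump v₀ δ (e p.1.1).val with hσ
      have hσ0 : 0 ≤ σ := bump_nonneg _ _ _
      have hbump : bump v₀ δ (Φ p) = σ := by rw [hΦ3 p hpΦ, bump_add_smul]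
      have h3 : Φ (P p) = (e p.1.1).val + (p.1.2 - σ) • normalVec n := by
        rw [h2, shear_apply, hbump, hΦ0, pushDown_of_nonpos hσ0 hp2, hΦ3 p hpΦ, add_assoc,
          ← add_smul]
        congr 2; ring
      have hle : p.1.2 - σ ≤ 0 := by linarith
      have h4 : e (P p).1.1 = e p.1.1 := by
        rw [← hΦ1 _ h1, h3]
        exact Subtype.ext (halfProj_add_smul_of_nonpos h0 hle)
      have h5 : (P p).1.1 = p.1.1 := e.injOn ((hΦs' _).1 h1) hps h4
      have h6 : (P p).1.2 = p.1.2 - σ := by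
        rw [← hΦ2 _ h1, h3]
        simp [h0, hle]
      dsimp only
      rw [if_pos hps]
      exact Prod.ext h5 h6
    · have hpS : p ∉ S := fun h => hps ((hΦs' p).1 (hSs h))
      dsimp only
      rw [hP2 p hpS, if_neg hps, sub_zero]

theorem IsLocallyBiPL.comp {Z Y X E F G : Type*} [TopologicalSpace Z] [TopologicalSpace Y]
    [AddCommGroup E] [Module ℝ E] [AddCommGroup F] [Module ℝ F] [AddCommGroup G] [Module ℝ G]
    {c : Z → Z → E} {d : Y → Y → F} {d' : X → X → G} {g : Y → X} {f : Z → Y}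
    (hg : IsLocallyBiPL d d' g) (hf : IsLocallyBiPL c d f) (hfc : Continuous f) :
    IsLocallyBiPL c d' (g ∘ f) := fun z =>
  BiPL.trans (hf z) (BiPL.comp_tendsto (hg (f z)) hfc.continuousAt)

theorem IsLocallyBiPL.symm {Z Y E F : Type*} [TopologicalSpace Z] [TopologicalSpace Y]
    [AddCommGroup E] [Module ℝ E] [AddCommGroup F] [Module ℝ F]
    {c : Z → Z → E} {d : Y → Y → F} {f : Z ≃ₜ Y} (hf : IsLocallyBiPL c d f) :
    IsLocallyBiPL d c f.symm := by
  intro y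
  have h := (isLocallyBiPL_iff.1 hf (f.symm y)).symm.comp_tendsto f.symm.continuous.continuousAt
  simp only [Homeomorph.apply_symm_apply] at h
  exact h

/-- On the collar, pushes keep the foot point and translate the height, so under composition the
translation lengths add. Since none is negative, finitely many local pushes make the sum positive on
the whole compact boundary. -/
theorem exists_global_push [ChartedSpace (EuclideanHalfSpace n) W] (hW : IsPLManifold n W)
    (hc : IsCompact ((𝓡∂ n).boundary W)) :
    ∃ (P : ExtSpace ((𝓡∂ n).boundary W) ≃ₜ ExtSpace ((𝓡∂ n).boundary W)) (s : W → ℝ),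
      (∀ x, 0 ≤ s x) ∧ (∀ x ∈ (𝓡∂ n).boundary W, 0 < s x) ∧
      IsLocallyBiPL (extCoord n) (extCoord n) P ∧
      ∀ p, p.1.1 ∈ (𝓡∂ n).boundary W → (P p).1 = (p.1.1, p.1.2 - s p.1.1) := by
  refine IsCompact.induction_on (p := fun K : Set W =>
    ∃ (P : ExtSpace ((𝓡∂ n).boundary W) ≃ₜ ExtSpace ((𝓡∂ n).boundary W)) (s : W → ℝ),
      (∀ x, 0 ≤ s x) ∧ (∀ x ∈ K, 0 < s x) ∧ IsLocallyBiPL (extCoord n) (extCoord n) P ∧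
      ∀ p, p.1.1 ∈ (𝓡∂ n).boundary W → (P p).1 = (p.1.1, p.1.2 - s p.1.1)) hc ?_ ?_ ?_ ?_
  · exact ⟨Homeomorph.refl _, fun _ => 0, fun _ => le_rfl, by simp, fun p => BiPL.refl _ _,
      fun p _ => by simp⟩
  · rintro K K' hK ⟨P, s, h1, h2, h3⟩
    exact ⟨P, s, h1, fun x hx => h2 x (hK hx), h3⟩
  · rintro K K' ⟨P, s, h1, h2, h3, h4⟩ ⟨P', s', h1', h2', h3', h4'⟩
    refine ⟨P.trans P', fun x => s x + s' x, fun x => add_nonneg (h1 x) (h1' x), ?_,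
      h3'.comp h3 P.continuous, fun p hp => ?_⟩
    · rintro x (hx | hx)
      · exact add_pos_of_pos_of_nonneg (h2 x hx) (h1' x)
      · exact add_pos_of_nonneg_of_pos (h1 x) (h2' x hx)
    · have e1 := h4 p hp
      have e2 : (P p).1.1 = p.1.1 := by rw [e1]
      have e3 := h4' (P p) (by rw [e2]; exact hp)
      change (P' (P p)).1 = _
      rw [e3, e2, e1]
      simp only [Prod.mk.injEq, true_and]
      ring
  · intro x hx
    obtain ⟨P, s, h1, h2, h3⟩ := exists_push hW hx
    exact ⟨_, mem_nhdsWithin_of_mem_nhds h2, P, s, h1, fun x hx => hx, h3⟩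

end Collar

/-- The collar theorem: a compact boundary has a piecewise linear collar. -/
theorem exists_collar {n : ℕ} [NeZero n] {W : Type*} [TopologicalSpace W]
    [ChartedSpace (EuclideanHalfSpace n) W] (hW : IsPLManifold n W)
    (hc : IsCompact ((𝓡∂ n).boundary W)) :
    ∃ κ : (𝓡∂ n).boundary W × Ico (0 : ℝ) 1 → W, IsOpenEmbedding κ ∧
      (∀ y, κ (y, ⟨0, by norm_num⟩) = y.val) ∧
      (∀ z, κ z ∈ (𝓡∂ n).boundary W → (z.2 : ℝ) = 0) ∧
      IsLocallyBiPL (fun z w => (plCoord n z.1.val w.1.val, (w.2 : ℝ))) (plCoord n) κ := by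
  have hpush := exists_global_push hW hc
  set B := (𝓡∂ n).boundary W with hB
  obtain ⟨P, s, hs0, hspos, hPpl, hP⟩ := hpush
  let i : W → ExtSpace B := fun w => ⟨(w, 0), le_rfl, Or.inl rfl⟩
  have hi : Continuous i := Continuous.subtype_mk (by fun_prop) _
  -- `s` comes without continuity; on `B` it is recovered as the depth to which `P` moves the
  -- boundary point.
  have hsB : Continuous fun b : B => s b := by
    have h1 : Continuous fun b : B => -(P (i b)).1.2 :=
      (continuous_snd.comp (continuous_subtype_val.comp
        (P.continuous.comp (hi.comp continuous_subtype_val)))).neg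
    refine h1.congr fun b => ?_
    have h2 : (P (i b)).1 = ((i b).1.1, (i b).1.2 - s (i b).1.1) := hP (i b) b.2
    rw [h2]
    simp [i]
  obtain ⟨η, hη, hηs⟩ : ∃ η > 0, ∀ b ∈ B, η ≤ s b := by
    rcases B.eq_empty_or_nonempty with h | h
    · exact ⟨1, one_pos, by simp [h]⟩
    · obtain ⟨b, hb, hmin⟩ := hc.exists_isMinOn h (continuousOn_iff_continuous_domRestrict.2 hsB)
      exact ⟨s b, hspos b hb, fun b' hb' => hmin hb'⟩
  have hjle : ∀ z : B × Ico (0 : ℝ) 1, η * z.2 - s z.1 ≤ 0 := fun z => by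
    have h1 := hηs z.1 z.1.2
    have h2 := z.2.2.2
    nlinarith
  -- `P` lowers the boundary point `b` to height `-s b`. The strip of width `η` directly above that
  -- level still lies in the external collar, and `P.symm` carries it into `W`: this is the collar
  -- sought.
  let j : B × Ico (0 : ℝ) 1 → ExtSpace B := fun z =>
    ⟨(z.1.val, η * z.2 - s z.1), hjle z, Or.inr z.1.2⟩
  have hjval : ∀ z, (j z).1 = (z.1.val, η * z.2 - s z.1) := fun z => rfl
  have hjemb : IsEmbedding j := by
    have h1 : IsEmbedding fun z : B × Ico (0 : ℝ) 1 => (z.1, (z.2 : ℝ)) :=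
      IsEmbedding.id.prodMap IsEmbedding.subtypeVal
    have h2 : IsEmbedding fun z : B × ℝ => (z.1, η * z.2 - s z.1) := by
      have hl : Function.LeftInverse (fun z : B × ℝ => (z.1, (z.2 + s z.1) / η))
          (fun z : B × ℝ => (z.1, η * z.2 - s z.1)) := fun z =>
        Prod.ext rfl (by simp [hη.ne'])
      have hs1 : Continuous fun z : B × ℝ => s z.1 := hsB.comp continuous_fst
      exact hl.isEmbedding
        (continuous_fst.prodMk ((continuous_snd.add hs1).div_const η))
        (continuous_fst.prodMk ((continuous_const.mul continuous_snd).sub hs1))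
    have h3 : IsEmbedding fun z : B × ℝ => (z.1.val, z.2) :=
      IsEmbedding.subtypeVal.prodMap IsEmbedding.id
    have h4 : IsEmbedding (Subtype.val ∘ j) := (h3.comp h2).comp h1
    exact IsEmbedding.of_comp
      (Continuous.subtype_mk h4.continuous _) continuous_subtype_val h4
  -- points of the inner part of the collar come from `W`
  have hq : ∀ z (hb : (P.symm (j z)).1.1 ∈ B), (P.symm (j z)).1.1 = z.1 ∧
      (P.symm (j z)).1.2 = η * z.2 := by
    intro z hb
    have h1 := hP _ hb
    rw [P.apply_symm_apply, hjval] at h1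
    obtain ⟨h2, h3⟩ := Prod.ext_iff.1 h1
    simp only at h2 h3
    rw [← h2] at h3
    exact ⟨h2.symm, by linarith⟩
  have hq0 : ∀ z, (P.symm (j z)).1.2 = 0 := by
    intro z
    rcases (P.symm (j z)).2 with ⟨h1, h2 | h2⟩
    · exact h2
    · refine le_antisymm h1 ?_
      rw [(hq z h2).2]
      exact mul_nonneg hη.le z.2.2.1
  let κ : B × Ico (0 : ℝ) 1 → W := fun z => (P.symm (j z)).1.1
  have hiκ : ∀ z, i (κ z) = P.symm (j z) := fun z =>
    Subtype.ext (Prod.ext rfl (hq0 z).symm)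
  have hκemb : IsEmbedding κ := by
    have h1 : IsEmbedding (i ∘ κ) := by
      have : i ∘ κ = P.symm ∘ j := funext hiκ
      rw [this]; exact P.symm.isEmbedding.comp hjemb
    refine IsEmbedding.of_comp ?_ hi h1
    exact continuous_fst.comp (continuous_subtype_val.comp (P.symm.continuous.comp
      hjemb.continuous))
  have hrange : range κ = i ⁻¹' (P ⁻¹' {p | p.1.1 ∈ B ∧ p.1.2 < η - s p.1.1}) := by
    ext w
    simp only [mem_preimage, mem_ofPred_eq]
    constructor
    · rintro ⟨z, rfl⟩
      rw [hiκ, P.apply_symm_apply, hjval]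
      refine ⟨z.1.2, ?_⟩
      have := z.2.2.2
      simp only
      nlinarith
    · rintro ⟨h1, h2⟩
      set b := (P (i w)).1.1 with hb
      set u := (P (i w)).1.2 with hu
      have h3 : 0 ≤ u + s b := by
        by_contra hneg
        push Not at hneg
        let q : ExtSpace B := ⟨(b, u + s b), hneg.le, Or.inr h1⟩
        have h4 : P q = P (i w) := Subtype.ext ((hP q h1).trans (Prod.ext rfl (by simp [q, hu])))
        have h5 : q.1.2 = 0 := by rw [P.injective h4]
        have h6 : q.1.2 = u + s b := rfl
        linarith
      let z : B × Ico (0 : ℝ) 1 := (⟨b, h1⟩, ⟨(u + s b) / η, div_nonneg h3 hη.le, by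
        rw [div_lt_one hη]; linarith⟩)
      have h4 : j z = P (i w) := by
        refine Subtype.ext (Prod.ext rfl ?_)
        change η * ((u + s b) / η) - s b = u
        field_simp
        ring
      refine ⟨z, ?_⟩
      change (P.symm (j z)).1.1 = w
      rw [h4, P.symm_apply_apply]
  -- The strip lies at negative heights, which occur only over `B`, and over `B` the function `s` is
  -- continuous.
  have hopen : IsOpen {p : ExtSpace B | p.1.1 ∈ B ∧ p.1.2 < η - s p.1.1} := by
    have hN : IsOpen {p : ExtSpace B | p.1.2 < 0} :=
      isOpen_lt (continuous_snd.comp continuous_subtype_val) continuous_const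
    have hNB : ∀ p : {p : ExtSpace B | p.1.2 < 0}, p.1.1.1 ∈ B := fun p =>
      p.1.2.2.resolve_left (ne_of_lt p.2)
    have hc1 : Continuous fun p : {p : ExtSpace B | p.1.2 < 0} => (⟨p.1.1.1, hNB p⟩ : B) :=
      Continuous.subtype_mk
        (continuous_fst.comp (continuous_subtype_val.comp continuous_subtype_val)) _
    have hc2 : Continuous fun p : {p : ExtSpace B | p.1.2 < 0} => s p.1.1.1 := hsB.comp hc1
    have hO : IsOpen {p : {p : ExtSpace B | p.1.2 < 0} | p.1.1.2 < η - s p.1.1.1} :=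
      isOpen_lt (continuous_snd.comp (continuous_subtype_val.comp continuous_subtype_val))
        (continuous_const.sub hc2)
    have := hN.isOpenMap_subtype_val _ hO
    convert this using 1
    ext p
    constructor
    · rintro ⟨h1, h2⟩
      have h3 : p.1.2 < 0 := by have := hηs _ h1; linarith
      exact ⟨⟨p, h3⟩, h2, rfl⟩
    · rintro ⟨q, hq, rfl⟩
      exact ⟨hNB q, hq⟩
  have hκ0 : ∀ y, κ (y, ⟨0, by norm_num⟩) = y.val := by
    intro y
    have h1 : j (y, ⟨0, by norm_num⟩) = P (i y) := by
      refine Subtype.ext ?_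
      rw [hP (i y) y.2, hjval]
      simp [i]
    change (P.symm (j _)).1.1 = _
    rw [h1, P.symm_apply_apply]
  refine ⟨κ, ⟨hκemb, ?_⟩, hκ0, ?_, ?_⟩
  · rw [hrange]
    exact hi.isOpen_preimage _ (P.continuous.isOpen_preimage _ hopen)
  · intro z hz
    have h1 := (hq z hz).2
    rw [hq0 z] at h1
    exact (mul_eq_zero.1 h1.symm).resolve_left hη.ne'
  · rw [isLocallyBiPL_iff]
    intro z
    set c : B × Ico (0 : ℝ) 1 → EuclideanSpace ℝ (Fin n) := fun w => plCoord n z.1.val w.1.val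
      with hcdef
    -- `s` is PL along the boundary because it is a coordinate of the PL map `P`.
    have hsg : IsPLGerm (𝓝 z) c (fun w => s w.1) := by
      have ht : Tendsto (fun w : B × Ico (0 : ℝ) 1 => i w.1) (𝓝 z) (𝓝 (i z.1)) :=
        (hi.comp (continuous_subtype_val.comp continuous_fst)).continuousAt
      have h1 := ((isLocallyBiPL_iff.1 hPpl (i z.1)).comp_tendsto ht).1
      have h2 : IsPLGerm (𝓝 z) c
          (fun w => extCoord n (P (i z.1)) (P (i w.1))) := (BiPL.prod_const (𝓝 z) c (0 : ℝ)).1.trans h1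
      have h3 := (h2.trans (IsPLGerm.snd (𝓝 z) _ _)).const_mul (-1)
      refine h3.congr (Eventually.of_forall fun w => ?_)
      have h4 : (P (i w.1)).1 = ((i w.1).1.1, (i w.1).1.2 - s (i w.1).1.1) := hP (i w.1) w.1.2
      dsimp only
      rw [h4]
      simp [i]
    have hA : BiPL (𝓝 z) (fun w => (c w, (w.2 : ℝ))) (fun w => (c w, η * w.2 - s w.1)) := by
      refine ⟨(IsPLGerm.fst _ _ _).prodMk (((IsPLGerm.snd _ _ _).const_mul η).sub
        ((IsPLGerm.fst _ _ _).trans hsg)), (IsPLGerm.fst _ _ _).prodMk ?_⟩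
      have h1 := ((IsPLGerm.snd (𝓝 z) c (fun w => η * w.2 - s w.1)).add
        ((IsPLGerm.fst _ _ _).trans hsg)).const_mul (1 / η)
      refine h1.congr (Eventually.of_forall fun w => ?_)
      simp only
      field_simp
      ring
    have hBg := (isLocallyBiPL_iff.1 hPpl.symm (j z)).comp_tendsto hjemb.continuous.continuousAt
    refine (hA.trans hBg).trans ?_
    have hC := (BiPL.prod_const (𝓝 z) (fun w => plCoord n (κ z) (κ w)) (0 : ℝ)).symm
    refine hC.congr (Eventually.of_forall fun w => ?_) (EventuallyEq.refl _ _)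
    simp only [extCoord, hq0]
    rfl

/-! ### Homotopy equivalences and strong deformation retracts -/

theorem continuous_of_isClosed_cover {X Y : Type*} [TopologicalSpace X] [TopologicalSpace Y]
    {f : X → Y} {C D : Set X} (hC : IsClosed C) (hD : IsClosed D) (h : ∀ x, x ∈ C ∨ x ∈ D)
    (hfC : Continuous fun x : C => f x) (hfD : Continuous fun x : D => f x) : Continuous f := by
  rw [← continuousOn_univ, show (univ : Set X) = C ∪ D from (eq_univ_of_forall h).symm]
  exact (continuousOn_iff_continuous_domRestrict.2 hfC).union_of_isClosed
    (continuousOn_iff_continuous_domRestrict.2 hfD) hC hD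

/-- On the open range the extension is `f`, and on the open complement of `C` it is `g`; these two
open sets cover `X`. -/
theorem Topology.IsOpenEmbedding.continuous_extend {Z X Y : Type*} [TopologicalSpace Z]
    [TopologicalSpace X] [TopologicalSpace Y] {κ : Z → X} (hκ : IsOpenEmbedding κ) {f : Z → Y}
    {g : X → Y} (hf : Continuous f) (hg : Continuous g) {C : Set X} (hC : IsClosed C)
    (hCκ : C ⊆ range κ) (hfg : ∀ z, κ z ∉ C → f z = g (κ z)) :
    Continuous (Function.extend κ f g) := by
  rw [continuous_iff_continuousAt]
  intro x
  by_cases hx : x ∈ C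
  · obtain ⟨z, rfl⟩ := hCκ hx
    rw [← hκ.continuousAt_iff]
    have : Function.extend κ f g ∘ κ = f := funext fun z => hκ.injective.extend_apply f g z
    rw [this]
    exact hf.continuousAt
  · refine hg.continuousAt.congr ?_
    filter_upwards [hC.isOpen_compl.mem_nhds hx] with y hy
    by_cases hyκ : y ∈ range κ
    · obtain ⟨z, rfl⟩ := hyκ
      rw [hκ.injective.extend_apply, hfg z hy]
    · rw [Function.extend_apply' _ _ _ (fun ⟨z, hz⟩ => hyκ ⟨z, hz⟩)]

section HomotopyEquiv

variable {X Y Z : Type*} [TopologicalSpace X] [TopologicalSpace Y] [TopologicalSpace Z]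

/-- The map `f` is a homotopy equivalence. -/
def IsHE (f : X → Y) : Prop := ∃ e : X ≃ₕ Y, ∀ x, e x = f x

theorem inclIsHomotopyEquiv_iff {A : Set X} :
    InclIsHomotopyEquiv A ↔ IsHE (Subtype.val : A → X) := Iff.rfl

theorem isHE_homeomorph (h : X ≃ₜ Y) : IsHE h := ⟨h.toHomotopyEquiv, fun _ => rfl⟩

theorem IsHE.comp {f : X → Y} {g : Y → Z} (hg : IsHE g) (hf : IsHE f) : IsHE (g ∘ f) := by
  obtain ⟨e, he⟩ := hf
  obtain ⟨e', he'⟩ := hg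
  exact ⟨e.trans e', fun x => by simp [he, he']⟩

/-- Part of two-out-of-three: a homotopy inverse of `f` is `g` followed by a homotopy inverse of `g
∘ f`. -/
theorem IsHE.of_comp {f : X → Y} {g : Y → Z} (hf : Continuous f) (hg : IsHE g)
    (hgf : IsHE (g ∘ f)) : IsHE f := by
  obtain ⟨e, he⟩ := hg
  obtain ⟨k, hk⟩ := hgf
  let fC : C(X, Y) := ⟨f, hf⟩
  have hcomp : e.toFun.comp fC = k.toFun := by
    ext x
    have h1 := he (f x)
    have h2 := hk x
    exact h1.trans h2.symm
  refine ⟨⟨fC, k.invFun.comp e.toFun, ?_, ?_⟩, fun x => rfl⟩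
  · rw [ContinuousMap.comp_assoc, hcomp]
    exact k.left_inv
  · -- `f k g ≃ g' g f k g ≃ g' g ≃ id`
    have h1 : (fC.comp (k.invFun.comp e.toFun)).Homotopic
        ((e.invFun.comp e.toFun).comp (fC.comp (k.invFun.comp e.toFun))) := by
      have := e.left_inv.symm.comp (ContinuousMap.Homotopic.refl
        (fC.comp (k.invFun.comp e.toFun)))
      simpa using this
    have h2 : ((e.invFun.comp e.toFun).comp (fC.comp (k.invFun.comp e.toFun))) =
        e.invFun.comp ((k.toFun.comp k.invFun).comp e.toFun) := by
      rw [← hcomp]; rfl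
    have h3 : (e.invFun.comp ((k.toFun.comp k.invFun).comp e.toFun)).Homotopic
        (e.invFun.comp ((ContinuousMap.id Z).comp e.toFun)) :=
      (ContinuousMap.Homotopic.refl e.invFun).comp
        (k.right_inv.comp (ContinuousMap.Homotopic.refl e.toFun))
    rw [h2] at h1
    refine (h1.trans h3).trans ?_
    simpa using e.left_inv

/-- `A` is a strong deformation retract of `X`. -/
def IsSDR (A : Set X) : Prop :=
  ∃ r : C(X, X), (∀ x, r x ∈ A) ∧ (ContinuousMap.id X).HomotopicRel r A

theorem IsSDR.isHE {A : Set X} (h : IsSDR A) {f : Z → X} (hf : IsEmbedding f)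
    (hr : range f = A) : IsHE f := by
  obtain ⟨r, hrA, ⟨H⟩⟩ := h
  have hlift : ∀ x, ∃ z, f z = r x := fun x => by
    have := hrA x; rw [← hr] at this; exact this
  choose g hg using hlift
  have hgc : Continuous g := by
    rw [hf.continuous_iff]
    have : f ∘ g = r := funext hg
    rw [this]; exact r.continuous
  have hrz : ∀ z, r (f z) = f z := fun z => by
    have := H.fst_eq_snd (x := f z) (by rw [← hr]; exact mem_range_self z)
    exact this.symm
  refine ⟨⟨⟨f, hf.continuous⟩, ⟨g, hgc⟩, ?_, ?_⟩, fun x => rfl⟩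
  · have : (⟨g, hgc⟩ : C(X, Z)).comp ⟨f, hf.continuous⟩ = ContinuousMap.id Z := by
      ext z
      exact hf.injective ((hg (f z)).trans (hrz z))
    rw [this]
  · have : (⟨f, hf.continuous⟩ : C(Z, X)).comp ⟨g, hgc⟩ = r := by
      ext x
      exact hg x
    rw [this]
    exact ⟨H.toHomotopy.symm⟩

theorem IsSDR.inclIsHomotopyEquiv {A : Set X} (h : IsSDR A) : InclIsHomotopyEquiv A :=
  h.isHE IsEmbedding.subtypeVal Subtype.range_val

/-- A collar yields a deformation of the identity that collapses the inner third of the collar, and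
a function that vanishes exactly on `A` inside of it. -/
theorem exists_collapse [T2Space X] {A : Set X} (hA : IsCompact A)
    {κ : A × Ico (0 : ℝ) 1 → X} (hκ : IsOpenEmbedding κ)
    (hκ0 : ∀ a, κ (a, ⟨0, by norm_num⟩) = a) :
    ∃ (u : X → ℝ) (ρ : X × unitInterval → X), Continuous u ∧ Continuous ρ ∧
      (∀ x, 0 ≤ u x ∧ u x ≤ 1) ∧ (∀ a ∈ A, u a = 0) ∧ (∀ x, ρ (x, 0) = x) ∧
      (∀ a ∈ A, ∀ t, ρ (a, t) = a) ∧ ∀ x, u x < 1 → ρ (x, 1) ∈ A := by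
  have := isCompact_iff_compactSpace.1 hA
  have hκ0' : ∀ a (ha : a ∈ A), κ (⟨a, ha⟩, ⟨0, by norm_num⟩) = a := fun a ha => hκ0 ⟨a, ha⟩
  set T : Set (Ico (0 : ℝ) 1) := {t | t.val ≤ 2 / 3} with hT
  have hTc : IsCompact T := by
    rw [Subtype.isCompact_iff]
    have : ((↑) '' T : Set ℝ) = Icc 0 (2 / 3) := by
      ext t
      constructor
      · rintro ⟨s, hs, rfl⟩
        exact ⟨s.2.1, hs⟩
      · rintro ⟨h1, h2⟩
        exact ⟨⟨t, h1, by linarith⟩, h2, rfl⟩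
    rw [this]
    exact isCompact_Icc
  set C : Set X := κ '' (univ ×ˢ T) with hC
  have hCc : IsClosed C := ((isCompact_univ.prod hTc).image hκ.continuous).isClosed
  have hCr : C ⊆ range κ := image_subset_range _ _
  have hnC : ∀ z, κ z ∉ C → 2 / 3 < (z.2 : ℝ) := by
    intro z hz
    by_contra h
    exact hz ⟨z, ⟨mem_univ _, not_lt.1 h⟩, rfl⟩
  -- A linear homotopy from the identity to the map that collapses `[0, 1/3]` to `0`, stretches
  -- `[1/3, 2/3]` onto `[0, 2/3]`, and fixes the rest.
  let sh : ℝ → ℝ → ℝ := fun s τ => (1 - s) * τ + s * max 0 (min τ (2 * τ - 2 / 3))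
  have hm : ∀ τ : ℝ, 0 ≤ τ → 0 ≤ max 0 (min τ (2 * τ - 2 / 3)) ∧
      max 0 (min τ (2 * τ - 2 / 3)) ≤ τ := fun τ h =>
    ⟨le_max_left _ _, max_le h (min_le_left _ _)⟩
  have hsh : ∀ (s : unitInterval) (τ : Ico (0 : ℝ) 1), sh s τ ∈ Ico (0 : ℝ) 1 := by
    intro s τ
    obtain ⟨h1, h2⟩ := hm τ τ.2.1
    have hs0 := s.2.1
    have hs1 := s.2.2
    have h3 := τ.2.1
    have h4 := τ.2.2
    refine ⟨add_nonneg (mul_nonneg (by linarith) h3) (mul_nonneg hs0 h1), ?_⟩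
    refine lt_of_le_of_lt (b := (τ : ℝ)) ?_ h4
    have := mul_le_mul_of_nonneg_left h2 hs0
    simp only [sh]
    linarith
  -- The factor 3 makes `u < 1` exactly on the collapsed third of the collar.
  let u : X → ℝ := Function.extend κ (fun z => min 1 (3 * (z.2 : ℝ))) (fun _ => 1)
  have huκ : ∀ z, u (κ z) = min 1 (3 * (z.2 : ℝ)) := fun z => hκ.injective.extend_apply _ _ z
  have hu' : ∀ x, x ∉ range κ → u x = 1 := fun x hx =>
    Function.extend_apply' _ _ _ (fun ⟨z, hz⟩ => hx ⟨z, hz⟩)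
  have hκi : IsOpenEmbedding (Prod.map κ (id : unitInterval → unitInterval)) :=
    hκ.prodMap IsOpenEmbedding.id
  let ρ : X × unitInterval → X := Function.extend (Prod.map κ (id : unitInterval → unitInterval))
    (fun z => κ (z.1.1, ⟨sh z.2 z.1.2, hsh _ _⟩)) Prod.fst
  have hρκ : ∀ z s, ρ (κ z, s) = κ (z.1, ⟨sh s z.2, hsh _ _⟩) := fun z s =>
    hκi.injective.extend_apply _ _ (z, s)
  have hρ' : ∀ x s, x ∉ range κ → ρ (x, s) = x := fun x s hx =>
    Function.extend_apply' _ _ _ (fun ⟨z, hz⟩ => hx ⟨z.1, congrArg Prod.fst hz⟩)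
  refine ⟨u, ρ, ?_, ?_, ?_, ?_, ?_, ?_, ?_⟩
  · refine hκ.continuous_extend (by fun_prop) continuous_const hCc hCr fun z hz => ?_
    have := hnC z hz
    exact min_eq_left (by linarith)
  · refine hκi.continuous_extend ?_ continuous_fst (hCc.prod isClosed_univ) ?_ ?_
    · refine hκ.continuous.comp ((continuous_fst.comp continuous_fst).prodMk
        (Continuous.subtype_mk ?_ _))
      simp only [sh]
      fun_prop
    · rintro ⟨x, s⟩ ⟨hx, -⟩
      obtain ⟨z, rfl⟩ := hCr hx
      exact ⟨(z, s), rfl⟩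
    · rintro ⟨z, s⟩ hz
      have h1 : 2 / 3 < (z.2 : ℝ) := hnC z fun h => hz ⟨h, mem_univ _⟩
      have h2 : sh s z.2 = z.2 := by
        simp only [sh]
        rw [min_eq_left (by linarith), max_eq_right (by linarith)]
        ring
      change κ (z.1, ⟨sh s z.2, _⟩) = κ z
      congr 1
      exact Prod.ext rfl (Subtype.ext h2)
  · intro x
    by_cases hx : x ∈ range κ
    · obtain ⟨z, rfl⟩ := hx
      rw [huκ]
      have := z.2.2.1
      exact ⟨le_min zero_le_one (by linarith), min_le_left _ _⟩
    · rw [hu' x hx]; norm_num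
  · intro a ha
    rw [← hκ0' a ha, huκ]
    simp
  · intro x
    by_cases hx : x ∈ range κ
    · obtain ⟨z, rfl⟩ := hx
      rw [hρκ]
      congr 1
      exact Prod.ext rfl (Subtype.ext (by simp [sh]))
    · exact hρ' x _ hx
  · intro a ha t
    conv_lhs => rw [← hκ0' a ha]
    rw [hρκ]
    conv_rhs => rw [← hκ0' a ha]
    congr 1
    exact Prod.ext rfl (Subtype.ext (by simp [sh]))
  · intro x hx
    by_cases hxr : x ∈ range κ
    · obtain ⟨z, rfl⟩ := hxr
      rw [huκ, min_lt_iff] at hx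
      have h1 : 3 * (z.2 : ℝ) < 1 := hx.resolve_left (lt_irrefl _)
      rw [hρκ]
      have h2 : (⟨sh (1 : unitInterval) z.2, hsh _ _⟩ : Ico (0 : ℝ) 1) = ⟨0, by norm_num⟩ := by
        refine Subtype.ext ?_
        simp only [sh, Set.Icc.coe_one]
        rw [max_eq_left]
        · ring
        · exact (min_le_right _ _).trans (by linarith)
      rw [h2, hκ0]
      exact z.1.2
    · rw [hu' x hxr] at hx
      exact absurd hx (lt_irrefl _)

/-- A collared compact subspace whose inclusion is a homotopy equivalence is a strong deformation
retract. -/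
theorem isSDR_of_collar [T2Space X] {A : Set X} (hA : IsCompact A)
    {κ : A × Ico (0 : ℝ) 1 → X} (hκ : IsOpenEmbedding κ)
    (hκ0 : ∀ a, κ (a, ⟨0, by norm_num⟩) = a) (h : InclIsHomotopyEquiv A) : IsSDR A := by
  classical
  obtain ⟨u, ρ, hu, hρ, hu01, huA, hρ0, hρA, hρ1⟩ := exists_collapse hA hκ hκ0
  obtain ⟨e, he⟩ := h
  obtain ⟨K⟩ := e.left_inv
  obtain ⟨L⟩ := e.right_inv
  have heval : ∀ a, e.toFun a = (a : X) := he
  set g : C(X, A) := e.invFun with hg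
  have hK0 : ∀ a, K (0, a) = g a := fun a => by
    rw [K.apply_zero]
    change g (e.toFun a) = g a
    rw [heval]
  have hK1 : ∀ a, K (1, a) = a := fun a => K.apply_one a
  let ρ₁ : X → X := fun x => ρ (x, 1)
  have hρ₁c : Continuous ρ₁ := hρ.comp (by fun_prop)
  have hCl : IsClosed {x | ρ₁ x ∈ A} := hA.isClosed.preimage hρ₁c
  have hDl : IsClosed {x | u x = 1} := isClosed_eq hu continuous_const
  have hcov : ∀ x, ρ₁ x ∈ A ∨ u x = 1 := fun x => by
    by_cases hx : u x < 1
    · exact Or.inl (hρ1 x hx)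
    · exact Or.inr (le_antisymm (hu01 x).2 (not_lt.1 hx))
  let τ : X → unitInterval → unitInterval := fun x s =>
    ⟨(1 - u x) * s, mul_nonneg (by linarith [(hu01 x).2]) s.2.1,
      mul_le_one₀ (by linarith [(hu01 x).1]) s.2.1 s.2.2⟩
  have hτc : Continuous fun p : unitInterval × X => τ p.2 p.1 :=
    Continuous.subtype_mk (by fun_prop) _
  -- The homotopy extension property by hand: `K`, from `g` restricted to `A` to the identity of
  -- `A`, is extended to a homotopy that starts at `g ∘ ρ₁`. The factor `1 - u` damps it to its
  -- initial value where `u = 1`, so the two formulas agree.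
  let R : unitInterval × X → X := fun p =>
    if h : ρ₁ p.2 ∈ A then (K (τ p.2 p.1, ⟨ρ₁ p.2, h⟩) : X) else g (ρ₁ p.2)
  have hR1 : ∀ s x (h : ρ₁ x ∈ A), R (s, x) = K (τ x s, ⟨ρ₁ x, h⟩) := fun s x h => dif_pos h
  have hR2 : ∀ s x, u x = 1 → R (s, x) = g (ρ₁ x) := by
    intro s x hx
    by_cases h : ρ₁ x ∈ A
    · have : τ x s = 0 := Subtype.ext (by simp [τ, hx])
      rw [hR1 s x h, this, hK0]
    · exact dif_neg h
  have hRc : Continuous R := by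
    refine continuous_of_isClosed_cover (C := {p | ρ₁ p.2 ∈ A}) (D := {p | u p.2 = 1})
      (hCl.preimage continuous_snd) (hDl.preimage continuous_snd) (fun p => hcov p.2) ?_ ?_
    · have : Continuous fun p : {p : unitInterval × X | ρ₁ p.2 ∈ A} =>
          (K (τ p.1.2 p.1.1, ⟨ρ₁ p.1.2, p.2⟩) : X) := by
        refine continuous_subtype_val.comp (K.continuous.comp ?_)
        exact (hτc.comp continuous_subtype_val).prodMk (Continuous.subtype_mk
          (hρ₁c.comp (continuous_snd.comp continuous_subtype_val)) _)
      exact this.congr fun p => (hR1 p.1.1 p.1.2 p.2).symm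
    · have : Continuous fun p : {p : unitInterval × X | u p.2 = 1} => (g (ρ₁ p.1.2) : X) :=
        continuous_subtype_val.comp (g.continuous.comp (hρ₁c.comp
          (continuous_snd.comp continuous_subtype_val)))
      exact this.congr fun p => (hR2 p.1.1 p.1.2 p.2).symm
  let r : C(X, X) := ⟨fun x => R (1, x), hRc.comp (by fun_prop)⟩
  have hrA : ∀ x, r x ∈ A := by
    intro x
    change R (1, x) ∈ A
    rcases hcov x with h | h
    · rw [hR1 1 x h]; exact Subtype.coe_prop _
    · rw [hR2 1 x h]; exact Subtype.coe_prop _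
  have hrfix : ∀ a ∈ A, r a = a := by
    intro a ha
    have h1 : ρ₁ a = a := hρA a ha 1
    change R (1, a) = a
    have h2 : ρ₁ a ∈ A := by rw [h1]; exact ha
    have h3 : τ a 1 = 1 := Subtype.ext (by simp [τ, huA a ha])
    rw [hR1 1 a h2, h3, hK1]
    exact h1
  let ρC : C(X, X) := ⟨ρ₁, hρ₁c⟩
  -- The retraction `r` is so far only freely homotopic to the identity; this homotopy may move `A`.
  have hD : (ContinuousMap.id X).Homotopic r := by
    have h1 : (ContinuousMap.id X).Homotopic (e.toFun.comp g) := ⟨L.symm⟩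
    have h2 : (ContinuousMap.id X).Homotopic ρC :=
      ⟨⟨⟨fun p => ρ (p.2, p.1), hρ.comp (by fun_prop)⟩, fun x => hρ0 x, fun x => rfl⟩⟩
    have h3 : (e.toFun.comp g).Homotopic ((e.toFun.comp g).comp ρC) := by
      simpa using (ContinuousMap.Homotopic.refl (e.toFun.comp g)).comp h2
    have h4 : ((e.toFun.comp g).comp ρC).Homotopic r := by
      refine ⟨⟨⟨R, hRc⟩, fun x => ?_, fun x => rfl⟩⟩
      change R (0, x) = e.toFun (g (ρ₁ x))
      rw [heval]
      rcases hcov x with h | h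
      · have : τ x 0 = 0 := Subtype.ext (by simp [τ])
        rw [hR1 0 x h, this, hK0]
      · exact hR2 0 x h
    exact (h1.trans h3).trans h4
  obtain ⟨D⟩ := hD
  let D' : ℝ × X → X := fun p => D (projIcc 0 1 zero_le_one p.1, p.2)
  have hD'c : Continuous D' :=
    D.continuous.comp ((continuous_projIcc.comp continuous_fst).prodMk continuous_snd)
  have hD'0 : ∀ x, D' (0, x) = x := fun x => by
    have : projIcc (0 : ℝ) 1 zero_le_one 0 = 0 := projIcc_left _
    simp only [D', this, D.apply_zero, ContinuousMap.id_apply]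
  have hD'1 : ∀ x, D' (1, x) = r x := fun x => by
    have : projIcc (0 : ℝ) 1 zero_le_one 1 = 1 := projIcc_right _
    simp only [D', this, D.apply_one]
  -- A homotopy from `ρ₁` to `r ∘ ρ₁`: along `D` from `ρ₁ x` up to time `u x`, then back along `D`
  -- to `r (ρ₁ x)`. At the turn the paths meet, because `ρ₁ x ∈ A` is fixed by `r`, or `u x = 1` and
  -- `r` is idempotent. On `A` both paths are constant, since `u = 0` there.
  let F : unitInterval × X → X := fun p =>
    if (p.1 : ℝ) ≤ 1 / 2 then D' (2 * p.1 * u p.2, ρ₁ p.2)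
    else D' ((2 - 2 * p.1) * u p.2, r (ρ₁ p.2))
  have hFc : Continuous F := by
    refine Continuous.if_le (hD'c.comp (by fun_prop)) (hD'c.comp (by fun_prop)) (by fun_prop)
      continuous_const ?_
    rintro ⟨t, x⟩ ht
    simp only at ht ⊢
    rw [ht]
    rcases hcov x with h | h
    · rw [hrfix _ h]; norm_num
    · rw [h]
      norm_num
      rw [hD'1, hD'1, hrfix _ (hrA _)]
  refine ⟨r.comp ρC, fun x => hrA _, ?_⟩
  have h1 : (ContinuousMap.id X).HomotopicRel ρC A :=
    ⟨⟨⟨⟨fun p => ρ (p.2, p.1), hρ.comp (by fun_prop)⟩, fun x => hρ0 x, fun x => rfl⟩,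
      fun t x hx => hρA x hx t⟩⟩
  refine h1.trans ⟨⟨⟨⟨F, hFc⟩, fun x => ?_, fun x => ?_⟩, fun t x hx => ?_⟩⟩
  · change F (0, x) = ρ₁ x
    simp [F, hD'0]
  · change F (1, x) = r (ρ₁ x)
    have : ¬ (1 : ℝ) ≤ 1 / 2 := by norm_num
    simp only [F, Set.Icc.coe_one, if_neg this]
    norm_num [hD'0]
  · change F (t, x) = ρ₁ x
    have h2 : ρ₁ x = x := hρA x hx 1
    simp only [F, huA x hx, mul_zero, hD'0, h2, hrfix x hx, ite_self]

end HomotopyEquiv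

/-! ### Topology of the adjunction space -/

namespace HCobordismStack

variable {n : ℕ} [NeZero n] (S : HCobordismStack.{u} n)

theorem cobordism (i : ℕ) : IsCompactCobordism n (S.M i) (S.N i) := (S.oneSided i).1

theorem isPLManifold (i : ℕ) : IsPLManifold n (S.W i) := (S.cobordism i).isPLManifold

theorem boundary_eq (i : ℕ) : (𝓡∂ n).boundary (S.W i) = S.M i ∪ S.N i := (S.cobordism i).boundary_eq

instance (i : ℕ) : CompactSpace (S.W i) := (S.cobordism i).compact

instance (i : ℕ) : T2Space (S.W i) := (S.isPLManifold i).t2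

theorem notMem_M_of_mem_N {i : ℕ} {x : S.W i} (hx : x ∈ S.N i) : x ∉ S.M i := fun h =>
  (S.cobordism i).disjoint.le_bot ⟨h, hx⟩

open Classical in
/-- The representative of a point of the adjunction space in the earliest possible piece. -/
noncomputable def canon : (Σ i, S.W i) → Σ i, S.W i
  | ⟨0, x⟩ => ⟨0, x⟩
  | ⟨i + 1, x⟩ => if h : x ∈ S.M (i + 1) then ⟨i, ((S.h i).symm ⟨x, h⟩).1⟩ else ⟨i + 1, x⟩

theorem canon_of_mem_N {i : ℕ} {x : S.W i} (hx : x ∈ S.N i) : S.canon ⟨i, x⟩ = ⟨i, x⟩ := by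
  cases i with
  | zero => rfl
  | succ i => exact dif_neg (S.notMem_M_of_mem_N hx)

theorem canon_succ_of_mem {i : ℕ} {x : S.W (i + 1)} (hx : x ∈ S.M (i + 1)) :
    S.canon ⟨i + 1, x⟩ = ⟨i, ((S.h i).symm ⟨x, hx⟩).1⟩ := dif_pos hx

theorem canon_succ_of_notMem {i : ℕ} {x : S.W (i + 1)} (hx : x ∉ S.M (i + 1)) :
    S.canon ⟨i + 1, x⟩ = ⟨i + 1, x⟩ := dif_neg hx

theorem incl_h (i : ℕ) (x : S.N i) : S.incl (i + 1) (S.h i x) = S.incl i x :=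
  (Quot.sound (Glue.glue i x)).symm

/-- `canon` descends to the quotient, so equality there is tested on representatives. One step back
suffices: the point reached lies in `N i`, which is disjoint from `M i`. -/
theorem canon_eq_of_incl_eq {i j : ℕ} {x : S.W i} {y : S.W j} (h : S.incl i x = S.incl j y) :
    S.canon ⟨i, x⟩ = S.canon ⟨j, y⟩ := by
  have hresp : ∀ p q, S.Glue p q → S.canon p = S.canon q := by
    rintro _ _ ⟨i, x⟩
    rw [S.canon_of_mem_N x.2, S.canon_succ_of_mem (S.h i x).2]
    simp
  exact congrArg (Quot.lift S.canon hresp) h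

theorem incl_injective (i : ℕ) : Function.Injective (S.incl i) := by
  intro x y hxy
  have h := S.canon_eq_of_incl_eq hxy
  cases i with
  | zero =>
    exact eq_of_heq (Sigma.mk.inj h).2
  | succ i =>
    by_cases hx : x ∈ S.M (i + 1) <;> by_cases hy : y ∈ S.M (i + 1)
    · rw [S.canon_succ_of_mem hx, S.canon_succ_of_mem hy] at h
      have h1 := (S.h i).symm.injective (Subtype.ext (eq_of_heq (Sigma.mk.inj h).2))
      exact congrArg Subtype.val h1
    · rw [S.canon_succ_of_mem hx, S.canon_succ_of_notMem hy] at h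
      exact absurd (congrArg Sigma.fst h) (by simp)
    · rw [S.canon_succ_of_notMem hx, S.canon_succ_of_mem hy] at h
      exact absurd (congrArg Sigma.fst h) (by simp)
    · rw [S.canon_succ_of_notMem hx, S.canon_succ_of_notMem hy] at h
      exact eq_of_heq (Sigma.mk.inj h).2

theorem canon_fst_le (p : Σ i, S.W i) : (S.canon p).1 ≤ p.1 := by
  obtain ⟨i, x⟩ := p
  cases i with
  | zero => exact le_rfl
  | succ i =>
    by_cases hx : x ∈ S.M (i + 1)
    · rw [S.canon_succ_of_mem hx]; exact Nat.le_succ i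
    · rw [S.canon_succ_of_notMem hx]

theorem incl_eq_incl_succ {i : ℕ} {x : S.W i} {y : S.W (i + 1)}
    (h : S.incl i x = S.incl (i + 1) y) : ∃ hx : x ∈ S.N i, y = S.h i ⟨x, hx⟩ := by
  have hc := S.canon_eq_of_incl_eq h
  by_cases hy : y ∈ S.M (i + 1)
  · have h1 : S.incl i x = S.incl i ((S.h i).symm ⟨y, hy⟩).1 := by
      rw [h, ← S.incl_h i]; simp
    have h2 := S.incl_injective i h1
    refine ⟨by rw [h2]; exact Subtype.coe_prop _, ?_⟩
    have h3 : (⟨x, by rw [h2]; exact Subtype.coe_prop _⟩ : S.N i) = (S.h i).symm ⟨y, hy⟩ :=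
      Subtype.ext h2
    rw [h3]; simp
  · rw [S.canon_succ_of_notMem hy] at hc
    have h1 := S.canon_fst_le ⟨i, x⟩
    rw [hc] at h1
    exact absurd h1 (by simp)

theorem incl_ne_of_lt {i j : ℕ} (hij : i + 1 < j) (x : S.W i) (y : S.W j) :
    S.incl i x ≠ S.incl j y := by
  intro h
  have hc := S.canon_eq_of_incl_eq h
  obtain ⟨k, rfl⟩ : ∃ k, j = k + 1 := ⟨j - 1, by omega⟩
  have h1 := S.canon_fst_le ⟨i, x⟩
  rw [hc] at h1
  by_cases hy : y ∈ S.M (k + 1)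
  · rw [S.canon_succ_of_mem hy] at h1
    simp only at h1
    omega
  · rw [S.canon_succ_of_notMem hy] at h1
    simp only at h1
    omega

theorem exists_incl_eq (p : S.Adjunction) : ∃ i x, S.incl i x = p := by
  induction p using Quot.ind with
  | mk q => exact ⟨q.1, q.2, rfl⟩

theorem continuous_incl (i : ℕ) : Continuous (S.incl i) :=
  continuous_quot_mk.comp continuous_sigmaMk

theorem isOpen_iff {O : Set S.Adjunction} : IsOpen O ↔ ∀ i, IsOpen (S.incl i ⁻¹' O) := by
  have h1 : IsOpen O ↔ IsOpen (Quot.mk S.Glue ⁻¹' O) := isQuotientMap_quot_mk.isOpen_preimage.symm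
  rw [h1, isOpen_sigma_iff]
  rfl

theorem isClosed_iff {C : Set S.Adjunction} : IsClosed C ↔ ∀ i, IsClosed (S.incl i ⁻¹' C) := by
  simp only [← isOpen_compl_iff, S.isOpen_iff, preimage_compl]

/-- Seen from piece `j`, the image of `C` is `C` itself if `j = i`, its trace on the common end
carried over by the gluing map if `j` is adjacent to `i`, and empty otherwise. -/
theorem isClosedMap_incl (i : ℕ) : IsClosedMap (S.incl i) := by
  intro C hC
  rw [S.isClosed_iff]
  intro j
  rcases lt_trichotomy j i with hji | rfl | hij
  · rcases Nat.lt_or_eq_of_le (Nat.succ_le_of_lt hji) with hlt | heq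
    · convert isClosed_empty
      rw [eq_empty_iff_forall_notMem]
      rintro x ⟨y, -, hyx⟩
      exact S.incl_ne_of_lt hlt x y hyx.symm
    · obtain rfl : j + 1 = i := heq
      have h1 : IsClosed {x : S.N j | (S.h j x : S.W (j + 1)) ∈ C} :=
        hC.preimage (continuous_subtype_val.comp (S.h j).continuous)
      convert (S.cobordism j).isClosed_right.isClosedMap_subtype_val _ h1 using 1
      ext x
      constructor
      · rintro ⟨y, hy, hyx⟩
        obtain ⟨hx, rfl⟩ := S.incl_eq_incl_succ hyx.symm
        exact ⟨⟨x, hx⟩, hy, rfl⟩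
      · rintro ⟨y, hy, rfl⟩
        exact ⟨_, hy, S.incl_h j y⟩
  · rwa [preimage_image_eq _ (S.incl_injective j)]
  · rcases Nat.lt_or_eq_of_le (Nat.succ_le_of_lt hij) with hlt | heq
    · convert isClosed_empty
      rw [eq_empty_iff_forall_notMem]
      rintro x ⟨y, -, hyx⟩
      exact S.incl_ne_of_lt hlt y x hyx
    · obtain rfl : i + 1 = j := heq
      have h1 : IsClosed {x : S.M (i + 1) | ((S.h i).symm x : S.W i) ∈ C} :=
        hC.preimage (continuous_subtype_val.comp (S.h i).symm.continuous)
      convert (S.cobordism (i + 1)).isClosed_left.isClosedMap_subtype_val _ h1 using 1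
      ext x
      constructor
      · rintro ⟨y, hy, hyx⟩
        obtain ⟨hx, rfl⟩ := S.incl_eq_incl_succ hyx
        exact ⟨S.h i ⟨y, hx⟩, by simpa using hy, rfl⟩
      · rintro ⟨y, hy, rfl⟩
        refine ⟨_, hy, ?_⟩
        rw [← S.incl_h i]; simp

theorem isClosedEmbedding_incl (i : ℕ) : IsClosedEmbedding (S.incl i) :=
  IsClosedEmbedding.of_continuous_injective_isClosedMap (S.continuous_incl i) (S.incl_injective i)
    (S.isClosedMap_incl i)

/-- Local finiteness: piece `j` meets no piece of index greater than `j + 1`. -/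
theorem isClosed_iUnion {A : ℕ → Set S.Adjunction} (hA : ∀ i, IsClosed (A i))
    (hAi : ∀ i, A i ⊆ range (S.incl i)) : IsClosed (⋃ i, A i) := by
  rw [S.isClosed_iff]
  intro j
  have : S.incl j ⁻¹' (⋃ i, A i) = S.incl j ⁻¹' (⋃ i ∈ Iic (j + 1), A i) := by
    ext x
    simp only [mem_preimage, mem_iUnion, mem_Iic, exists_prop]
    constructor
    · rintro ⟨i, hi⟩
      refine ⟨i, ?_, hi⟩
      by_contra hlt
      obtain ⟨y, hy⟩ := hAi i hi
      exact S.incl_ne_of_lt (not_le.1 hlt) x y hy.symm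
    · rintro ⟨i, -, hi⟩
      exact ⟨i, hi⟩
  rw [this]
  exact ((finite_Iic (j + 1)).isClosed_biUnion fun i _ => hA i).preimage (S.continuous_incl j)

instance : T2Space S.Adjunction := by
  have hclosed : IsClosedMap (Quot.mk S.Glue) := by
    intro C hC
    have h1 : Quot.mk S.Glue '' C = ⋃ i, S.incl i '' (Sigma.mk i ⁻¹' C) := by
      ext p
      constructor
      · rintro ⟨⟨i, x⟩, hx, rfl⟩
        exact mem_iUnion.2 ⟨i, x, hx, rfl⟩
      · intro h
        obtain ⟨i, x, hx, rfl⟩ := mem_iUnion.1 h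
        exact ⟨⟨i, x⟩, hx, rfl⟩
    rw [h1]
    exact S.isClosed_iUnion (fun i => S.isClosedMap_incl i _ (hC.preimage continuous_sigmaMk))
      (fun i => image_subset_range _ _)
  have hfin : ∀ p : S.Adjunction, (Quot.mk S.Glue ⁻¹' {p}).Finite := by
    intro p
    obtain ⟨j, y, rfl⟩ := S.exists_incl_eq p
    have h1 : Quot.mk S.Glue ⁻¹' {S.incl j y} ⊆
        ⋃ i ∈ Iic (j + 1), Sigma.mk i '' (S.incl i ⁻¹' {S.incl j y}) := by
      rintro ⟨i, x⟩ hx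
      refine mem_biUnion (x := i) ?_ ⟨x, hx, rfl⟩
      by_contra hlt
      exact S.incl_ne_of_lt (not_le.1 hlt) y x (Eq.symm hx)
    refine ((finite_Iic (j + 1)).biUnion fun i _ => Set.Finite.image _ ?_).subset h1
    exact Set.Subsingleton.finite fun x hx y hy => S.incl_injective i (hx.trans hy.symm)
  refine ⟨fun p q hpq => ?_⟩
  -- The quotient map is closed with finite fibres. Two fibres are separated in the disjoint union,
  -- and closedness shrinks the separating sets to open sets of the quotient.
  obtain ⟨A, B, hA, hB, hpA, hqB, hAB⟩ := SeparatedNhds.of_isCompact_isCompact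
    (hfin p).isCompact (hfin q).isCompact (by
      rw [Set.disjoint_left]
      rintro x hx hx'
      exact hpq (Eq.trans (Eq.symm hx) hx'))
  refine ⟨(Quot.mk S.Glue '' Aᶜ)ᶜ, (Quot.mk S.Glue '' Bᶜ)ᶜ, (hclosed _ hA.isClosed_compl).isOpen_compl,
    (hclosed _ hB.isClosed_compl).isOpen_compl, ?_, ?_, ?_⟩
  · rintro ⟨x, hx, rfl⟩
    exact hx (hpA rfl)
  · rintro ⟨x, hx, rfl⟩
    exact hx (hqB rfl)
  · rw [Set.disjoint_left]
    intro z hz hz'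
    obtain ⟨x, rfl⟩ := Quot.exists_rep z
    have h1 : x ∈ A := by by_contra h; exact hz ⟨x, h, rfl⟩
    have h2 : x ∈ B := by by_contra h; exact hz' ⟨x, h, rfl⟩
    exact Set.disjoint_left.1 hAB h1 h2

instance : SigmaCompactSpace S.Adjunction := by
  refine ⟨?_⟩
  have h : (univ : Set S.Adjunction) = range (Quot.mk S.Glue) :=
    (range_eq_univ.2 Quot.exists_rep).symm
  rw [h]
  exact isSigmaCompact_range continuous_quot_mk

theorem secondCountable [ChartedSpace (EuclideanHalfSpace n) S.Adjunction] :
    SecondCountableTopology S.Adjunction := by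
  have : SecondCountableTopology (EuclideanHalfSpace n) :=
    TopologicalSpace.Subtype.secondCountableTopology _
  exact ChartedSpace.secondCountable_of_sigmaCompact (EuclideanHalfSpace n) S.Adjunction

end HCobordismStack

/-! ### The piecewise linear structure of the adjunction space -/

theorem BiPL.of_map {Z Z' E F : Type*} [AddCommGroup E] [Module ℝ E] [AddCommGroup F] [Module ℝ F]
    {l : Filter Z} {f : Z → Z'} {a : Z' → E} {b : Z' → F}
    (h : BiPL l (fun z => a (f z)) (fun z => b (f z))) : BiPL (map f l) a b := by
  obtain ⟨⟨T, hT, hP, hab⟩, ⟨T', hT', hP', hab'⟩⟩ := h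
  exact ⟨⟨T, hT, hP, eventually_map.2 hab⟩, ⟨T', hT', hP', eventually_map.2 hab'⟩⟩

theorem BiPL.neg_right {Z E : Type*} [AddCommGroup E] [Module ℝ E] (l : Filter Z) (a : Z → E)
    (t : Z → ℝ) : BiPL l (fun z => (a z, t z)) (fun z => (a z, -t z)) := by
  have key : ∀ t : Z → ℝ, IsPLGerm l (fun z => (a z, t z)) (fun z => (a z, -t z)) := fun t =>
    (IsPLGerm.fst _ _ _).prodMk (by simpa using (IsPLGerm.snd l a t).const_mul (-1))
  exact ⟨key t, by simpa using key (fun z => -t z)⟩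

/-- A collar of a clopen part `A` of the boundary, parametrized by a homeomorphic copy of `A`. -/
theorem exists_collar_along {n : ℕ} [NeZero n] {W Z : Type*} [TopologicalSpace W]
    [ChartedSpace (EuclideanHalfSpace n) W] [TopologicalSpace Z]
    [ChartedSpace (EuclideanHalfSpace n) Z] (hW : IsPLManifold n W)
    (hc : IsCompact ((𝓡∂ n).boundary W)) {A : Set W} (hA : A ⊆ (𝓡∂ n).boundary W)
    (hAo : ∀ x ∈ A, ∀ᶠ z in 𝓝 x, z ∈ A ↔ z ∈ (𝓡∂ n).boundary W) {B : Set Z} {h : B ≃ₜ A}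
    (hh : IsPLHomeo n h) :
    ∃ κ : B × Ico (0 : ℝ) 1 → W, IsOpenEmbedding κ ∧
      (∀ y, κ (y, ⟨0, by norm_num⟩) = h y) ∧
      (∀ z, κ z ∈ (𝓡∂ n).boundary W → (z.2 : ℝ) = 0) ∧
      IsLocallyBiPL (fun z w => (plCoord n z.1.val w.1.val, (w.2 : ℝ))) (plCoord n) κ := by
  obtain ⟨κ, hκ, hκ0, hκb, hκpl⟩ := exists_collar hW hc
  have hι : IsOpenEmbedding (inclusion hA) := by
    refine ⟨IsEmbedding.inclusion hA, ?_⟩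
    rw [range_inclusion, isOpen_iff_mem_nhds]
    intro x hx
    filter_upwards [continuous_subtype_val.continuousAt.eventually (hAo x hx)] with y hy
    exact hy.2 y.2
  have hιh : IsOpenEmbedding fun y => inclusion hA (h y) := hι.comp h.isOpenEmbedding
  refine ⟨κ ∘ Prod.map (fun y => inclusion hA (h y)) id,
    hκ.comp (hιh.prodMap IsOpenEmbedding.id), fun y => hκ0 _, fun z hz => hκb _ hz, ?_⟩
  refine hκpl.comp (isLocallyBiPL_iff.2 fun z => ?_) (hιh.prodMap IsOpenEmbedding.id).continuous
  have h1 : BiPL (𝓝 z.1) (fun y : B => plCoord n z.1.val y.val)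
    (fun y => plCoord n (h z.1).val (h y).val) := hh z.1
  exact (h1.comp_tendsto continuous_fst.continuousAt).prodMk (BiPL.refl _ _)

/-- The positive part. -/
def posIco (t : Ioo (-1 : ℝ) 1) : Ico (0 : ℝ) 1 :=
  ⟨max t 0, le_max_right _ _, max_lt t.2.2 one_pos⟩

/-- The negative part. -/
def negIco (t : Ioo (-1 : ℝ) 1) : Ico (0 : ℝ) 1 :=
  ⟨max (-t) 0, le_max_right _ _, max_lt (by linarith [t.2.1]) one_pos⟩

theorem continuous_posIco : Continuous posIco :=
  Continuous.subtype_mk (by fun_prop) _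

theorem continuous_negIco : Continuous negIco :=
  Continuous.subtype_mk (by fun_prop) _

/-- The inclusion of `[0, 1)` in `(-1, 1)`. -/
def icoToIoo (s : Ico (0 : ℝ) 1) : Ioo (-1 : ℝ) 1 := ⟨s, by linarith [s.2.1], s.2.2⟩

/-- The reflected inclusion of `[0, 1)` in `(-1, 1)`. -/
def icoToIooNeg (s : Ico (0 : ℝ) 1) : Ioo (-1 : ℝ) 1 :=
  ⟨-s, by linarith [s.2.2], by linarith [s.2.1]⟩

theorem continuous_icoToIoo : Continuous icoToIoo :=
  Continuous.subtype_mk (by fun_prop) _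

theorem continuous_icoToIooNeg : Continuous icoToIooNeg :=
  Continuous.subtype_mk (by fun_prop) _

theorem posIco_icoToIoo (s : Ico (0 : ℝ) 1) : posIco (icoToIoo s) = s :=
  Subtype.ext (max_eq_left s.2.1)

theorem negIco_icoToIooNeg (s : Ico (0 : ℝ) 1) : negIco (icoToIooNeg s) = s :=
  Subtype.ext (by simpa [negIco, icoToIooNeg] using s.2.1)

theorem icoToIoo_posIco {t : Ioo (-1 : ℝ) 1} (h : 0 ≤ (t : ℝ)) : icoToIoo (posIco t) = t :=
  Subtype.ext (max_eq_left h)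

theorem icoToIooNeg_negIco {t : Ioo (-1 : ℝ) 1} (h : (t : ℝ) ≤ 0) : icoToIooNeg (negIco t) = t :=
  Subtype.ext (by simp [negIco, icoToIooNeg, h])

namespace HCobordismStack

variable {n : ℕ} [NeZero n] (S : HCobordismStack.{u} n)

theorem isCompact_boundary (i : ℕ) : IsCompact ((𝓡∂ n).boundary (S.W i)) :=
  (S.isPLManifold i).isClosed_boundary.isCompact

theorem M_subset (i : ℕ) : S.M i ⊆ (𝓡∂ n).boundary (S.W i) := by
  rw [S.boundary_eq]; exact subset_union_left

theorem N_subset (i : ℕ) : S.N i ⊆ (𝓡∂ n).boundary (S.W i) := by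
  rw [S.boundary_eq]; exact subset_union_right

theorem eventually_mem_N_iff {i : ℕ} {x : S.W i} (hx : x ∈ S.N i) :
    ∀ᶠ z in 𝓝 x, z ∈ S.N i ↔ z ∈ (𝓡∂ n).boundary (S.W i) := by
  filter_upwards [(S.cobordism i).isClosed_left.isOpen_compl.mem_nhds
    (S.notMem_M_of_mem_N hx)] with z hz
  rw [S.boundary_eq]
  exact (or_iff_right hz).symm

theorem eventually_mem_M_iff {i : ℕ} {x : S.W i} (hx : x ∈ S.M i) :
    ∀ᶠ z in 𝓝 x, z ∈ S.M i ↔ z ∈ (𝓡∂ n).boundary (S.W i) := by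
  filter_upwards [(S.cobordism i).isClosed_right.isOpen_compl.mem_nhds
    (fun h => S.notMem_M_of_mem_N h hx)] with z hz
  rw [S.boundary_eq]
  exact (or_iff_left hz).symm

/-- Collars on both sides of the `k`-th seam of the adjunction space. -/
structure SeamCollar (k : ℕ) where
  up : S.N k × Ico (0 : ℝ) 1 → S.W (k + 1)
  down : S.N k × Ico (0 : ℝ) 1 → S.W k
  up_open : IsOpenEmbedding up
  down_open : IsOpenEmbedding down
  up_zero : ∀ y, up (y, ⟨0, by norm_num⟩) = S.h k y
  down_zero : ∀ y, down (y, ⟨0, by norm_num⟩) = y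
  up_boundary : ∀ z, up z ∈ (𝓡∂ n).boundary (S.W (k + 1)) → (z.2 : ℝ) = 0
  down_boundary : ∀ z, down z ∈ (𝓡∂ n).boundary (S.W k) → (z.2 : ℝ) = 0
  up_pl : IsLocallyBiPL (fun z w => (plCoord n z.1.val w.1.val, (w.2 : ℝ))) (plCoord n) up
  down_pl : IsLocallyBiPL (fun z w => (plCoord n z.1.val w.1.val, (w.2 : ℝ))) (plCoord n) down

theorem nonempty_seamCollar (k : ℕ) : Nonempty (S.SeamCollar k) := by
  obtain ⟨up, h1, h2, h3, h4⟩ := exists_collar_along (S.isPLManifold (k + 1))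
    (S.isCompact_boundary (k + 1)) (S.M_subset (k + 1)) (fun x hx => S.eventually_mem_M_iff hx)
    (S.isPLHomeo k)
  obtain ⟨down, h1', h2', h3', h4'⟩ := exists_collar_along (S.isPLManifold k)
    (S.isCompact_boundary k) (S.N_subset k) (fun x hx => S.eventually_mem_N_iff hx)
    (h := Homeomorph.refl (S.N k)) (isLocallyBiPL_iff.2 fun z => BiPL.refl _ _)
  exact ⟨⟨up, down, h1, h1', h2, h2', h3, h3', h4, h4'⟩⟩

/-! ### The bicollar of a seam -/

namespace SeamCollar

variable {S} {k : ℕ} (C : S.SeamCollar k)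

/-- The bicollar of a seam. -/
noncomputable def bicollar (z : S.N k × Ioo (-1 : ℝ) 1) : S.Adjunction :=
  if 0 ≤ (z.2 : ℝ) then S.incl (k + 1) (C.up (z.1, posIco z.2))
  else S.incl k (C.down (z.1, negIco z.2))

theorem bicollar_of_nonneg {z : S.N k × Ioo (-1 : ℝ) 1} (h : 0 ≤ (z.2 : ℝ)) :
    C.bicollar z = S.incl (k + 1) (C.up (z.1, posIco z.2)) := if_pos h

theorem bicollar_of_nonpos {z : S.N k × Ioo (-1 : ℝ) 1} (h : (z.2 : ℝ) ≤ 0) :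
    C.bicollar z = S.incl k (C.down (z.1, negIco z.2)) := by
  rcases h.lt_or_eq with h | h
  · exact if_neg (not_le.2 h)
  · rw [C.bicollar_of_nonneg h.ge]
    have h1 : posIco z.2 = ⟨0, by norm_num⟩ := Subtype.ext (by simp [posIco, h])
    have h2 : negIco z.2 = ⟨0, by norm_num⟩ := Subtype.ext (by simp [negIco, h])
    rw [h1, h2, C.up_zero, C.down_zero, S.incl_h]

theorem bicollar_icoToIoo (y : S.N k) (s : Ico (0 : ℝ) 1) :
    C.bicollar (y, icoToIoo s) = S.incl (k + 1) (C.up (y, s)) := by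
  rw [C.bicollar_of_nonneg s.2.1, posIco_icoToIoo]

theorem bicollar_icoToIooNeg (y : S.N k) (s : Ico (0 : ℝ) 1) :
    C.bicollar (y, icoToIooNeg s) = S.incl k (C.down (y, s)) := by
  rw [C.bicollar_of_nonpos (by simpa [icoToIooNeg] using s.2.1), negIco_icoToIooNeg]

theorem bicollar_zero (y : S.N k) : C.bicollar (y, ⟨0, by norm_num⟩) = S.incl k y := by
  rw [C.bicollar_of_nonpos le_rfl]
  have h2 : negIco ⟨0, by norm_num⟩ = ⟨0, by norm_num⟩ := Subtype.ext (by simp [negIco])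
  rw [h2, C.down_zero]

theorem up_notMem_N (z) : C.up z ∉ S.N (k + 1) := by
  intro h
  have h1 : z.2 = ⟨0, by norm_num⟩ := Subtype.ext (C.up_boundary z (S.N_subset _ h))
  have h2 : z = (z.1, ⟨0, by norm_num⟩) := Prod.ext rfl h1
  rw [h2, C.up_zero] at h
  exact S.notMem_M_of_mem_N h (S.h k z.1).2

theorem down_notMem_M (z) : C.down z ∉ S.M k := by
  intro h
  have h1 : z.2 = ⟨0, by norm_num⟩ := Subtype.ext (C.down_boundary z (S.M_subset _ h))
  have h2 : z = (z.1, ⟨0, by norm_num⟩) := Prod.ext rfl h1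
  rw [h2, C.down_zero] at h
  exact S.notMem_M_of_mem_N z.1.2 h

theorem continuous_bicollar : Continuous C.bicollar := by
  refine Continuous.if_le (f' := fun z : S.N k × Ioo (-1 : ℝ) 1 =>
    S.incl (k + 1) (C.up (z.1, posIco z.2))) ?_ ?_ continuous_const (by fun_prop) ?_
  · exact (S.continuous_incl _).comp (C.up_open.continuous.comp
      (continuous_fst.prodMk (continuous_posIco.comp continuous_snd)))
  · exact (S.continuous_incl _).comp (C.down_open.continuous.comp
      (continuous_fst.prodMk (continuous_negIco.comp continuous_snd)))
  · intro z hz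
    rw [← C.bicollar_of_nonneg hz.le, ← C.bicollar_of_nonpos hz.ge]

theorem incl_up_eq_incl_down {z z'} (h : S.incl k (C.down z) = S.incl (k + 1) (C.up z')) :
    (z.2 : ℝ) = 0 ∧ (z'.2 : ℝ) = 0 ∧ z.1 = z'.1 := by
  obtain ⟨hN, hM⟩ := S.incl_eq_incl_succ h
  have h1 := C.down_boundary z (S.N_subset _ hN)
  have h2 := C.up_boundary z' (S.M_subset _ (by rw [hM]; exact Subtype.coe_prop _))
  have e1 : C.down z = z.1 := by
    rw [← C.down_zero]; congr 1; exact Prod.ext rfl (Subtype.ext h1)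
  have e2 : C.up z' = S.h k z'.1 := by
    rw [← C.up_zero]; congr 1; exact Prod.ext rfl (Subtype.ext h2)
  refine ⟨h1, h2, ?_⟩
  rw [e2] at hM
  rw [(S.h k).injective (Subtype.ext hM)]
  exact Subtype.ext e1.symm

theorem injective_bicollar : Function.Injective C.bicollar := by
  have hpos : ∀ z z' : S.N k × Ioo (-1 : ℝ) 1, 0 ≤ (z.2 : ℝ) → (z'.2 : ℝ) ≤ 0 →
      C.bicollar z = C.bicollar z' → z = z' := by
    intro z z' h h' he
    rw [C.bicollar_of_nonneg h, C.bicollar_of_nonpos h'] at he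
    obtain ⟨h1, h2, h3⟩ := C.incl_up_eq_incl_down he.symm
    refine Prod.ext h3.symm (Subtype.ext ?_)
    have e1 : (z.2 : ℝ) = 0 := by rw [← icoToIoo_posIco h]; exact h2
    have e2 : (z'.2 : ℝ) = 0 := by
      rw [← icoToIooNeg_negIco h']
      change -((negIco z'.2 : Ico (0 : ℝ) 1) : ℝ) = 0
      simp only at h1
      rw [h1, neg_zero]
    rw [e1, e2]
  intro z z' he
  rcases le_total 0 (z.2 : ℝ) with h | h <;> rcases le_total 0 (z'.2 : ℝ) with h' | h'
  · rw [C.bicollar_of_nonneg h, C.bicollar_of_nonneg h'] at he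
    have h1 := C.up_open.injective (S.incl_injective _ he)
    obtain ⟨e1, e2⟩ := Prod.ext_iff.1 h1
    refine Prod.ext e1 ?_
    rw [← icoToIoo_posIco h, ← icoToIoo_posIco h']
    exact congrArg icoToIoo e2
  · exact hpos z z' h h' he
  · exact (hpos z' z h' h he.symm).symm
  · rw [C.bicollar_of_nonpos h, C.bicollar_of_nonpos h'] at he
    have h1 := C.down_open.injective (S.incl_injective _ he)
    obtain ⟨e1, e2⟩ := Prod.ext_iff.1 h1
    refine Prod.ext e1 ?_
    rw [← icoToIooNeg_negIco h, ← icoToIooNeg_negIco h']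
    exact congrArg icoToIooNeg e2

/-- Openness is tested in each piece. In the two pieces at the seam the preimage is the image of
half of `O` under an open collar; in all others it is empty, because the collars miss the far ends.
-/
theorem isOpenMap_bicollar : IsOpenMap C.bicollar := by
  intro O hO
  have hup : S.incl (k + 1) ⁻¹' (C.bicollar '' O) =
      C.up '' {z | (z.1, icoToIoo z.2) ∈ O} := by
    ext w
    constructor
    · rintro ⟨z, hz, hzw⟩
      rcases le_total 0 (z.2 : ℝ) with h | h
      · refine ⟨(z.1, posIco z.2), ?_, ?_⟩
        · change (z.1, icoToIoo (posIco z.2)) ∈ O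
          rw [icoToIoo_posIco h]; exact hz
        · rw [C.bicollar_of_nonneg h] at hzw
          exact S.incl_injective _ hzw
      -- A point of the lower half that also lies in the upper piece is on the seam, so it has
      -- height 0.
      · have h0 : (z.2 : ℝ) = 0 := by
          rw [C.bicollar_of_nonpos h] at hzw
          obtain ⟨hN, -⟩ := S.incl_eq_incl_succ hzw
          have h1 := C.down_boundary _ (S.N_subset _ hN)
          have h2 : -(z.2 : ℝ) ≤ 0 := by
            rw [← h1]; exact le_max_left _ _
          linarith
        refine ⟨(z.1, posIco z.2), ?_, ?_⟩
        · change (z.1, icoToIoo (posIco z.2)) ∈ O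
          rw [icoToIoo_posIco h0.ge]; exact hz
        · rw [C.bicollar_of_nonneg h0.ge] at hzw
          exact S.incl_injective _ hzw
    · rintro ⟨z, hz, rfl⟩
      exact ⟨_, hz, C.bicollar_icoToIoo _ _⟩
  have hdown : S.incl k ⁻¹' (C.bicollar '' O) =
      C.down '' {z | (z.1, icoToIooNeg z.2) ∈ O} := by
    ext w
    constructor
    · rintro ⟨z, hz, hzw⟩
      rcases le_total (z.2 : ℝ) 0 with h | h
      · refine ⟨(z.1, negIco z.2), ?_, ?_⟩
        · change (z.1, icoToIooNeg (negIco z.2)) ∈ O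
          rw [icoToIooNeg_negIco h]; exact hz
        · rw [C.bicollar_of_nonpos h] at hzw
          exact S.incl_injective _ hzw
      · have h0 : (z.2 : ℝ) = 0 := by
          rw [C.bicollar_of_nonneg h] at hzw
          obtain ⟨_, hM⟩ := S.incl_eq_incl_succ hzw.symm
          have h1 := C.up_boundary _ (S.M_subset _ (by rw [hM]; exact Subtype.coe_prop _))
          have h2 : (z.2 : ℝ) ≤ 0 := by
            rw [← h1]; exact le_max_left _ _
          linarith
        refine ⟨(z.1, negIco z.2), ?_, ?_⟩
        · change (z.1, icoToIooNeg (negIco z.2)) ∈ O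
          rw [icoToIooNeg_negIco h0.le]; exact hz
        · rw [C.bicollar_of_nonpos h0.le] at hzw
          exact S.incl_injective _ hzw
    · rintro ⟨z, hz, rfl⟩
      exact ⟨_, hz, C.bicollar_icoToIooNeg _ _⟩
  rw [S.isOpen_iff]
  intro j
  by_cases hj1 : j = k + 1
  · subst hj1
    rw [hup]
    exact C.up_open.isOpenMap _ (hO.preimage
      (continuous_fst.prodMk (continuous_icoToIoo.comp continuous_snd)))
  by_cases hj2 : j = k
  · subst hj2
    rw [hdown]
    exact C.down_open.isOpenMap _ (hO.preimage
      (continuous_fst.prodMk (continuous_icoToIooNeg.comp continuous_snd)))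
  convert isOpen_empty
  rw [eq_empty_iff_forall_notMem]
  rintro w ⟨z, -, hzw⟩
  rcases le_total 0 (z.2 : ℝ) with h | h
  · rw [C.bicollar_of_nonneg h] at hzw
    rcases lt_or_gt_of_ne hj1 with hlt | hlt
    · exact S.incl_ne_of_lt (by omega) _ _ hzw.symm
    · rcases Nat.lt_or_eq_of_le (Nat.succ_le_of_lt hlt) with h3 | h3
      · exact S.incl_ne_of_lt h3 _ _ hzw
      · obtain rfl : k + 1 + 1 = j := h3
        obtain ⟨hN, -⟩ := S.incl_eq_incl_succ hzw
        exact C.up_notMem_N _ hN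
  · rw [C.bicollar_of_nonpos h] at hzw
    rcases lt_or_gt_of_ne hj2 with hlt | hlt
    · rcases Nat.lt_or_eq_of_le (Nat.succ_le_of_lt hlt) with h3 | h3
      · exact S.incl_ne_of_lt h3 _ _ hzw.symm
      · obtain rfl : j + 1 = k := h3
        obtain ⟨_, hM⟩ := S.incl_eq_incl_succ hzw.symm
        exact C.down_notMem_M _ (by rw [hM]; exact Subtype.coe_prop _)
    · exact S.incl_ne_of_lt (by omega) _ _ hzw

theorem isOpenEmbedding_bicollar : IsOpenEmbedding C.bicollar :=
  IsOpenEmbedding.of_continuous_injective_isOpenMap C.continuous_bicollar C.injective_bicollar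
    C.isOpenMap_bicollar

end SeamCollar

end HCobordismStack

/-! ### Coordinates and charts on the adjunction space -/

namespace HCobordismStack

variable {n : ℕ} [NeZero n] (S : HCobordismStack.{u} n)

theorem eq_of_incl_mem_N {k i : ℕ} {y : S.W k} {x : S.W i} (hy : y ∈ S.N k)
    (h : S.incl i x = S.incl k y) :
    (∃ hik : k = i, hik ▸ y = x) ∨ ∃ hik : k + 1 = i, hik ▸ (S.h k ⟨y, hy⟩ : S.W (k + 1)) = x := by
  rcases lt_trichotomy i k with hlt | rfl | hlt
  · rcases Nat.lt_or_eq_of_le (Nat.succ_le_of_lt hlt) with h3 | h3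
    · exact absurd h (S.incl_ne_of_lt h3 _ _)
    · obtain rfl : i + 1 = k := h3
      obtain ⟨_, hM⟩ := S.incl_eq_incl_succ h
      exact absurd (by rw [hM]; exact Subtype.coe_prop _) (S.notMem_M_of_mem_N hy)
  · exact Or.inl ⟨rfl, (S.incl_injective i h).symm⟩
  · rcases Nat.lt_or_eq_of_le (Nat.succ_le_of_lt hlt) with h3 | h3
    · exact absurd h.symm (S.incl_ne_of_lt h3 _ _)
    · obtain rfl : k + 1 = i := h3
      obtain ⟨_, hM⟩ := S.incl_eq_incl_succ h.symm
      exact Or.inr ⟨rfl, hM.symm⟩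

/-- The points of a piece that do not lie on any seam. -/
def innerPart (i : ℕ) : Set (S.W i) := {x | x ∉ S.N i ∧ (i ≠ 0 → x ∉ S.M i)}

theorem isOpen_innerPart (i : ℕ) : IsOpen (S.innerPart i) := by
  have h : IsOpen {x : S.W i | i ≠ 0 → x ∉ S.M i} := by
    by_cases hi : i = 0
    · have : {x : S.W i | i ≠ 0 → x ∉ S.M i} = univ := by ext; simp [hi]
      rw [this]; exact isOpen_univ
    · have : {x : S.W i | i ≠ 0 → x ∉ S.M i} = (S.M i)ᶜ := by ext; simp [hi]
      rw [this]; exact (S.cobordism i).isClosed_left.isOpen_compl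
  exact (S.cobordism i).isClosed_right.isOpen_compl.inter h

theorem eq_of_incl_mem_innerPart {i j : ℕ} {x : S.W i} {y : S.W j} (hx : x ∈ S.innerPart i)
    (h : S.incl j y = S.incl i x) : ∃ hij : i = j, hij ▸ x = y := by
  rcases lt_trichotomy i j with hlt | rfl | hlt
  · rcases Nat.lt_or_eq_of_le (Nat.succ_le_of_lt hlt) with h3 | h3
    · exact absurd h.symm (S.incl_ne_of_lt h3 _ _)
    · obtain rfl : i + 1 = j := h3
      obtain ⟨hN, -⟩ := S.incl_eq_incl_succ h.symm
      exact absurd hN hx.1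
  · exact ⟨rfl, (S.incl_injective i h).symm⟩
  · rcases Nat.lt_or_eq_of_le (Nat.succ_le_of_lt hlt) with h3 | h3
    · exact absurd h (S.incl_ne_of_lt h3 _ _)
    · obtain rfl : j + 1 = i := h3
      obtain ⟨_, hM⟩ := S.incl_eq_incl_succ h
      exact absurd (by rw [hM]; exact Subtype.coe_prop _) (hx.2 (by omega))

theorem exists_seam_or_inner (p : S.Adjunction) :
    (∃ k, ∃ y : S.N k, S.incl k y = p) ∨ ∃ i, ∃ x ∈ S.innerPart i, S.incl i x = p := by
  obtain ⟨i, x, rfl⟩ := S.exists_incl_eq p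
  by_cases hN : x ∈ S.N i
  · exact Or.inl ⟨i, ⟨x, hN⟩, rfl⟩
  by_cases hM : i ≠ 0 ∧ x ∈ S.M i
  · obtain ⟨k, rfl⟩ : ∃ k, i = k + 1 := ⟨i - 1, by have := hM.1; omega⟩
    refine Or.inl ⟨k, (S.h k).symm ⟨x, hM.2⟩, ?_⟩
    rw [← S.incl_h]; simp
  · push Not at hM
    exact Or.inr ⟨i, x, ⟨hN, hM⟩, rfl⟩

theorem isOpen_image_innerPart {i : ℕ} {O : Set (S.W i)} (hO : IsOpen O)
    (hOi : O ⊆ S.innerPart i) : IsOpen (S.incl i '' O) := by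
  rw [S.isOpen_iff]
  intro j
  by_cases hj : j = i
  · subst hj
    rwa [preimage_image_eq _ (S.incl_injective j)]
  · convert isOpen_empty
    rw [eq_empty_iff_forall_notMem]
    rintro y ⟨x, hx, hxy⟩
    obtain ⟨h, -⟩ := S.eq_of_incl_mem_innerPart (hOi hx) hxy.symm
    exact hj h.symm

/-- The inner part of a piece as an open subset of the adjunction space. -/
theorem exists_inner_homeomorph {i : ℕ} {x : S.W i} :
    ∃ e : OpenPartialHomeomorph (S.W i) S.Adjunction, e.source = S.innerPart i ∧
      ∀ w, e w = S.incl i w := by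
  have : Nonempty (S.W i) := ⟨x⟩
  refine ⟨OpenPartialHomeomorph.ofContinuousOpenRestrict
    ((S.incl_injective i).injOn.toPartialEquiv (S.incl i) (S.innerPart i))
    (S.continuous_incl i).continuousOn ?_ (S.isOpen_innerPart i), rfl, fun w => rfl⟩
  intro O hO
  have h1 := S.isOpen_image_innerPart ((S.isOpen_innerPart i).isOpenMap_subtype_val O hO)
    (by rintro _ ⟨x, -, rfl⟩; exact x.2)
  have h2 := image_comp (S.incl i) (Subtype.val : S.innerPart i → S.W i) O
  exact (congrArg IsOpen h2).mpr h1

/-- Coordinates on the adjunction space adapted to the pieces and to the bicollars. -/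
theorem exists_coord (C : ∀ k, S.SeamCollar k) :
    ∃ c : S.Adjunction → S.Adjunction → EuclideanSpace ℝ (Fin n) × ℝ,
      (∀ k (y : S.N k), BiPL (𝓝 (y, (⟨0, by norm_num⟩ : Ioo (-1 : ℝ) 1)))
        (fun w : S.N k × Ioo (-1 : ℝ) 1 => (plCoord n y.val w.1.val, (w.2 : ℝ)))
        (fun w => c (S.incl k y) ((C k).bicollar w))) ∧
      ∀ i (x : S.W i), BiPL (𝓝 x) (plCoord n x) (fun w => c (S.incl i x) (S.incl i w)) := by
  -- Coordinates are chosen at each point separately; their agreement at nearby points comes from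
  -- the comparison with the pieces.
  suffices h : ∀ p : S.Adjunction, ∃ f : S.Adjunction → EuclideanSpace ℝ (Fin n) × ℝ,
      (∀ k (y : S.N k), S.incl k y = p → BiPL (𝓝 (y, (⟨0, by norm_num⟩ : Ioo (-1 : ℝ) 1)))
        (fun w : S.N k × Ioo (-1 : ℝ) 1 => (plCoord n y.val w.1.val, (w.2 : ℝ)))
        (fun w => f ((C k).bicollar w))) ∧
      ∀ i (x : S.W i), S.incl i x = p → BiPL (𝓝 x) (plCoord n x) (fun w => f (S.incl i w)) by
    choose c h1 h2 using h
    exact ⟨c, fun k y => h1 _ k y rfl, fun i x => h2 _ i x rfl⟩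
  intro p
  rcases S.exists_seam_or_inner p with ⟨k, y, rfl⟩ | ⟨i, x, hx, rfl⟩
  · set y₀ : S.N k × Ioo (-1 : ℝ) 1 := (y, ⟨0, by norm_num⟩) with hy₀
    have : Nonempty (S.N k × Ioo (-1 : ℝ) 1) := ⟨y₀⟩
    have hinv : ∀ z, Function.invFun (C k).bicollar ((C k).bicollar z) = z :=
      Function.leftInverse_invFun (C k).injective_bicollar
    refine ⟨fun q => (plCoord n y.val (Function.invFun (C k).bicollar q).1.val,
      ((Function.invFun (C k).bicollar q).2 : ℝ)), ?_, ?_⟩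
    · intro k' y' hy'
      rcases S.eq_of_incl_mem_N y.2 hy' with ⟨rfl, h⟩ | ⟨rfl, h⟩
      · have : y = y' := Subtype.ext h
        subst this
        simp only [hinv]
        exact BiPL.refl _ _
      · exact absurd (h ▸ Subtype.coe_prop _) (S.notMem_M_of_mem_N y'.2)
    · intro i x hx
      rcases S.eq_of_incl_mem_N y.2 hx with ⟨rfl, h⟩ | ⟨rfl, h⟩
      · have h : y.val = x := h
        have hd := (C k).down_zero y
        have hn : 𝓝 x = map (C k).down (𝓝 (y, ⟨0, by norm_num⟩)) := by
          rw [(C k).down_open.map_nhds_eq, hd, h]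
        rw [hn]
        refine BiPL.of_map ?_
        have h1 := isLocallyBiPL_iff.1 (C k).down_pl (y, ⟨0, by norm_num⟩)
        rw [hd, h] at h1
        refine h1.symm.trans ?_
        have h2 : ∀ w : S.N k × Ico (0 : ℝ) 1, S.incl k ((C k).down w) =
            (C k).bicollar (w.1, icoToIooNeg w.2) := fun w =>
          ((C k).bicollar_icoToIooNeg w.1 w.2).symm
        simp only [h2, hinv, ← h]
        -- The lower collar runs against the direction of the bicollar.
        exact BiPL.neg_right _ _ _
      · have h : (S.h k y : S.W (k + 1)) = x := h
        have hd := (C k).up_zero y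
        have hn : 𝓝 x = map (C k).up (𝓝 (y, ⟨0, by norm_num⟩)) := by
          rw [(C k).up_open.map_nhds_eq, hd, h]
        rw [hn]
        refine BiPL.of_map ?_
        have h1 := isLocallyBiPL_iff.1 (C k).up_pl (y, ⟨0, by norm_num⟩)
        rw [hd, h] at h1
        refine h1.symm.trans ?_
        have h2 : ∀ w : S.N k × Ico (0 : ℝ) 1, S.incl (k + 1) ((C k).up w) =
            (C k).bicollar (w.1, icoToIoo w.2) := fun w =>
          ((C k).bicollar_icoToIoo w.1 w.2).symm
        simp only [h2, hinv]
        exact BiPL.refl _ _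
  · have : Nonempty (S.W i) := ⟨x⟩
    -- The extra coordinate `0` only serves to give inner points and seam points the same coordinate
    -- space.
    refine ⟨fun q => (plCoord n x (Function.invFun (S.incl i) q), 0), ?_, ?_⟩
    · intro k y hy
      obtain ⟨rfl, rfl⟩ := S.eq_of_incl_mem_innerPart hx hy
      exact absurd y.2 hx.1
    · intro j y hy
      obtain ⟨rfl, rfl⟩ := S.eq_of_incl_mem_innerPart hx hy
      simp only [Function.leftInverse_invFun (S.incl_injective i) _]
      exact BiPL.prod_const _ _ _

/-- At nonzero height the bicollar is locally one of the two PL collars, and `h2` applies; at height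
0 the claim is `h1`. Thus the coordinates centred on the seam are compatible with those centred at
points beside it. -/
theorem SeamCollar.isLocallyBiPL_bicollar {k : ℕ} (C : S.SeamCollar k) {E : Type*}
    [AddCommGroup E] [Module ℝ E] {c : S.Adjunction → S.Adjunction → E}
    (h1 : ∀ y : S.N k, BiPL (𝓝 (y, (⟨0, by norm_num⟩ : Ioo (-1 : ℝ) 1)))
        (fun w : S.N k × Ioo (-1 : ℝ) 1 => (plCoord n y.val w.1.val, (w.2 : ℝ)))
        (fun w => c (S.incl k y) (C.bicollar w)))
    (h2 : ∀ i (x : S.W i), BiPL (𝓝 x) (plCoord n x) (fun w => c (S.incl i x) (S.incl i w))) :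
    IsLocallyBiPL (fun z w => (plCoord n z.1.val w.1.val, (w.2 : ℝ))) c C.bicollar := by
  rw [isLocallyBiPL_iff]
  intro z
  have hcont : Continuous fun w : S.N k × Ioo (-1 : ℝ) 1 => (w.2 : ℝ) := by fun_prop
  rcases lt_trichotomy (z.2 : ℝ) 0 with h | h | h
  · have hev : ∀ᶠ w in 𝓝 z, (w.2 : ℝ) < 0 := hcont.continuousAt.eventually (gt_mem_nhds h)
    have hg : Continuous fun w : S.N k × Ioo (-1 : ℝ) 1 => (w.1, negIco w.2) :=
      continuous_fst.prodMk (continuous_negIco.comp continuous_snd)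
    have e1 := (isLocallyBiPL_iff.1 C.down_pl (z.1, negIco z.2)).comp_tendsto hg.continuousAt
    have e2 := (h2 k (C.down (z.1, negIco z.2))).comp_tendsto
      (C.down_open.continuous.comp hg).continuousAt
    refine (BiPL.neg_right _ _ _).trans ((e1.trans e2).congr ?_ ?_)
    · filter_upwards [hev] with w hw
      exact Prod.ext rfl (max_eq_left (by linarith)).symm
    · filter_upwards [hev] with w hw
      rw [C.bicollar_of_nonpos h.le, C.bicollar_of_nonpos hw.le]
      rfl
  · have hz : z = (z.1, ⟨0, by norm_num⟩) := Prod.ext rfl (Subtype.ext h)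
    rw [hz, C.bicollar_zero]
    exact h1 z.1
  · have hev : ∀ᶠ w in 𝓝 z, 0 < (w.2 : ℝ) := hcont.continuousAt.eventually (lt_mem_nhds h)
    have hg : Continuous fun w : S.N k × Ioo (-1 : ℝ) 1 => (w.1, posIco w.2) :=
      continuous_fst.prodMk (continuous_posIco.comp continuous_snd)
    have e1 := (isLocallyBiPL_iff.1 C.up_pl (z.1, posIco z.2)).comp_tendsto hg.continuousAt
    have e2 := (h2 (k + 1) (C.up (z.1, posIco z.2))).comp_tendsto
      (C.up_open.continuous.comp hg).continuousAt
    refine (e1.trans e2).congr ?_ ?_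
    · filter_upwards [hev] with w hw
      exact Prod.ext rfl (max_eq_left (by linarith)).symm
    · filter_upwards [hev] with w hw
      rw [C.bicollar_of_nonneg h.le, C.bicollar_of_nonneg hw.le]
      rfl

theorem exists_plStructure (C : ∀ k, S.SeamCollar k) :
    ∃ _ : ChartedSpace (EuclideanHalfSpace n) S.Adjunction, IsPLManifold n S.Adjunction ∧
      (∀ i, IsPLEmbedding n (S.incl i)) ∧
      (𝓡∂ n).boundary S.Adjunction = S.incl 0 '' S.M 0 ∧
      ∀ k, IsLocallyBiPL (fun z w => (plCoord n z.1.val w.1.val, (w.2 : ℝ))) (plCoord n)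
        (C k).bicollar := by
  obtain ⟨c, hc1, hc2⟩ := S.exists_coord C
  have hb : ∀ k, IsLocallyBiPL (fun z w => (plCoord n z.1.val w.1.val, (w.2 : ℝ))) c
      (C k).bicollar := fun k => (C k).isLocallyBiPL_bicollar S (hc1 k) hc2
  have hcharts : ∀ p, ∃ φ : OpenPartialHomeomorph S.Adjunction (EuclideanHalfSpace n),
      p ∈ φ.source ∧ (∀ q ∈ φ.source, BiPL (𝓝 q) (c q) (fun z => (φ z).val)) ∧
      ((φ p).val 0 = 0 ↔ p ∈ S.incl 0 '' S.M 0) := by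
    intro p
    rcases S.exists_seam_or_inner p with ⟨k, y, rfl⟩ | ⟨i, x, hx, rfl⟩
    · obtain ⟨ψ, hy, hψ, hψ0⟩ := exists_flatChart (S.isPLManifold k)
        (fun x hx => S.eventually_mem_N_iff hx) (C k).isOpenEmbedding_bicollar (hb k) y
      rw [(C k).bicollar_zero] at hy
      have hpos : ∀ x ∈ ψ.source, 0 < ψ x 0 + 1 := fun x hx => by
        obtain ⟨z, -, hz⟩ := hψ0 x hx
        rw [hz]; linarith [z.2.2.1]
      have : Nonempty S.Adjunction := ⟨S.incl k y⟩
      obtain ⟨φ, hφs, -, hφ⟩ := (ψ.transHomeomorph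
        (Homeomorph.addRight (normalVec n))).exists_pullback
        (IsEmbedding.id (X := S.Adjunction)) (isEmbedding_val_halfSpace (n := n)) (fun q hq => by
          rw [range_val_halfSpace, range_id]
          refine iff_of_true trivial ?_
          have := hpos q hq
          simpa using this.le)
      have hφ' : ∀ q ∈ φ.source, (φ q).val = ψ q + normalVec n := hφ
      have hφs' : φ.source = ψ.source := hφs
      refine ⟨φ, by rwa [hφs'], fun q hq => ?_, ?_⟩
      · refine (hψ q (by rwa [← hφs'])).trans ?_
        refine (BiPL.affineEquiv (𝓝 q) ψ (AffineEquiv.constVAdd ℝ _ (normalVec n))).congr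
          (EventuallyEq.refl _ _) ?_
        filter_upwards [φ.open_source.mem_nhds hq] with q' hq'
        rw [hφ' q' hq', AffineEquiv.constVAdd_apply, vadd_eq_add, add_comm]
      · refine iff_of_false ?_ ?_
        · rw [hφ' _ (by rwa [hφs'])]
          have := hpos _ hy
          simpa using this.ne'
        · rintro ⟨x, hx, hxy⟩
          rcases S.eq_of_incl_mem_N y.2 hxy with ⟨rfl, h⟩ | ⟨h, -⟩
          · have h : y.val = x := h
            exact S.notMem_M_of_mem_N y.2 (h ▸ hx)
          · omega
    -- Off the seams a chart of the piece is used. Of all ends only `M 0` is not on a seam, so no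
    -- other boundary survives.
    · obtain ⟨e, hes, he⟩ := S.exists_inner_homeomorph (x := x)
      set χ := chartAt (EuclideanHalfSpace n) x with hχ
      have hxe : x ∈ e.source := by rwa [hes]
      have hsrc : ∀ q, q ∈ (e.symm ≫ₕ χ).source → ∃ w ∈ e.source, w ∈ χ.source ∧
          S.incl i w = q ∧ e.symm q = w := by
        intro q hq
        rw [OpenPartialHomeomorph.trans_source] at hq
        refine ⟨e.symm q, e.map_target hq.1, hq.2, ?_, rfl⟩
        rw [← he, e.right_inv hq.1]
      have hex : e.symm (S.incl i x) = x := by rw [← he, e.left_inv hxe]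
      refine ⟨e.symm ≫ₕ χ, ?_, ?_, ?_⟩
      · rw [OpenPartialHomeomorph.trans_source]
        refine ⟨?_, ?_⟩
        · rw [← he]; exact e.map_source hxe
        · rw [mem_preimage, hex]; exact mem_chart_source _ x
      · intro q hq
        have hqt : q ∈ e.target := by
          rw [OpenPartialHomeomorph.trans_source] at hq; exact hq.1
        obtain ⟨w, hw, hwχ, hwq, hqw⟩ := hsrc q hq
        have h1 := (hc2 i w).symm.trans ((S.isPLManifold i).biPL_plCoord (chart_mem_atlas _ x) hwχ)
        have ht : Tendsto e.symm (𝓝 q) (𝓝 w) := by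
          rw [← hqw]
          exact e.symm.continuousAt hqt
        refine (h1.comp_tendsto ht).congr ?_ (EventuallyEq.refl _ _)
        filter_upwards [e.open_target.mem_nhds hqt] with q' hq'
        rw [hwq, ← he, e.right_inv hq']
      · have h1 : (e.symm ≫ₕ χ) (S.incl i x) = χ x := by
          rw [OpenPartialHomeomorph.trans_apply, hex]
        rw [h1, ← (S.isPLManifold i).mem_boundary_iff (chart_mem_atlas _ x) (mem_chart_source _ x),
          S.boundary_eq]
        constructor
        · rintro (h | h)
          · by_cases hi : i = 0
            · subst hi; exact ⟨x, h, rfl⟩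
            · exact absurd h (hx.2 hi)
          · exact absurd h hx.1
        · rintro ⟨y, hy, hyx⟩
          obtain ⟨rfl, rfl⟩ := S.eq_of_incl_mem_innerPart hx hyx
          exact Or.inl hy
  obtain ⟨inst, hg, hpl⟩ := exists_chartedSpace_of_charts c
    (fun p => let ⟨φ, h1, h2, _⟩ := hcharts p; ⟨φ, h1, h2⟩)
  have hM : IsPLManifold n S.Adjunction := ⟨inferInstance, S.secondCountable, hg⟩
  refine ⟨inst, hM, fun i => ⟨(S.isClosedEmbedding_incl i).isEmbedding, fun x => ?_⟩, ?_, ?_⟩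
  · exact (hc2 i x).trans ((hpl (S.incl i x)).comp_tendsto (S.continuous_incl i).continuousAt)
  · ext p
    obtain ⟨φ, h1, h2, h3⟩ := hcharts p
    rw [mem_boundary_iff_of_biPL h1 ((hpl p).symm.trans (h2 p h1)), h3]
  · intro k z
    exact BiPL.trans (hb k z) ((hpl _).comp_tendsto (C k).continuous_bicollar.continuousAt)

end HCobordismStack

/-! ### The adjunction space is a pseudo-collar -/

theorem isSDR_of_flow {X : Type*} [TopologicalSpace X] {F : Set X} (Φ : unitInterval × X → X)
    (hΦ : Continuous Φ) (h0 : ∀ x, Φ (0, x) = x) (h1 : ∀ x, Φ (1, x) ∈ F)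
    (hfix : ∀ x ∈ F, ∀ t, Φ (t, x) = x) : IsSDR F :=
  ⟨⟨fun x => Φ (1, x), hΦ.comp (by fun_prop)⟩, h1,
    ⟨⟨⟨⟨Φ, hΦ⟩, h0, fun _ => rfl⟩, fun t x hx => hfix x hx t⟩⟩⟩

theorem notMem_interior_of_flatChart {n : ℕ} [NeZero n] {X : Type*} [TopologicalSpace X]
    {A : Set X} {x : X} {ψ : OpenPartialHomeomorph X (EuclideanSpace ℝ (Fin n))}
    (hx : x ∈ ψ.source) (h0 : ψ x 0 = 0) (hA : ∀ y ∈ ψ.source, y ∈ A ↔ 0 ≤ ψ y 0) :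
    x ∉ interior A := by
  intro hxA
  have hc : Tendsto (fun t : ℝ => ψ x - t • normalVec n) (𝓝[>] 0) (𝓝 (ψ x)) := by
    have : Continuous (fun t : ℝ => ψ x - t • normalVec n) := by fun_prop
    have h2 := this.tendsto 0
    simp only [zero_smul, sub_zero] at h2
    exact h2.mono_left nhdsWithin_le_nhds
  have hc' : Tendsto ψ.symm (𝓝 (ψ x)) (𝓝 x) := by
    have := ψ.symm.continuousAt (ψ.map_source hx)
    rwa [ContinuousAt, ψ.left_inv hx] at this
  obtain ⟨t, ⟨ht1, ht2⟩, ht⟩ := ((hc.eventually (ψ.open_target.mem_nhds (ψ.map_source hx))).and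
    ((hc'.comp hc).eventually (isOpen_interior.mem_nhds hxA))).and self_mem_nhdsWithin |>.exists
  have h3 := (hA _ (ψ.map_target ht1)).1 (interior_subset ht2)
  rw [ψ.right_inv ht1] at h3
  simp [h0] at h3
  exact absurd ht (not_lt.2 h3)

namespace HCobordismStack

variable {n : ℕ} [NeZero n] (S : HCobordismStack.{u} n)

theorem isSDR_M (i : ℕ) : IsSDR (S.M i) := by
  obtain ⟨κ, h1, h2, -, -⟩ := exists_collar_along (S.isPLManifold i)
    (S.isCompact_boundary i) (S.M_subset i) (fun x hx => S.eventually_mem_M_iff hx)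
    (h := Homeomorph.refl (S.M i)) (isLocallyBiPL_iff.2 fun z => BiPL.refl _ _)
  exact isSDR_of_collar (S.cobordism i).isClosed_left.isCompact h1 h2 (S.homotopyEquiv i)

/-- A strong deformation retraction of every piece to its initial end. -/
structure PieceFlow where
  D : ∀ i, ℝ × S.W i → S.W i
  continuous_D : ∀ i, Continuous (D i)
  D_of_nonpos : ∀ i t x, t ≤ 0 → D i (t, x) = x
  D_mem : ∀ i x, D i (1, x) ∈ S.M i
  D_fix : ∀ i x t, x ∈ S.M i → D i (t, x) = x

theorem nonempty_pieceFlow : Nonempty S.PieceFlow := by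
  choose r hr H using S.isSDR_M
  let H' := fun i => (H i).some
  refine ⟨⟨fun i p => H' i (projIcc 0 1 zero_le_one p.1, p.2), fun i => ?_, fun i t x ht => ?_,
    fun i x => ?_, fun i x t hx => ?_⟩⟩
  · exact (H' i).continuous.comp ((continuous_projIcc.comp continuous_fst).prodMk continuous_snd)
  · have h1 : projIcc (0 : ℝ) 1 zero_le_one t = 0 := projIcc_of_le_left _ ht
    simp only [h1, ContinuousMap.HomotopyWith.apply_zero, ContinuousMap.id_apply]
  · have h1 : projIcc (0 : ℝ) 1 zero_le_one 1 = 1 := projIcc_right _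
    simp only [h1, ContinuousMap.HomotopyWith.apply_one]
    exact hr i x
  · exact (H' i).eq_fst _ hx

/-! ### Concatenating the retractions of the pieces -/

variable {S} (P : S.PieceFlow)

namespace PieceFlow

/-- The time at which the `i`-th piece has been retracted. -/
noncomputable def time (i : ℕ) : ℝ := (1 / 2) ^ i

theorem time_pos (i : ℕ) : 0 < time i := by unfold time; positivity

theorem time_zero : time 0 = 1 := pow_zero _

theorem time_succ (i : ℕ) : time i = 2 * time (i + 1) := by unfold time; rw [pow_succ]; ring

theorem time_anti {i j : ℕ} (h : i ≤ j) : time j ≤ time i :=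
  pow_le_pow_of_le_one (by norm_num) (by norm_num) h

/-- The end point of the retraction of a piece, as a point of the previous piece. -/
noncomputable def back (i : ℕ) (x : S.W (i + 1)) : S.N i :=
  (S.h i).symm ⟨P.D (i + 1) (1, x), P.D_mem (i + 1) x⟩

theorem continuous_back (i : ℕ) : Continuous (P.back i) :=
  (S.h i).symm.continuous.comp (Continuous.subtype_mk ((P.continuous_D (i + 1)).comp
    (by fun_prop)) _)

theorem incl_back (i : ℕ) (x : S.W (i + 1)) :
    S.incl i (P.back i x) = S.incl (i + 1) (P.D (i + 1) (1, x)) := by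
  rw [← S.incl_h]; simp [back]

/-- The flow on the pieces: the `i`-th piece moves to its initial end during the time interval
`[2⁻⁽ⁱ⁺¹⁾, 2⁻ⁱ]`, then follows the flow of the previous pieces. -/
noncomputable def flow : ∀ i, S.W i × ℝ → S.Adjunction
  | 0, p => S.incl 0 (P.D 0 (2 * p.2 - 1, p.1))
  | i + 1, p => if p.2 ≤ time (i + 1) then
      S.incl (i + 1) (P.D (i + 1) (p.2 / time (i + 2) - 1, p.1))
    else flow i (P.back i p.1, p.2)

theorem flow_zero (x : S.W 0) (t : ℝ) : P.flow 0 (x, t) = S.incl 0 (P.D 0 (2 * t - 1, x)) := rfl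

theorem flow_succ_of_le {i : ℕ} (x : S.W (i + 1)) {t : ℝ} (h : t ≤ time (i + 1)) :
    P.flow (i + 1) (x, t) = S.incl (i + 1) (P.D (i + 1) (t / time (i + 2) - 1, x)) := if_pos h

theorem flow_of_le {i : ℕ} (x : S.W i) {t : ℝ} (h : t ≤ time (i + 1)) :
    P.flow i (x, t) = S.incl i x := by
  cases i with
  | zero =>
    have h1 := time_succ 0
    rw [time_zero] at h1
    rw [flow_zero, P.D_of_nonpos]
    linarith
  | succ i =>
    rw [flow_succ_of_le _ _ (h.trans (time_anti (Nat.le_succ _))), P.D_of_nonpos]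
    rw [sub_nonpos, div_le_one (time_pos _)]
    exact h

/-- At the common time `time (i + 1)` piece `i + 1` has just arrived at its initial end, and piece
`i` has not yet started to move. -/
theorem flow_succ_of_ge {i : ℕ} (x : S.W (i + 1)) {t : ℝ} (h : time (i + 1) ≤ t) :
    P.flow (i + 1) (x, t) = P.flow i (P.back i x, t) := by
  rcases h.lt_or_eq with h | rfl
  · exact if_neg (not_le.2 h)
  · rw [flow_succ_of_le _ _ le_rfl, flow_of_le _ _ le_rfl, incl_back]
    have : time (i + 1) / time (i + 2) - 1 = 1 := by
      rw [time_succ (i + 1), mul_div_assoc, div_self (time_pos _).ne']; norm_num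
    rw [this]

theorem continuous_flow (i : ℕ) : Continuous (P.flow i) := by
  induction i with
  | zero =>
    exact (S.continuous_incl 0).comp ((P.continuous_D 0).comp (by fun_prop))
  | succ i ih =>
    refine Continuous.if_le (f := fun p : S.W (i + 1) × ℝ => p.2) (g := fun _ => time (i + 1))
      ?_ ?_ continuous_snd continuous_const ?_
    · exact (S.continuous_incl _).comp ((P.continuous_D _).comp (by fun_prop))
    · exact ih.comp ((continuous_subtype_val.comp
        ((P.continuous_back i).comp continuous_fst)).prodMk continuous_snd)
    · rintro ⟨x, t⟩ ht
      change t = time (i + 1) at ht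
      change S.incl (i + 1) (P.D (i + 1) (t / time (i + 2) - 1, x)) = P.flow i (P.back i x, t)
      rw [← flow_succ_of_le P x ht.le, flow_succ_of_ge P x ht.ge]

/-- Compatibility with the gluing: `M (i + 1)` is fixed while its own piece retracts, and during
that time `N i` is still at rest. -/
theorem flow_h (i : ℕ) (y : S.N i) (t : ℝ) : P.flow (i + 1) (S.h i y, t) = P.flow i (y, t) := by
  have hb : P.back i (S.h i y) = y := by
    unfold back
    rw [Homeomorph.symm_apply_eq]
    exact Subtype.ext (P.D_fix _ _ _ (S.h i y).2)
  rcases le_total t (time (i + 1)) with h | h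
  · rw [flow_succ_of_le _ _ h, flow_of_le _ _ h, P.D_fix _ _ _ (S.h i y).2, S.incl_h]
  · rw [flow_succ_of_ge _ _ h, hb]

end PieceFlow

variable (S) in
/-- The union of all pieces from the `k`-th on. -/
def tail (k : ℕ) : Set S.Adjunction := ⋃ i ≥ k, range (S.incl i)

variable (S) in
/-- The initial end of the `k`-th piece in the adjunction space. -/
def seam (k : ℕ) : Set S.Adjunction := S.incl k '' S.M k

theorem incl_mem_tail {i k : ℕ} (h : k ≤ i) (x : S.W i) : S.incl i x ∈ S.tail k :=
  mem_biUnion (show i ≥ k from h) (mem_range_self x)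

theorem mem_tail {k : ℕ} {p : S.Adjunction} : p ∈ S.tail k ↔ ∃ i ≥ k, ∃ x, S.incl i x = p := by
  simp only [tail, mem_iUnion, exists_prop, mem_range]

theorem seam_subset_tail (k : ℕ) : S.seam k ⊆ S.tail k := by
  rintro _ ⟨x, -, rfl⟩
  exact incl_mem_tail le_rfl x

theorem seam_succ (k : ℕ) : S.seam (k + 1) = S.incl k '' S.N k := by
  ext p
  constructor
  · rintro ⟨x, hx, rfl⟩
    refine ⟨_, ((S.h k).symm ⟨x, hx⟩).2, ?_⟩
    rw [← S.incl_h]; simp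
  · rintro ⟨y, hy, rfl⟩
    exact ⟨_, (S.h k ⟨y, hy⟩).2, S.incl_h k ⟨y, hy⟩⟩

namespace PieceFlow

/-- Up to `time k` only the pieces from `k` on have moved, and each of them moves inside itself. -/
theorem flow_mem_tail {k i : ℕ} (hki : k ≤ i) (x : S.W i) {t : ℝ} (ht : t ≤ time k) :
    P.flow i (x, t) ∈ S.tail k := by
  induction i, hki using Nat.le_induction with
  | base =>
    cases k with
    | zero => exact incl_mem_tail le_rfl _
    | succ k => rw [flow_succ_of_le _ _ ht]; exact incl_mem_tail le_rfl _
  | succ i hi ih =>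
    rcases le_total t (time (i + 1)) with h | h
    · rw [flow_succ_of_le _ _ h]; exact incl_mem_tail (by omega) _
    · rw [flow_succ_of_ge _ _ h]; exact ih _

theorem flow_mem_seam {k i : ℕ} (hki : k ≤ i) (x : S.W i) :
    P.flow i (x, time k) ∈ S.seam k := by
  induction i, hki using Nat.le_induction with
  | base =>
    cases k with
    | zero =>
      rw [flow_zero, time_zero]
      norm_num
      exact ⟨_, P.D_mem 0 x, rfl⟩
    | succ k =>
      have : time (k + 1) / time (k + 2) - 1 = 1 := by
        rw [time_succ (k + 1), mul_div_assoc, div_self (time_pos _).ne']; norm_num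
      rw [flow_succ_of_le _ _ le_rfl, this]
      exact ⟨_, P.D_mem _ x, rfl⟩
  | succ i hi ih =>
    rw [flow_succ_of_ge _ _ (time_anti (by omega))]; exact ih _

theorem flow_fix {k : ℕ} {x : S.W k} (hx : x ∈ S.M k) {t : ℝ} (ht : t ≤ time k) :
    P.flow k (x, t) = S.incl k x := by
  cases k with
  | zero => rw [flow_zero, P.D_fix _ _ _ hx]
  | succ k => rw [flow_succ_of_le _ _ ht, P.D_fix _ _ _ hx]

/-- The flow is curried to a map into the space of paths, so that continuity passes to the quotient
without a quotient topology on a product. -/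
theorem exists_flow : ∃ Φ : unitInterval × S.Adjunction → S.Adjunction, Continuous Φ ∧
    ∀ i (x : S.W i) t, Φ (t, S.incl i x) = P.flow i (x, t) := by
  let G : (Σ i, S.W i) → C(unitInterval, S.Adjunction) := fun q =>
    ⟨fun t => P.flow q.1 (q.2, t), (P.continuous_flow q.1).comp (by fun_prop)⟩
  have hG : Continuous G := by
    refine continuous_sigma fun i => ?_
    let g : C(S.W i × unitInterval, S.Adjunction) :=
      ⟨fun p => P.flow i (p.1, p.2), (P.continuous_flow i).comp (by fun_prop)⟩
    exact g.curry.continuous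
  have hresp : ∀ p q, S.Glue p q → G p = G q := by
    rintro _ _ ⟨i, y⟩
    ext t
    exact (P.flow_h i y t).symm
  let L : S.Adjunction → C(unitInterval, S.Adjunction) := Quot.lift G hresp
  have hL : Continuous L := continuous_quot_lift hresp hG
  refine ⟨fun p => L p.2 p.1, ?_, fun i x t => rfl⟩
  exact (ContinuousEval.continuous_eval).comp ((hL.comp continuous_snd).prodMk continuous_fst)

end PieceFlow

end HCobordismStack

/-! ### Tails of the adjunction space as homotopy collars -/

namespace HCobordismStack

variable {n : ℕ} [NeZero n] {S : HCobordismStack.{u} n}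

open PieceFlow

/-- The flow restricted to `[0, time k]` and rescaled to the unit interval. -/
theorem isSDR_seam (k : ℕ) : IsSDR (Subtype.val ⁻¹' S.seam k : Set (S.tail k)) := by
  obtain ⟨P⟩ := S.nonempty_pieceFlow
  obtain ⟨Φ, hΦ, hΦP⟩ := P.exists_flow
  let τ : unitInterval → unitInterval := fun t =>
    ⟨t * time k, mul_nonneg t.2.1 (time_pos k).le,
      mul_le_one₀ t.2.2 (time_pos k).le (by
        have := time_anti (Nat.zero_le k); rwa [time_zero] at this)⟩
  have hτ : Continuous τ := Continuous.subtype_mk (by fun_prop) _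
  have hτle : ∀ t, (τ t : ℝ) ≤ time k := fun t =>
    mul_le_of_le_one_left (time_pos k).le t.2.2
  have hmem : ∀ t, ∀ p ∈ S.tail k, Φ (τ t, p) ∈ S.tail k := by
    intro t p hp
    obtain ⟨i, hi, x, rfl⟩ := mem_tail.1 hp
    rw [hΦP]
    exact P.flow_mem_tail hi x (hτle t)
  refine isSDR_of_flow (fun p => ⟨Φ (τ p.1, p.2.1), hmem _ _ p.2.2⟩)
    (Continuous.subtype_mk (hΦ.comp ((hτ.comp continuous_fst).prodMk
      (continuous_subtype_val.comp continuous_snd))) _) ?_ ?_ ?_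
  · rintro ⟨p, hp⟩
    obtain ⟨i, hi, x, rfl⟩ := mem_tail.1 hp
    refine Subtype.ext ?_
    change Φ (τ 0, S.incl i x) = S.incl i x
    rw [hΦP, P.flow_of_le]
    simp [τ, (time_pos _).le]
  · rintro ⟨p, hp⟩
    obtain ⟨i, hi, x, rfl⟩ := mem_tail.1 hp
    change Φ (τ 1, S.incl i x) ∈ S.seam k
    rw [hΦP]
    have : ((τ 1 : unitInterval) : ℝ) = time k := by simp [τ]
    rw [this]
    exact P.flow_mem_seam hi x
  · rintro ⟨p, hp⟩ ⟨x, hx, rfl⟩ t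
    refine Subtype.ext ?_
    change Φ (τ t, S.incl k x) = S.incl k x
    rw [hΦP, P.flow_fix hx (hτle t)]

theorem tail_zero : S.tail 0 = univ := by
  refine eq_univ_of_forall fun p => ?_
  obtain ⟨i, x, rfl⟩ := S.exists_incl_eq p
  exact incl_mem_tail (Nat.zero_le i) x

theorem inclIsHomotopyEquiv_seam_zero : InclIsHomotopyEquiv (S.seam 0) := by
  have h1 := (isSDR_seam (S := S) 0).inclIsHomotopyEquiv
  have h0 := S.tail_zero
  let e : S.tail 0 ≃ₜ S.Adjunction := (Homeomorph.setCongr h0).trans (Homeomorph.Set.univ _)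
  let f : S.seam 0 ≃ₜ (Subtype.val ⁻¹' S.seam 0 : Set (S.tail 0)) :=
    { toFun := fun x => ⟨⟨x.1, h0 ▸ mem_univ _⟩, x.2⟩
      invFun := fun x => ⟨x.1.1, x.2⟩
      left_inv := fun _ => rfl
      right_inv := fun _ => rfl
      continuous_toFun := by fun_prop
      continuous_invFun := by fun_prop }
  exact (isHE_homeomorph e).comp ((inclIsHomotopyEquiv_iff.1 h1).comp (isHE_homeomorph f))

theorem isClosed_tail (k : ℕ) : IsClosed (S.tail k) := by
  refine S.isClosed_iUnion (A := fun i => ⋃ _ : i ≥ k, range (S.incl i)) (fun i => ?_) fun i => ?_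
  · by_cases h : i ≥ k
    · simp only [h, iUnion_true]; exact (S.isClosedEmbedding_incl i).isClosed_range
    · simp only [h, iUnion_false]; exact isClosed_empty
  · exact iUnion_subset fun _ => subset_rfl

theorem tail_anti {i j : ℕ} (h : i ≤ j) : S.tail j ⊆ S.tail i := by
  intro p hp
  obtain ⟨l, hl, x, rfl⟩ := mem_tail.1 hp
  exact incl_mem_tail (h.trans hl) x

theorem compl_tail_subset (k : ℕ) : (S.tail k)ᶜ ⊆ ⋃ j ∈ Iio k, range (S.incl j) := by
  intro p hp
  obtain ⟨i, x, rfl⟩ := S.exists_incl_eq p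
  refine mem_biUnion (x := i) ?_ (mem_range_self x)
  by_contra h
  exact hp (incl_mem_tail (not_lt.1 h) x)

theorem isNhdOfInfinity_tail (k : ℕ) : IsNhdOfInfinity (S.tail k) := by
  have h1 : IsCompact (⋃ j ∈ Iio k, range (S.incl j)) :=
    (finite_Iio k).isCompact_biUnion fun j _ => isCompact_range (S.continuous_incl j)
  exact h1.of_isClosed_subset isClosed_closure (h1.isClosed.closure_subset_iff.2
    (compl_tail_subset k))

theorem incl_mem_tail_succ {k : ℕ} {x : S.W k} (h : S.incl k x ∈ S.tail (k + 1)) : x ∈ S.N k := by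
  obtain ⟨j, hj, y, hy⟩ := mem_tail.1 h
  rcases Nat.lt_or_eq_of_le hj with h3 | rfl
  · exact absurd hy.symm (S.incl_ne_of_lt h3 _ _)
  · exact (S.incl_eq_incl_succ hy.symm).1

theorem incl_notMem_tail {i k : ℕ} (h : i + 1 < k) (x : S.W i) : S.incl i x ∉ S.tail k := by
  intro hx
  obtain ⟨j, hj, y, hy⟩ := mem_tail.1 hx
  exact S.incl_ne_of_lt (h.trans_le hj) x y hy.symm

/-- The complements of the tails are an increasing open cover, so one of them contains the compact
closure of `Qᶜ`. The index `k + 1` provides a seam between pieces `k` and `k + 1`, where a bicollar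
exists, and keeps the tail away from the boundary. -/
theorem exists_tail_subset {Q : Set S.Adjunction} (hQ : IsNhdOfInfinity Q) :
    ∃ k, S.tail (k + 1) ⊆ Q := by
  obtain ⟨k, hk⟩ := IsCompact.elim_directed_cover hQ (fun k => (S.tail k)ᶜ)
    (fun k => (isClosed_tail k).isOpen_compl) (by
      intro p _
      obtain ⟨i, x, rfl⟩ := S.exists_incl_eq p
      exact mem_iUnion.2 ⟨i + 2, incl_notMem_tail (by omega) x⟩)
    (Monotone.directed_le fun i j h => compl_subset_compl.2 (tail_anti h))
  refine ⟨k, fun p hp => ?_⟩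
  by_contra h
  exact hk (subset_closure h) (tail_anti (Nat.le_succ k) hp)

/-- The pieces before `k` form a closed set that meets the tail only in the seam. -/
theorem tail_mem_nhds {k : ℕ} {p : S.Adjunction} (hp : p ∈ S.tail k) (hps : p ∉ S.seam k) :
    S.tail k ∈ 𝓝 p := by
  have h1 : IsClosed (⋃ j ∈ Iio k, range (S.incl j)) :=
    (finite_Iio k).isClosed_biUnion fun j _ => (S.isClosedEmbedding_incl j).isClosed_range
  refine mem_of_superset (h1.isOpen_compl.mem_nhds ?_) (compl_subset_comm.1 (compl_tail_subset k))
  intro h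
  obtain ⟨j, hj, x, rfl⟩ := mem_iUnion₂.1 h
  rcases Nat.lt_or_eq_of_le (Nat.succ_le_of_lt hj) with h3 | rfl
  · exact incl_notMem_tail h3 x hp
  · exact hps (by rw [seam_succ]; exact ⟨x, incl_mem_tail_succ hp, rfl⟩)

theorem SeamCollar.bicollar_mem_tail {k : ℕ} (C : S.SeamCollar k) (z) :
    C.bicollar z ∈ S.tail (k + 1) ↔ 0 ≤ (z.2 : ℝ) := by
  constructor
  · intro h
    by_contra hneg
    rw [not_le] at hneg
    rw [C.bicollar_of_nonpos hneg.le] at h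
    have h1 := C.down_boundary _ (S.N_subset _ (incl_mem_tail_succ h))
    have h2 : -(z.2 : ℝ) ≤ 0 := by rw [← h1]; exact le_max_left _ _
    linarith
  · intro h
    rw [C.bicollar_of_nonneg h]
    exact incl_mem_tail le_rfl _

theorem seam_zero_disjoint_tail {k : ℕ} {p : S.Adjunction} (hp : p ∈ S.seam 0) :
    p ∉ S.tail (k + 1) := by
  obtain ⟨x, hx, rfl⟩ := hp
  intro h
  exact S.notMem_M_of_mem_N (incl_mem_tail_succ (tail_anti (by omega : 1 ≤ k + 1) h)) hx

theorem isPseudoCollar_adjunction [ChartedSpace (EuclideanHalfSpace n) S.Adjunction]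
    (hU : IsPLManifold n S.Adjunction) (C : ∀ k, S.SeamCollar k)
    (hincl : ∀ i, IsPLEmbedding n (S.incl i))
    (hbd : (𝓡∂ n).boundary S.Adjunction = S.seam 0)
    (hb : ∀ k, IsLocallyBiPL (fun z w => (plCoord n z.1.val w.1.val, (w.2 : ℝ))) (plCoord n)
      (C k).bicollar) : IsPseudoCollar n S.Adjunction := by
  have hseam : ∀ k, IsCompact (S.seam k) := fun k =>
    ((S.cobordism k).isClosed_left.isCompact).image (S.continuous_incl k)
  refine ⟨⟨hU, by rw [hbd]; exact hseam 0, by rw [hbd]; exact inclIsHomotopyEquiv_seam_zero⟩, ?_⟩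
  intro Q hQ
  obtain ⟨k, hk⟩ := exists_tail_subset hQ
  refine ⟨S.tail (k + 1), hk, isNhdOfInfinity_tail _, ?_⟩
  have hflat : ∀ p ∈ S.seam (k + 1),
      ∃ ψ : OpenPartialHomeomorph S.Adjunction (EuclideanSpace ℝ (Fin n)), p ∈ ψ.source ∧
      ψ p 0 = 0 ∧ (∀ y ∈ ψ.source, BiPL (𝓝 y) (plCoord n y) ψ) ∧
      ∀ y ∈ ψ.source, y ∈ S.tail (k + 1) ↔ 0 ≤ ψ y 0 := by
    intro p hp
    rw [seam_succ] at hp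
    obtain ⟨y, hy, rfl⟩ := hp
    obtain ⟨ψ, hyψ, hψ, hψ0⟩ := exists_flatChart (S.isPLManifold k)
      (fun x hx => S.eventually_mem_N_iff hx) (C k).isOpenEmbedding_bicollar (hb k) ⟨y, hy⟩
    rw [(C k).bicollar_zero] at hyψ
    refine ⟨ψ, hyψ, ?_, hψ, fun q hq => ?_⟩
    · obtain ⟨z, hz, hz0⟩ := hψ0 _ hyψ
      rw [← (C k).bicollar_zero] at hz
      rw [hz0, (C k).injective_bicollar hz]
    · obtain ⟨z, rfl, hz0⟩ := hψ0 _ hq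
      rw [(C k).bicollar_mem_tail, hz0]
  obtain ⟨inst, hV, hemb, hbV⟩ := exists_submanifold hU (A := S.tail (k + 1))
    (F := S.seam (k + 1)) (fun x hx hxs => tail_mem_nhds hx hxs) hflat
  have hbV' : (𝓡∂ n).boundary (S.tail (k + 1)) = Subtype.val ⁻¹' S.seam (k + 1) := by
    rw [hbV]
    ext x
    refine ⟨fun h => h.resolve_right fun h' => ?_, Or.inl⟩
    rw [hbd] at h'
    exact seam_zero_disjoint_tail h' x.2
  refine ⟨inst, ⟨hV, isClosed_tail _, hemb, ?_, ?_⟩, ⟨hV, ?_, ?_⟩⟩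
  · rw [(isClosed_tail _).frontier_eq, hbV', Subtype.image_preimage_coe]
    ext p
    constructor
    · rintro ⟨h1, h2⟩
      refine ⟨h1, ?_⟩
      by_contra h
      exact h2 (mem_interior_iff_mem_nhds.2 (tail_mem_nhds h1 h))
    · rintro ⟨h1, h2⟩
      obtain ⟨ψ, hp, h0, -, hA⟩ := hflat p h2
      exact ⟨h1, notMem_interior_of_flatChart hp h0 hA⟩
  · have hmem : ∀ y : S.N k, S.incl k y ∈ S.seam (k + 1) := fun y => by
      rw [seam_succ]; exact mem_image_of_mem _ y.2
    let f : S.N k → (𝓡∂ n).boundary (S.tail (k + 1)) := fun y =>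
      ⟨⟨S.incl k y, seam_subset_tail _ (hmem y)⟩, by rw [hbV']; exact hmem y⟩
    have hf : IsEmbedding f := by
      have h1 : IsEmbedding fun y : S.N k => S.incl k y :=
        (hincl k).1.comp IsEmbedding.subtypeVal
      exact IsEmbedding.of_comp (f := f)
        (g := fun x : (𝓡∂ n).boundary (S.tail (k + 1)) => x.1.1)
        (Continuous.subtype_mk (Continuous.subtype_mk h1.continuous _) _) (by fun_prop) h1
    have hfs : Function.Surjective f := by
      rintro ⟨⟨p, hp⟩, hpb⟩
      have hpb' := hpb
      rw [hbV', mem_preimage, seam_succ] at hpb'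
      obtain ⟨y, hy, hyp⟩ := hpb'
      exact ⟨⟨y, hy⟩, Subtype.ext (Subtype.ext hyp)⟩
    let θ := hf.toHomeomorphOfSurjective hfs
    have hθ : ∀ x, S.incl k (θ.symm x) = x.1.1 := fun x => by
      have : f (θ.symm x) = x := θ.apply_symm_apply x
      exact congrArg (fun x => x.1.1) this
    -- The bicollar is parametrized by `N k`, whereas the submanifold needs one over the boundary of
    -- the tail in its own charts. Both structures are PL embedded in the adjunction space and are
    -- compared through it.
    have hθpl : ∀ x, BiPL (𝓝 x)
        (fun x' : (𝓡∂ n).boundary (S.tail (k + 1)) => plCoord n x.1 x'.1)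
        (fun x' => plCoord n (θ.symm x).1 (θ.symm x').1) := by
      intro x
      have h1 : BiPL (𝓝 x.1) (plCoord n x.1) (fun x' : S.tail (k + 1) => plCoord n x.1.1 x'.1) :=
        hemb.2 x.1
      have h2 : BiPL (𝓝 (θ.symm x).1) (plCoord n (θ.symm x).1)
        (fun w => plCoord n (S.incl k (θ.symm x)) (S.incl k w)) := (hincl k).2 (θ.symm x).1
      have h3 := h1.comp_tendsto (f := fun x' : (𝓡∂ n).boundary (S.tail (k + 1)) => x'.1)
        continuous_subtype_val.continuousAt
      have h4 := h2.comp_tendsto (f := fun x' => (θ.symm x').1)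
        (continuous_subtype_val.comp θ.symm.continuous).continuousAt
      simp only [hθ] at h4
      exact h3.trans h4.symm
    refine ⟨(C k).bicollar ∘ Prod.map θ.symm id, (C k).isOpenEmbedding_bicollar.comp
      (θ.symm.isOpenEmbedding.prodMap IsOpenEmbedding.id), fun y => ?_, fun z =>
      (C k).bicollar_mem_tail _, ?_⟩
    · exact ((C k).bicollar_zero _).trans (hθ y)
    · refine (hb k).comp (isLocallyBiPL_iff.2 fun z => ?_)
        (θ.symm.continuous.prodMap continuous_id)
      exact ((hθpl z.1).comp_tendsto continuous_fst.continuousAt).prodMk (BiPL.refl _ _)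
  · rw [hbV']
    exact (isClosed_tail (k + 1)).isClosedEmbedding_subtypeVal.isCompact_preimage (hseam (k + 1))
  · rw [hbV']
    exact (isSDR_seam (k + 1)).inclIsHomotopyEquiv

theorem exists_isPseudoCollar (S : HCobordismStack.{u} n) :
    ∃ _ : ChartedSpace (EuclideanHalfSpace n) S.Adjunction,
      (∀ i, IsPLEmbedding n (S.incl i)) ∧ IsPseudoCollar n S.Adjunction ∧
        (𝓡∂ n).boundary S.Adjunction = S.incl 0 '' S.M 0 := by
  have C := fun k => (S.nonempty_seamCollar k).some
  obtain ⟨inst, hU, hincl, hbd, hb⟩ := S.exists_plStructure C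
  exact ⟨inst, hincl, isPseudoCollar_adjunction hU C hincl hbd hb, hbd⟩

end HCobordismStack

/-! ### Decomposition of a pseudo-collar -/

section Decomposition

variable {n : ℕ} [NeZero n] {U : Type u} [TopologicalSpace U]
  [ChartedSpace (EuclideanHalfSpace n) U]

theorem isSDR_boundary {X : Type*} [TopologicalSpace X] [ChartedSpace (EuclideanHalfSpace n) X]
    (hX : IsHomotopyCollar n X) : IsSDR ((𝓡∂ n).boundary X) := by
  have := hX.isPLManifold.t2
  obtain ⟨κ, h1, h2, -, -⟩ := exists_collar_along hX.isPLManifold hX.isCompact_boundary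
    Subset.rfl (fun x _ => Eventually.of_forall fun _ => Iff.rfl)
    (h := Homeomorph.refl ((𝓡∂ n).boundary X)) (isLocallyBiPL_iff.2 fun z => BiPL.refl _ _)
  exact isSDR_of_collar hX.isCompact_boundary h1 h2 hX.homotopyEquiv

/-- The set `V` is flat at `x`: some piecewise linear chart takes it to a half-space. -/
def IsFlatAt (n : ℕ) [NeZero n] {U : Type*} [TopologicalSpace U]
    [ChartedSpace (EuclideanHalfSpace n) U] (V : Set U) (x : U) : Prop :=
  ∃ ψ : OpenPartialHomeomorph U (EuclideanSpace ℝ (Fin n)), x ∈ ψ.source ∧ ψ x 0 = 0 ∧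
    (∀ y ∈ ψ.source, BiPL (𝓝 y) (plCoord n y) ψ) ∧ ∀ y ∈ ψ.source, y ∈ V ↔ 0 ≤ ψ y 0

theorem IsFlatAt.congr {V V' : Set U} {x : U} (h : IsFlatAt n V x)
    (hV : V =ᶠ[𝓝 x] V') : IsFlatAt n V' x := by
  obtain ⟨ψ, hx, h0, hpl, hψ⟩ := h
  obtain ⟨O, hO, hOo, hxO⟩ := eventually_nhds_iff.1 hV
  refine ⟨ψ.restrOpen O hOo, ⟨hx, hxO⟩, h0, fun y hy => hpl y hy.1, fun y hy => ?_⟩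
  exact Iff.trans (hO y hy.2).to_iff.symm (hψ y hy.1)

/-- Reflection in the hyperplane exchanges the two sides, and the interior of `V` corresponds to
positive first coordinate. -/
theorem IsFlatAt.compl_interior {V : Set U} {x : U} (h : IsFlatAt n V x) :
    IsFlatAt n (interior V)ᶜ x := by
  obtain ⟨ψ, hx, h0, hpl, hψ⟩ := h
  refine ⟨ψ.transHomeomorph (Homeomorph.neg _), hx, by simp [h0], fun y hy => ?_, fun y hy => ?_⟩
  · refine (hpl y hy).trans ?_
    exact BiPL.affineEquiv (𝓝 y) ψ (LinearEquiv.neg ℝ).toAffineEquiv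
  · have key : y ∈ interior V ↔ 0 < ψ y 0 := by
      constructor
      · intro hyV
        refine lt_of_le_of_ne ((hψ y hy).1 (interior_subset hyV)) fun h => ?_
        exact notMem_interior_of_flatChart (ψ := ψ) hy h.symm hψ hyV
      · intro hpos
        rw [mem_interior_iff_mem_nhds]
        have hc : ContinuousAt (fun z => ψ z 0) y :=
          (show Continuous fun v : EuclideanSpace ℝ (Fin n) => v 0 by fun_prop).continuousAt.comp
            (ψ.continuousAt hy)
        filter_upwards [hc.eventually (lt_mem_nhds hpos), ψ.open_source.mem_nhds hy] with z hz hzs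
        exact (hψ z hzs).2 hz.le
    rw [mem_compl_iff, key]
    simp

/-- A closed neighborhood of infinity with flat frontier that is a homotopy collar. -/
structure IsCollarEnd (n : ℕ) [NeZero n] {U : Type*} [TopologicalSpace U]
    [ChartedSpace (EuclideanHalfSpace n) U] (V : Set U) : Prop where
  isClosed : IsClosed V
  isNhdOfInfinity : IsNhdOfInfinity V
  isFlatAt : ∀ x ∈ frontier V, IsFlatAt n V x
  homotopyEquiv : InclIsHomotopyEquiv {x : V | x.val ∈ frontier V ∨ x.val ∈ (𝓡∂ n).boundary U}

theorem inclIsHomotopyEquiv_of_homeomorph {X Y : Type*} [TopologicalSpace X] [TopologicalSpace Y]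
    (e : X ≃ₜ Y) {A : Set Y} (h : InclIsHomotopyEquiv (e ⁻¹' A)) : InclIsHomotopyEquiv A := by
  let f : A ≃ₜ (e ⁻¹' A : Set X) := (e.sets (s := e ⁻¹' A) (t := A) rfl).symm
  have := (isHE_homeomorph e).comp ((inclIsHomotopyEquiv_iff.1 h).comp (isHE_homeomorph f))
  refine inclIsHomotopyEquiv_iff.2 ?_
  convert this using 1
  ext a
  exact (congrArg Subtype.val (f.symm_apply_apply a)).symm

/-- The whole space has empty frontier; the clause about `∂U` in `IsCollarEnd` is there to allow it
as first member of the sequence. -/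
theorem isCollarEnd_univ (hU : IsHomotopyCollar n U) : IsCollarEnd n (univ : Set U) where
  isClosed := isClosed_univ
  isNhdOfInfinity := by simp [IsNhdOfInfinity]
  isFlatAt := by simp
  homotopyEquiv := by
    refine inclIsHomotopyEquiv_of_homeomorph (Homeomorph.Set.univ U).symm ?_
    convert hU.homotopyEquiv using 1
    ext x
    simp [Homeomorph.Set.univ]

/-- Replaces the PL structure on `V` by what is visible in `U`: flat charts, obtained from the
bicollar, and the homotopy data. As `Q` avoids `∂U`, the boundary of `V` is just its frontier. -/
theorem exists_isCollarEnd (hU : IsPseudoCollar n U) {Q : Set U} (hQ : IsNhdOfInfinity Q)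
    (hQb : Disjoint Q ((𝓡∂ n).boundary U)) :
    ∃ V ⊆ Q, IsCollarEnd n V ∧ IsSDR {x : V | x.val ∈ frontier V} := by
  obtain ⟨V, hVQ, hV, inst, hclean, hcol⟩ := hU.2 Q hQ
  have hfr : (𝓡∂ n).boundary V = {x : V | x.val ∈ frontier V} := by
    rw [hclean.frontier_eq]
    exact (preimage_image_eq _ Subtype.val_injective).symm
  refine ⟨V, hVQ, ⟨hclean.isClosed, hV, fun x hx => ?_, ?_⟩, ?_⟩
  · rw [hclean.frontier_eq] at hx
    obtain ⟨y, hy, rfl⟩ := hx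
    obtain ⟨b, hb, hb0, hbV, hbpl⟩ := hclean.bicollar
    obtain ⟨ψ, hyψ, hψ, hψ0⟩ := exists_flatChart hclean.isPLManifold
      (fun x _ => Eventually.of_forall fun _ => Iff.rfl) hb hbpl ⟨y, hy⟩
    have h0 := hb0 ⟨y, hy⟩
    refine ⟨ψ, h0 ▸ hyψ, ?_, hψ, fun q hq => ?_⟩
    · obtain ⟨z, hz, hz0⟩ := hψ0 _ hyψ
      rw [← h0, hz0, hb.injective hz]
    · obtain ⟨z, rfl, hz0⟩ := hψ0 _ hq
      rw [hbV, hz0]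
  · have h : {x : V | x.val ∈ frontier V ∨ x.val ∈ (𝓡∂ n).boundary U} = (𝓡∂ n).boundary V := by
      rw [hfr]
      ext x
      exact ⟨fun h => h.resolve_right fun h' => hQb.le_bot ⟨hVQ x.2, h'⟩, Or.inl⟩
    rw [h]
    exact hcol.homotopyEquiv
  · rw [← hfr]
    exact isSDR_boundary hcol

/-- The deformation of `V'` fixes the frontier, hence can be continued by the identity on the rest
of `V`. -/
theorem isSDR_diff_interior {V V' : Set U} (hV' : IsClosed V') (hVV' : V' ⊆ V)
    (h : IsSDR {x : V' | x.val ∈ frontier V'}) : IsSDR {x : V | x.val ∉ interior V'} := by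
  classical
  obtain ⟨r, hr, ⟨H⟩⟩ := h
  let Φ : unitInterval × V → V := fun p =>
    if h : p.2.val ∈ V' then ⟨H (p.1, ⟨p.2, h⟩), hVV' (Subtype.coe_prop _)⟩ else p.2
  have h1 : ∀ t (x : V) (h : x.val ∈ V'),
      Φ (t, x) = ⟨H (t, ⟨x, h⟩), hVV' (Subtype.coe_prop _)⟩ := fun t x h => dif_pos h
  have h2 : ∀ t (x : V), x.val ∉ interior V' → Φ (t, x) = x := by
    intro t x hx
    by_cases h : x.val ∈ V'
    · rw [h1 t x h]
      have hfix := H.eq_fst t (x := ⟨x.val, h⟩) (hV'.frontier_eq ▸ ⟨h, hx⟩)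
      exact Subtype.ext (congrArg (fun y : V' => y.val) hfix)
    · exact dif_neg h
  refine isSDR_of_flow Φ ?_ (fun x => ?_) (fun x => ?_) fun x hx t => h2 t x hx
  · refine continuous_of_isClosed_cover (C := {p | p.2.val ∈ V'})
      (D := {p | p.2.val ∉ interior V'}) (hV'.preimage (by fun_prop))
      (isOpen_interior.isClosed_compl.preimage (by fun_prop))
      (fun p => (em (p.2.val ∈ V')).imp_right fun h h' => h (interior_subset h')) ?_ ?_
    · have : Continuous fun p : {p : unitInterval × V | p.2.val ∈ V'} =>
          (⟨H (p.1.1, ⟨p.1.2, p.2⟩), hVV' (Subtype.coe_prop _)⟩ : V) := by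
        refine Continuous.subtype_mk (continuous_subtype_val.comp (H.continuous.comp ?_)) _
        exact (continuous_fst.comp continuous_subtype_val).prodMk
          (Continuous.subtype_mk (by fun_prop) _)
      exact this.congr fun p => (h1 p.1.1 p.1.2 p.2).symm
    · have : Continuous fun p : {p : unitInterval × V | p.2.val ∉ interior V'} => p.1.2 := by
        fun_prop
      exact this.congr fun p => (h2 p.1.1 p.1.2 p.2).symm
  · by_cases h : x.val ∈ V'
    · rw [h1 0 x h]
      have hid := H.apply_zero ⟨x.val, h⟩
      exact Subtype.ext (congrArg (fun y : V' => y.val) hid)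
    · exact h2 0 x fun h' => h (interior_subset h')
  · by_cases h : x.val ∈ V'
    · rw [h1 1 x h, H.apply_one]
      have := hr ⟨x.val, h⟩
      rw [mem_ofPred_eq, hV'.frontier_eq] at this
      exact this.2
    · rw [h2 1 x fun h' => h (interior_subset h')]
      exact fun h' => h (interior_subset h')

/-- Two-out-of-three for `∂V ⊆ W ⊆ V`, where `W = V \ interior V'`: the second inclusion is a
homotopy equivalence since `V'` retracts to its frontier, the composite because `V` is a homotopy
collar. -/
theorem exists_hCobordism (hU : IsPLManifold n U) {V V' : Set U} (hV : IsCollarEnd n V)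
    (hV' : IsCollarEnd n V') (hr : IsSDR {x : V' | x.val ∈ frontier V'}) (hVV' : V' ⊆ interior V)
    (hb : Disjoint V' ((𝓡∂ n).boundary U)) :
    ∃ _ : ChartedSpace (EuclideanHalfSpace n) (V \ interior V' : Set U),
      IsPLEmbedding n (Subtype.val : (V \ interior V' : Set U) → U) ∧
      IsCompactCobordism n
        {x : (V \ interior V' : Set U) | x.val ∈ frontier V ∨ x.val ∈ (𝓡∂ n).boundary U}
        {x | x.val ∈ frontier V'} ∧
      InclIsHomotopyEquiv
        {x : (V \ interior V' : Set U) | x.val ∈ frontier V ∨ x.val ∈ (𝓡∂ n).boundary U} := by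
  have hfV' : frontier V' ⊆ V' := hV'.isClosed.frontier_subset
  have hfV : ∀ x ∈ frontier V, x ∉ V' := fun x hx hx' => hx.2 (hVV' hx')
  have hcl : IsClosed (V \ interior V') := hV.isClosed.sdiff isOpen_interior
  obtain ⟨inst, hW, hemb, hbd⟩ := exists_submanifold hU (A := V \ interior V')
    (F := frontier V ∪ frontier V') (fun x hx hxF => by
      have h1 : x ∈ interior V := by
        by_contra h; exact hxF (Or.inl ⟨subset_closure hx.1, h⟩)
      have h2 : x ∈ V'ᶜ := fun h => hxF (Or.inr ⟨subset_closure h, hx.2⟩)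
      filter_upwards [isOpen_interior.mem_nhds h1, hV'.isClosed.isOpen_compl.mem_nhds h2] with y hy
        hy'
      exact ⟨interior_subset hy, fun h => hy' (interior_subset h)⟩) (by
      -- Near `frontier V` the piece coincides with `V`; near `frontier V'` it coincides with the
      -- complement of `interior V'`, whose flat charts are the reflected ones.
      rintro x (hx | hx)
      · refine (hV.isFlatAt x hx).congr ?_
        filter_upwards [hV'.isClosed.isOpen_compl.mem_nhds (hfV x hx)] with y hy
        exact propext ⟨fun h => ⟨h, fun h' => hy (interior_subset h')⟩, fun h => h.1⟩
      · refine (hV'.isFlatAt x hx).compl_interior.congr ?_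
        filter_upwards [isOpen_interior.mem_nhds (hVV' (hfV' hx))] with y hy
        exact propext ⟨fun h => ⟨interior_subset hy, h⟩, fun h => h.2⟩)
  have hcont : Continuous (Subtype.val : (V \ interior V' : Set U) → U) := continuous_subtype_val
  refine ⟨inst, hemb, ⟨hW, ?_, ?_, ?_, ?_, ?_⟩, ?_⟩
  -- The piece lies in the closure of the complement of `V'`, which is compact.
  · refine isCompact_iff_compactSpace.1 (hV'.isNhdOfInfinity.of_isClosed_subset hcl fun x hx => ?_)
    rw [closure_compl]
    exact hx.2
  · exact (isClosed_frontier.union hU.isClosed_boundary).preimage hcont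
  · exact isClosed_frontier.preimage hcont
  · rw [Set.disjoint_left]
    rintro x (hx | hx) hx'
    · exact hfV _ hx (hfV' hx')
    · exact hb.le_bot ⟨hfV' hx', hx⟩
  · rw [hbd]
    ext x
    simp only [mem_union, mem_ofPred_eq]
    tauto
  · let W : Set U := V \ interior V'
    let D : Set U := frontier V ∪ (𝓡∂ n).boundary U
    let g : W → V := inclusion sdiff_subset
    have hg : IsHE g := (isSDR_diff_interior hV'.isClosed (hVV'.trans interior_subset) hr).isHE
      (IsEmbedding.inclusion sdiff_subset) (by
        ext x
        exact ⟨fun ⟨y, hy⟩ => hy ▸ y.2.2, fun hx => ⟨⟨x.1, x.2, hx⟩, rfl⟩⟩)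
    let e : {x : W | x.val ∈ D} ≃ₜ {x : V | x.val ∈ D} :=
      { toFun := fun x => ⟨g x.1, x.2⟩
        invFun := fun x => ⟨⟨x.1.1, x.1.2, fun h => x.2.elim (fun h' => hfV _ h'
          (interior_subset h)) fun h' => hb.le_bot ⟨interior_subset h, h'⟩⟩, x.2⟩
        left_inv := fun _ => rfl
        right_inv := fun _ => rfl
        continuous_toFun := by fun_prop
        continuous_invFun := by fun_prop }
    exact IsHE.of_comp continuous_subtype_val hg
      ((inclIsHomotopyEquiv_iff.1 hV.homotopyEquiv).comp (isHE_homeomorph e))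

theorem exists_collarEnd_sequence (hU : IsPseudoCollar n U) : ∃ V : ℕ → Set U, V 0 = univ ∧
    (∀ i, IsCollarEnd n (V i)) ∧ (∀ i, IsSDR {x : V (i + 1) | x.val ∈ frontier (V (i + 1))}) ∧
    (∀ i, V (i + 1) ⊆ interior (V i)) ∧ (∀ i, Disjoint (V (i + 1)) ((𝓡∂ n).boundary U)) ∧
    ∀ x, ∃ i, (V i)ᶜ ∈ 𝓝 x := by
  have := hU.1.isPLManifold.t2
  have := hU.1.isPLManifold.secondCountable
  have : LocallyCompactSpace U := Manifold.locallyCompact_of_finiteDimensional (𝓡∂ n)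
  let K := CompactExhaustion.choice U
  have hQ : ∀ (i : ℕ) (V : {V : Set U // IsCollarEnd n V}), ∃ V' : {V : Set U // IsCollarEnd n V},
      V'.1 ⊆ interior V.1 ∩ (K i ∪ (𝓡∂ n).boundary U)ᶜ ∧
      IsSDR {x : V'.1 | x.val ∈ frontier V'.1} := by
    intro i V
    -- Besides nesting, each step avoids `∂U` and the next member of a compact exhaustion, so every
    -- point has a neighborhood that some `V i` misses.
    have h : IsNhdOfInfinity (interior V.1 ∩ (K i ∪ (𝓡∂ n).boundary U)ᶜ) := by
      have hc : IsCompact (closure V.1ᶜ ∪ (K i ∪ (𝓡∂ n).boundary U)) :=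
        V.2.isNhdOfInfinity.union ((K.isCompact i).union hU.1.isCompact_boundary)
      rw [IsNhdOfInfinity, compl_inter, compl_compl, ← closure_compl, hc.isClosed.closure_eq]
      exact hc
    obtain ⟨V', h1, h2, h3⟩ := exists_isCollarEnd hU h
      (disjoint_left.2 fun x hx hx' => hx.2 (Or.inr hx'))
    exact ⟨⟨V', h2⟩, h1, h3⟩
  choose next hnext hsdr using hQ
  let V : ℕ → {V : Set U // IsCollarEnd n V} := fun i =>
    Nat.rec ⟨univ, isCollarEnd_univ hU.1⟩ next i
  refine ⟨fun i => (V i).1, rfl, fun i => (V i).2, fun i => hsdr i (V i),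
    fun i => (hnext i (V i)).trans inter_subset_left,
    fun i => disjoint_left.2 fun x hx hx' => (hnext i (V i) hx).2 (Or.inr hx'), fun x => ?_⟩
  obtain ⟨i, hi⟩ := K.exists_mem_nhds x
  refine ⟨i + 1, ?_⟩
  filter_upwards [hi] with y hy hy'
  exact (hnext i (V i) hy').2 (Or.inl hy)

end Decomposition

/-- The induced map is a continuous bijection; it is closed because a closed set goes to a locally
finite union of closed sets. -/
theorem exists_homeomorph_adjunction {n : ℕ} [NeZero n] {U : Type*} [TopologicalSpace U]
    {S : HCobordismStack.{u} n} (f : ∀ i, S.W i → U)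
    (hf : ∀ i, IsClosedEmbedding (f i)) (hfin : LocallyFinite fun i => range (f i))
    (hcov : ∀ x, ∃ i, x ∈ range (f i)) (hh : ∀ i (x : S.N i), f i x = f (i + 1) (S.h i x))
    (hinj : ∀ i j, i < j → ∀ x y, f i x = f j y → S.incl i x = S.incl j y) :
    ∃ Φ : S.Adjunction ≃ₜ U, ∀ i x, Φ (S.incl i x) = f i x := by
  let F : S.Adjunction → U := Quot.lift (fun p => f p.1 p.2) (by
    rintro _ _ ⟨i, x⟩
    exact hh i x)
  have hF : ∀ i x, F (S.incl i x) = f i x := fun _ _ => rfl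
  have hFc : Continuous F := continuous_quot_lift _ (continuous_sigma fun i => (hf i).continuous)
  have hFi : Function.Injective F := by
    intro p q hpq
    obtain ⟨i, x, rfl⟩ := S.exists_incl_eq p
    obtain ⟨j, y, rfl⟩ := S.exists_incl_eq q
    rw [hF, hF] at hpq
    rcases lt_trichotomy i j with h | rfl | h
    · exact hinj i j h x y hpq
    · rw [(hf i).injective hpq]
    · exact (hinj j i h y x hpq.symm).symm
  have hFs : Function.Surjective F := by
    intro u
    obtain ⟨i, x, rfl⟩ := hcov u
    exact ⟨S.incl i x, rfl⟩
  have hFcl : IsClosedMap F := by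
    intro C hC
    have h1 : F '' C = ⋃ i, f i '' (S.incl i ⁻¹' C) := by
      ext u
      simp only [mem_image, mem_iUnion, mem_preimage]
      constructor
      · rintro ⟨p, hp, rfl⟩
        obtain ⟨i, x, rfl⟩ := S.exists_incl_eq p
        exact ⟨i, x, hp, rfl⟩
      · rintro ⟨i, x, hx, rfl⟩
        exact ⟨S.incl i x, hx, rfl⟩
    rw [h1]
    exact (hfin.subset fun i => image_subset_range _ _).isClosed_iUnion fun i =>
      (hf i).isClosedMap _ (hC.preimage (S.continuous_incl i))
  exact ⟨(isHomeomorph_iff_continuous_isClosedMap_bijective.2 ⟨hFc, hFcl, hFi, hFs⟩).homeomorph F,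
    hF⟩

section Decomposition

variable {n : ℕ} [NeZero n] {U : Type u} [TopologicalSpace U]
  [ChartedSpace (EuclideanHalfSpace n) U]

/-- The gluing map is the identity of a common subset of `U`; both of its charted structures are
compared with that of `U`. -/
theorem exists_isPLHomeo {X Y : Set U} [ChartedSpace (EuclideanHalfSpace n) X]
    [ChartedSpace (EuclideanHalfSpace n) Y] (hX : IsPLEmbedding n (Subtype.val : X → U))
    (hY : IsPLEmbedding n (Subtype.val : Y → U)) {s : Set X} {t : Set Y}
    (hst : Subtype.val '' s = Subtype.val '' t) :
    ∃ h : s ≃ₜ t, (∀ x, ((h x : Y) : U) = (x : X)) ∧ IsPLHomeo n h := by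
  have h1 : ∀ x : s, ∃ y : t, y.1.1 = x.1.1 := fun x => by
    obtain ⟨y, hy, h⟩ := hst ▸ mem_image_of_mem Subtype.val x.2
    exact ⟨⟨y, hy⟩, h⟩
  have h2 : ∀ y : t, ∃ x : s, x.1.1 = y.1.1 := fun y => by
    obtain ⟨x, hx, h⟩ := hst.symm ▸ mem_image_of_mem Subtype.val y.2
    exact ⟨⟨x, hx⟩, h⟩
  choose f hf using h1
  choose g hg using h2
  have hfc : Continuous f := by
    refine Continuous.subtype_mk (f := fun x => (f x).1) (Continuous.subtype_mk
      (f := fun x => (f x).1.1) ?_ fun x => (f x).1.2) fun x => (f x).2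
    simp only [hf]
    fun_prop
  have hgc : Continuous g := by
    refine Continuous.subtype_mk (f := fun x => (g x).1) (Continuous.subtype_mk
      (f := fun x => (g x).1.1) ?_ fun x => (g x).1.2) fun x => (g x).2
    simp only [hg]
    fun_prop
  refine ⟨⟨⟨f, g, fun x => Subtype.ext (Subtype.ext ((hg _).trans (hf _))),
    fun x => Subtype.ext (Subtype.ext ((hf _).trans (hg _)))⟩, hfc, hgc⟩, hf,
    isLocallyBiPL_iff.2 fun z => ?_⟩
  have h3 : BiPL (𝓝 z.1) (plCoord n z.1) (fun x : X => plCoord n z.1.1 x.1) := hX.2 z.1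
  have h4 : BiPL (𝓝 (f z).1) (plCoord n (f z).1) (fun y : Y => plCoord n (f z).1.1 y.1) :=
    hY.2 (f z).1
  have h5 := h4.comp_tendsto (f := fun x => (f x).1)
    (continuous_subtype_val.comp hfc).continuousAt
  simp only [hf] at h5
  exact (h3.comp_tendsto (f := fun x : s => x.1) continuous_subtype_val.continuousAt).trans h5.symm

theorem exists_hCobordismStack (hU : IsPseudoCollar n U) :
    ∃ S : HCobordismStack.{u} n, ∃ Φ : S.Adjunction ≃ₜ U,
      (∀ i, IsPLEmbedding n (fun x => Φ (S.incl i x))) ∧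
      (𝓡∂ n).boundary U = (fun x => Φ (S.incl 0 x)) '' S.M 0 := by
  obtain ⟨V, hV0, hV, hsdr, hsub, hdisj, hfin⟩ := exists_collarEnd_sequence hU
  have hanti : Antitone V := antitone_nat_of_succ_le fun i => (hsub i).trans interior_subset
  choose inst hemb hcob hhe using fun i =>
    exists_hCobordism hU.1.isPLManifold (hV i) (hV (i + 1)) (hsdr i) (hsub i) (hdisj i)
  have hfr : ∀ i, frontier (V i) ⊆ V i := fun i => (hV i).isClosed.frontier_subset
  have hN : ∀ i, Subtype.val '' {x : (V i \ interior (V (i + 1)) : Set U) |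
      x.val ∈ frontier (V (i + 1))} = frontier (V (i + 1)) := by
    intro i
    ext x
    constructor
    · rintro ⟨y, hy, rfl⟩
      exact hy
    · intro hx
      exact ⟨⟨x, interior_subset (hsub i (hfr _ hx)), hx.2⟩, hx, rfl⟩
  have hM : ∀ i, Subtype.val '' {x : (V i \ interior (V (i + 1)) : Set U) |
      x.val ∈ frontier (V i) ∨ x.val ∈ (𝓡∂ n).boundary U} =
      frontier (V i) ∪ V i ∩ (𝓡∂ n).boundary U := by
    intro i
    ext x
    constructor
    · rintro ⟨y, hy | hy, rfl⟩
      · exact Or.inl hy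
      · exact Or.inr ⟨y.2.1, hy⟩
    · rintro (hx | hx)
      · exact ⟨⟨x, hfr i hx, fun h => hx.2 (hsub i (interior_subset h))⟩, Or.inl hx, rfl⟩
      · exact ⟨⟨x, hx.1, fun h => (hdisj i).le_bot ⟨interior_subset h, hx.2⟩⟩, Or.inr hx.2, rfl⟩
  choose h hval hpl using fun i => exists_isPLHomeo (hemb i) (hemb (i + 1))
    ((hN i).trans (by rw [hM, (hdisj i).inter_eq, union_empty]))
  let S : HCobordismStack.{u} n :=
    { W := fun i => (V i \ interior (V (i + 1)) : Set U)
      M := fun i => {x | x.val ∈ frontier (V i) ∨ x.val ∈ (𝓡∂ n).boundary U}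
      N := fun i => {x | x.val ∈ frontier (V (i + 1))}
      oneSided := fun i => ⟨hcob i, Or.inl (hhe i)⟩
      homotopyEquiv := hhe
      h := h
      isPLHomeo := hpl }
  obtain ⟨Φ, hΦ⟩ := exists_homeomorph_adjunction (S := S) (fun i (x : S.W i) => x.val)
    (fun i => ((hV i).isClosed.sdiff isOpen_interior).isClosedEmbedding_subtypeVal) (by
      intro x
      obtain ⟨i, hi⟩ := hfin x
      refine ⟨_, hi, (finite_lt_nat i).subset ?_⟩
      rintro j ⟨_, ⟨y, rfl⟩, hy⟩
      by_contra hij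
      exact hy (hanti (not_lt.1 hij) y.2.1)) (by
      classical
      intro x
      have hex : ∃ i, x ∉ V i := by
        obtain ⟨i, hi⟩ := hfin x
        exact ⟨i, mem_of_mem_nhds hi⟩
      -- The piece containing `x` is the one before the first `V i` that misses `x`; that index is
      -- not 0 because `V 0` is everything.
      obtain ⟨i, hi⟩ : ∃ i, Nat.find hex = i + 1 := Nat.exists_eq_succ_of_ne_zero fun h0 => by
        have := Nat.find_spec hex
        rw [h0, hV0] at this
        exact this (mem_univ x)
      have h1 : x ∉ V (i + 1) := hi ▸ Nat.find_spec hex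
      have h2 : x ∈ V i := not_not.1 (Nat.find_min hex (by omega))
      exact ⟨i, ⟨x, h2, fun h => h1 (interior_subset h)⟩, rfl⟩)
    (fun i x => (hval i x).symm) (by
      rintro i j hij x y hxy
      -- A common point of pieces `i < j` lies in `V j`. For `j = i + 1` it is then on the frontier
      -- of `V (i + 1)`, which is the seam; for larger `j` it would lie in the interior of `V (i +
      -- 1)`, which was removed.
      have hy : x.val ∈ V j := hxy ▸ y.2.1
      rcases Nat.lt_iff_add_one_le.1 hij |>.eq_or_lt with rfl | hij'
      · have hx : x ∈ S.N i := ⟨subset_closure hy, x.2.2⟩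
        have : S.h i ⟨x, hx⟩ = y := Subtype.ext ((hval i ⟨x, hx⟩).trans hxy)
        rw [← this]
        exact (S.incl_h i ⟨x, hx⟩).symm
      · exact absurd (hsub _ (hanti hij' hy)) x.2.2)
  refine ⟨S, Φ, fun i => ?_, ?_⟩
  · have : (fun x => Φ (S.incl i x)) = fun x : S.W i => x.val := funext (hΦ i)
    rw [this]
    exact hemb i
  · have : (fun x => Φ (S.incl 0 x)) = fun x : S.W 0 => x.val := funext (hΦ 0)
    rw [this]
    refine Eq.trans ?_ (hM 0).symm
    rw [hV0]
    simp

end Decomposition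

/-- First part: the adjunction space carries the PL structure in which every piece `W i` is PL
embedded (such a structure is unique), and with it is a pseudo-collar with boundary `M 0`. Second
part: every pseudo-collar is PL homeomorphic to such an adjunction space (a homeomorphism that
restricts to a PL embedding of every piece). -/
theorem proposition4p3 (n : ℕ) [NeZero n] :
    (∀ S : HCobordismStack.{u} n,
      ∃ _ : ChartedSpace (EuclideanHalfSpace n) S.Adjunction,
        (∀ i, IsPLEmbedding n (S.incl i)) ∧
        IsPseudoCollar n S.Adjunction ∧
        (𝓡∂ n).boundary S.Adjunction = S.incl 0 '' S.M 0) ∧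
    (∀ (U : Type u) [TopologicalSpace U] [ChartedSpace (EuclideanHalfSpace n) U],
      IsPseudoCollar n U →
        ∃ S : HCobordismStack.{u} n, ∃ Φ : S.Adjunction ≃ₜ U,
          (∀ i, IsPLEmbedding n (fun x => Φ (S.incl i x))) ∧
          (𝓡∂ n).boundary U = (fun x => Φ (S.incl 0 x)) '' S.M 0) :=
  ⟨fun S => S.exists_isPseudoCollar, fun _ _ _ hU => exists_hCobordismStack hU⟩
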